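/- **Notation.** Work over $K=\mathbb{Q}(q^{1/2})$, with $\{k\}=q^{k/2}-q^{-k/2}$. Let $\Lambda=K[p_1,p_2,\dots]$ be the ring of symmetric functions with its Hall inner product, $s_\mu$ the Schur functions, $s_{\mu/\eta}$ the skew Schur functions ($\langle s_{\mu/\eta},s_\nu\rangle=\langle s_\mu,s_\eta s_\nu\rangle$), $\mu^t$ the transposed partition, $\kappa_\mu=\sum_i\mu_i(\mu_i-2i+1)$, and let $f(q^{\nu+\rho})$ be the value of $f\in\Lambda$ at the sequence $(q^{\nu_1-1/2},q^{\nu_2-3/2},\dots)$ (infinite geometric sums are read as rational functions, by expansion in $q^{-1}$). The (framed) topological vertex is $$C_{\mu_1\mu_2\mu_3}=q^{\kappa_{\mu_3}/2}s_{\mu_2}(q^\rho)\sum_\eta s_{\mu_1/\eta}(q^{\mu_2^t+\rho})\,s_{\mu_3^t/\eta}(q^{\mu_2+\rho}),\qquad C^{(f_1,f_2,f_3)}_{\mu_1\mu_2\mu_3}=q^{\sum_i f_i\kappa_{\mu_i}/2}\,C_{\mu_1\mu_2\mu_3}.$$ **Strips.** A strip $X$ with vertices $v_1,\dots,v_n$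 ($n\ge 1$) is the smooth toric Calabi–Yau threefold whose fan is the cone over a triangulation of a trapezoid in $\{0,1\}\times\mathbb{Z}\times\{1\}$ into unimodular triangles. The triangle dual to $v_k$ lies between the segments $[(0,a_{k-1}),(1,b_{k-1})]$ and $[(0,a_k),(1,b_k)]$, where $a_0=b_0=0$ and $(a_k,b_k)=(a_{k-1}+1,b_{k-1})$ if $v_k$ is of type $A$, $(a_k,b_k)=(a_{k-1},b_{k-1}+1)$ if $v_k$ is of type $B$. In the dual trivalent graph, drawn with the lattice point $(x,y)$ at $(y,-x)$, the vertical edge at $v_k$ points upward for type $A$ and downward for type $B$. Assume that $v_1$ is of type $A$. Let $Q_k$ be the Kähler parameter of the compact edge joining $v_k$ to $v_{k+1}$, and $Q_{i,j}=\prod_{l=i}^{j-1}Q_l$ ($=1$ for $i\ge j$). Put $\alpha_k=Q_{1,k}$ if $v_k$ is of type $A$ and $\beta_k=Q_{1,k}$ if $v_k$ is of type $B$. Write $e_1,e_2,e_3$ for the edge directions at a vertex, in the cyclic order for which $\det(e_1,e_2)=-1$ and with $e_3$ the vertical one: $e_1,e_2$ are the right, left edges for type $A$ and the left, right edges for type $B$.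 The leg of a brane on $e_i$ with framing $f$ is $e_{i+1}-fe_i$. The Aganagic–Vafa branes $L_1$ (on the left edge of $v_1$) and $L_2$ (on the right edge of $v_n$) have vertical legs, pointing up and down respectively. The auxiliary branes on the two halves of a compact edge have vertical, opposite legs. Thus the framings at every vertex are $(-1,0,0)$. **Partition function.** $Z_{X,L_1\cup L_2}$ is the sum over all partitions $\lambda_1,\dots,\lambda_{n-1}$ (one for each compact edge) and $\mu_1,\mu_2$ of $$\prod_{k=1}^n C^{(-1,0,0)}(v_k)\;\prod_{e=1}^{n-1}(-1)^{(f_e+f_e'+1)|\lambda_e|}Q_e^{|\lambda_e|}\;\; s_{\mu_1}^{L_1}\otimes s_{\mu_2}^{L_2}.$$ Here $C^{(-1,0,0)}(v_k)$ is the framed vertex whose entries are the partitions on the edges $e_1,e_2,e_3$ at $v_k$: $\lambda_k$ on its right edge, $\lambda_{k-1}^t$ on its left edge, $\mu_1$ at $L_1$, $\mu_2$ at $L_2$, and $\emptyset$ on vertical edges; $f_e,f'_e$ are the framings on the two halves of the edge $e$. It is a power series in the $Q_e$ and in the power sums $p_k^{L_1},p_k^{L_2}$. Let $Z_{X,\emptyset}$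 be its part with $\mu_1=\mu_2=\emptyset$ and $Z^{\mathrm{open}}_{X,L_1\cup L_2}=Z_{X,L_1\cup L_2}/Z_{X,\emptyset}$. **Plethystic exponentials.** $\mathrm{Exp}(x)=\exp\sum_{k\ge1}\frac1k\psi_k(x)$ and $\mathrm{Exp}'(x)=\exp\sum_{k\ge1}\frac{(-1)^{k+1}}k\psi_k(x)$, where the Adams operator $\psi_k$ sends $q^{1/2}\mapsto q^{k/2}$, $Q_e\mapsto Q_e^k$, $p_m\mapsto p_{km}$. **Theorem.** For every strip $X$ as above, $$Z^{\mathrm{open}}_{X,L_1\cup L_2}=\Psi_{\mathrm{annulus}}^{L_1-L_2}\cdot\prod_{k=1}^n\Psi_{\mathrm{disk}}^{v_k-L_1}\cdot\prod_{k=1}^n\Psi_{\mathrm{disk}}^{v_k-L_2},$$ where - $\Psi_{\mathrm{disk}}^{v_k-L_1}=\mathrm{Exp}\bigl(\tfrac{\alpha_k}{\{1\}}p_1^{L_1}\bigr)$ if $v_k$ is of type $A$, and $\mathrm{Exp}\bigl(\tfrac{-\beta_k}{\{1\}}p_1^{L_1}\bigr)$ if $v_k$ is of type $B$; - if $v_n$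 is of type $A$: $\Psi_{\mathrm{disk}}^{v_k-L_2}=\mathrm{Exp}'\bigl(\tfrac{Q_{k,n}}{\{1\}}p_1^{L_2}\bigr)$ for $v_k$ of type $A$, $\mathrm{Exp}'\bigl(\tfrac{-Q_{k,n}}{\{1\}}p_1^{L_2}\bigr)$ for $v_k$ of type $B$, and $\Psi_{\mathrm{annulus}}^{L_1-L_2}=\mathrm{Exp}'\bigl(Q_{1,n}\,p_1^{L_1}\otimes p_1^{L_2}\bigr)$; - if $v_n$ is of type $B$: $\Psi_{\mathrm{disk}}^{v_k-L_2}=\mathrm{Exp}\bigl(\tfrac{-Q_{k,n}}{\{1\}}p_1^{L_2}\bigr)$ for $v_k$ of type $A$, $\mathrm{Exp}\bigl(\tfrac{Q_{k,n}}{\{1\}}p_1^{L_2}\bigr)$ for $v_k$ of type $B$, and $\Psi_{\mathrm{annulus}}^{L_1-L_2}=\mathrm{Exp}\bigl(-Q_{1,n}\,p_1^{L_1}\otimes p_1^{L_2}\bigr)$. -/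

import Mathlib

noncomputable section

namespace TopVertex

/-! ## Scalars, partitions -/

/-- The field `ℚ(q^{1/2})` of rational functions in the variable `q^{1/2}`. -/
abbrev K : Type := RatFunc ℚ

/-- The element `q^{1/2}` of the scalar field. -/
def qHalf : K := RatFunc.X

/-- The quantum integer `{n} = q^{n/2} - q^{-n/2}`. -/
def qInt (n : ℕ) : K := qHalf ^ n - (qHalf ^ n)⁻¹

/-- There are finitely many partitions (Young diagrams) of a given size. -/
theorem finite_card_eq (n : ℕ) : {μ : YoungDiagram | μ.card = n}.Finite := by
  have h : Set.InjOn YoungDiagram.cells {μ : YoungDiagram | μ.card = n} :=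
    fun μ _ ν _ h => YoungDiagram.ext h
  refine Set.Finite.of_finite_image (Set.Finite.subset
    (Finset.finite_toSet (Finset.range n ×ˢ Finset.range n).powerset) ?_) h
  rintro _ ⟨μ, hμ, rfl⟩
  simp only [Finset.mem_coe, Finset.mem_powerset]
  rintro ⟨i, j⟩ hij
  have hij' : (i, j) ∈ μ := hij
  have hμ' : μ.cells.card = n := hμ
  have h1 : j < n := by
    have h2 := YoungDiagram.mem_iff_lt_rowLen.1 hij'
    have h3 : (μ.row i).card ≤ μ.cells.card := Finset.card_le_card (Finset.filter_subset _ _)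
    rw [← YoungDiagram.rowLen_eq_card] at h3
    omega
  have h2 : i < n := by
    have h2 := YoungDiagram.mem_iff_lt_colLen.1 hij'
    have h3 : (μ.col j).card ≤ μ.cells.card := Finset.card_le_card (Finset.filter_subset _ _)
    rw [← YoungDiagram.colLen_eq_card] at h3
    omega
  simp [h1, h2]

/-- The finite set of all partitions of `n`. -/
def partitionsOf (n : ℕ) : Finset YoungDiagram := (finite_card_eq n).toFinset

/-- `κ_μ = ∑_i μ_i (μ_i - 2 i + 1)`, `i = 1, 2, …` (in the code the row index starts at `0`). -/
def kappa (μ : YoungDiagram) : ℤ :=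
  ∑ i ∈ Finset.range (μ.colLen 0), (μ.rowLen i : ℤ) * (μ.rowLen i - 2 * (i + 1) + 1)

/-! ## Symmetric functions -/

/-- The ring of symmetric functions over `K`: the polynomial ring in the power sums `p_1, p_2, …`;
the variable with index `k` is `p_k`. -/
abbrev Sym : Type := MvPolynomial ℕ+ K

/-- Complete homogeneous symmetric functions, by Newton's identity
`n h_n = ∑_{k=1}^n p_k h_{n-k}`. -/
def hSym : ℕ → Sym
  | 0 => 1
  | n + 1 => MvPolynomial.C ((n + 1 : K)⁻¹) *
      ∑ i : Fin (n + 1), MvPolynomial.X (Nat.succPNat i) * hSym (n - i)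
  decreasing_by omega

/-- `h_n` for an integer index, with `h_n = 0` for `n < 0`. -/
def hSymInt (n : ℤ) : Sym := if 0 ≤ n then hSym n.toNat else 0

/-- The Schur function `s_μ = det (h_{μ_i - i + j})`. -/
def schur (μ : YoungDiagram) : Sym :=
  Matrix.det (Matrix.of fun i j : Fin (μ.colLen 0) =>
    hSymInt ((μ.rowLen i : ℤ) - (i : ℤ) + (j : ℤ)))

/-- `z_ρ = ∏_k k^{m_k} m_k!` for the partition `ρ` with `m_k` parts equal to `k`. -/
def zCoeff (a : ℕ+ →₀ ℕ) : ℕ := a.prod fun k c => (k : ℕ) ^ c * c.factorial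

/-- The standard (Hall) inner product of symmetric functions: `⟨p_ρ, p_σ⟩ = z_ρ δ_{ρσ}`. -/
def hall (f g : Sym) : K :=
  ∑ a ∈ f.support, MvPolynomial.coeff a f * MvPolynomial.coeff a g * (zCoeff a : K)

/-- The skew Schur function: the element `s_{μ/η}` with `⟨s_{μ/η}, s_ν⟩ = ⟨s_μ, s_η s_ν⟩` for all
`ν`, expanded in the orthonormal basis of Schur functions.  Only partitions `ν` of `|μ| - |η|` can
have a non-zero coefficient (if `|η| > |μ|`, the single summand `ν = ∅` vanishes too). -/
def skewSchur (μ η : YoungDiagram) : Sym :=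
  ∑ ν ∈ partitionsOf (μ.card - η.card), hall (schur μ) (schur η * schur ν) • schur ν

/-- The value of the power sum `p_k` at the infinite sequence
`q^{ν+ρ} = (q^{ν_1 - 1/2}, q^{ν_2 - 3/2}, …)`, that is `∑_{i ≥ 1} q^{k (ν_i - i + 1/2)}`, as a
rational function: the tail is the geometric series `∑_{i ≥ 1} q^{k (-i + 1/2)} = 1 / {k}`
(expansion in powers of `q^{-1}`), and finitely many terms are corrected. -/
def powerSumAt (ν : YoungDiagram) (k : ℕ+) : K :=
  (qInt k)⁻¹ + ∑ i ∈ Finset.range (ν.colLen 0),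
    (qHalf ^ ((k : ℤ) * (2 * (ν.rowLen i : ℤ) - 2 * (i : ℤ) - 1))
      - qHalf ^ ((k : ℤ) * (-2 * (i : ℤ) - 1)))

/-- The specialization `f(q^{ν+ρ})` of a symmetric function `f`. -/
def evalAt (ν : YoungDiagram) (f : Sym) : K := MvPolynomial.eval (powerSumAt ν) f

/-! ## The topological vertex -/

/-- The topological vertex
`C_{μ₁μ₂μ₃} = q^{κ_{μ₃}/2} s_{μ₂}(q^ρ) ∑_η s_{μ₁/η}(q^{μ₂ᵗ+ρ}) s_{μ₃ᵗ/η}(q^{μ₂+ρ})`.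
Only `η` with `|η| ≤ |μ₁|` contribute to the sum. -/
def vertexC (μ : Fin 3 → YoungDiagram) : K :=
  qHalf ^ kappa (μ 2) * evalAt ⊥ (schur (μ 1)) *
    ∑ d ∈ Finset.range ((μ 0).card + 1), ∑ η ∈ partitionsOf d,
      evalAt (μ 1).transpose (skewSchur (μ 0) η) * evalAt (μ 1) (skewSchur (μ 2).transpose η)

/-- The framed topological vertex
`q^{f₁ κ_{μ₁}/2 + f₂ κ_{μ₂}/2 + f₃ κ_{μ₃}/2} C_{μ₁μ₂μ₃}`. -/
def framedVertexC (f : Fin 3 → ℤ) (μ : Fin 3 → YoungDiagram) : K :=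
  qHalf ^ (∑ i, f i * kappa (μ i)) * vertexC μ

/-! ## Formal toric Calabi-Yau graphs with branes, and their partition functions -/

/-- What is found on a half-edge: the beginning or the end of a compact edge, a framed
Aganagic-Vafa brane on a non-compact edge, or nothing. -/
inductive Slot (E L : Type) : Type
  | source (e : E)
  | target (e : E)
  | brane (l : L)
  | free

/-- A formal toric Calabi-Yau graph with set of vertices `V`, set of compact edges `E` and a set `L`
of framed Aganagic-Vafa branes on non-compact edges, cut into trivalent vertices.
The three half-edges `e₁, e₂, e₃` at a vertex are indexed by `Fin 3`. -/
structure FTCY (V E L : Type) where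
  /-- the primitive integral direction of a half-edge, pointing away from the vertex -/
  vec : V × Fin 3 → ℤ × ℤ
  balanced : ∀ v, vec (v, 0) + vec (v, 1) + vec (v, 2) = 0
  /-- the three directions are unimodular, in the cyclic order of the standard vertex
  `e₁ = (1,-1)`, `e₂ = (-1,0)`, `e₃ = (0,1)` -/
  smooth : ∀ v, (vec (v, 0)).1 * (vec (v, 1)).2 - (vec (v, 0)).2 * (vec (v, 1)).1 = -1
  /-- the two half-edges that make up a compact edge -/
  src : E → V × Fin 3
  tgt : E → V × Fin 3
  /-- the half-edge that carries a brane -/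
  pos : L → V × Fin 3
  slot : V × Fin 3 → Slot E L
  slot_source : ∀ h e, slot h = .source e ↔ h = src e
  slot_target : ∀ h e, slot h = .target e ↔ h = tgt e
  slot_brane : ∀ h l, slot h = .brane l ↔ h = pos l
  /-- the framing of the brane placed on a half-edge (for a compact edge: of the auxiliary branes
  used for gluing; irrelevant on free half-edges) -/
  framing : V × Fin 3 → ℤ
  opposite : ∀ e, vec (tgt e) = - vec (src e)
  /-- the auxiliary branes on the two halves of a compact edge have opposing framings: their
  legs `e_{i+1} - f e_i` are opposite vectors -/
  opposing : ∀ e,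
    vec ((tgt e).1, (tgt e).2 + 1) - framing (tgt e) • vec (tgt e) =
      - (vec ((src e).1, (src e).2 + 1) - framing (src e) • vec (src e))

/-- The ring in which partition functions live: power series over `ℚ(q^{1/2})` in the Kähler
parameters `Q_e` (the variables `Sum.inl e`) and, for each brane `l`, the power sums `p_k^l`
(the variables `Sum.inr (l, k)`); the completion of `K[Q_e, e ∈ E] ⊗ Sym^{⊗ L}`. -/
abbrev Ser (E L : Type) : Type := MvPowerSeries (E ⊕ L × ℕ+) K

namespace FTCY

variable {V E L : Type}

/-- The partition on a half-edge, given partitions `lam` on the compact edges and `mu` on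
the branes: `lam e` on the first half of the edge `e` and its transpose on the second half, `mu l`
at the brane `l`, and the empty partition on a free half-edge. -/
def label (X : FTCY V E L) (lam : E → YoungDiagram) (mu : L → YoungDiagram) (h : V × Fin 3) :
    YoungDiagram :=
  match X.slot h with
  | .source e => lam e
  | .target e => (lam e).transpose
  | .brane l => mu l
  | .free => ⊥

variable [Fintype V] [Fintype E] [Fintype L] [DecidableEq E] [DecidableEq L]

/-- The contribution of one labelling to the Feynman sum (without the monomial `∏ Q_e^{|lam e|}`):
a framed topological vertex for every vertex, and the sign `(-1)^{(f + f' + 1) |lam e|}` for every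
compact edge, where `f` and `f'` are the framings on its two halves. -/
def weight (X : FTCY V E L) (lam : E → YoungDiagram) (mu : L → YoungDiagram) : K :=
  (∏ v, framedVertexC (fun i => X.framing (v, i)) (fun i => X.label lam mu (v, i))) *
    ∏ e, ((-1 : K) ^ (X.framing (X.src e) + X.framing (X.tgt e) + 1)) ^ (lam e).card

/-- The `p`-degree of a monomial at the brane `l`, where `p_k` has degree `k`. -/
def legDegree (m : (E ⊕ L × ℕ+) →₀ ℕ) (l : L) : ℕ :=
  m.sum fun x a => Sum.elim (fun _ => 0) (fun y => if y.1 = l then a * (y.2 : ℕ) else 0) x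

/-- The part of a monomial in the power sums of the brane `l`. -/
def legPart (m : (E ⊕ L × ℕ+) →₀ ℕ) (l : L) : ℕ+ →₀ ℕ :=
  m.comapDomain (fun k : ℕ+ => (Sum.inr (l, k) : E ⊕ L × ℕ+))
    (fun _ _ _ _ h => (Prod.mk.inj (Sum.inr.inj h)).2)

/-- The partition function
`Z_{X,L} = ∑_{lam, mu} weight lam mu * ∏_e Q_e^{|lam e|} * ∏_l s_{mu l}(p^l)`, given by its
coefficients: since `s_μ` is homogeneous of degree `|μ|`, only the finitely many labellings with
`|lam e|` the exponent of `Q_e` and `|mu l|` the `p^l`-degree contribute to a given monomial. -/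
def partitionFunction (X : FTCY V E L) : Ser E L := fun m =>
  ∑ lam ∈ Fintype.piFinset (fun e => partitionsOf (m (Sum.inl e))),
    ∑ mu ∈ Fintype.piFinset (fun l => partitionsOf (legDegree m l)),
      X.weight lam mu * ∏ l, MvPolynomial.coeff (legPart m l) (schur (mu l))

/-- The closed partition function `Z_{X,∅} = ∑_{lam} weight lam ∅ * ∏_e Q_e^{|lam e|}`: all
non-compact half-edges carry the empty partition.  It involves the variables `Q_e` only. -/
def closedPartitionFunction (X : FTCY V E L) : Ser E L := fun m =>
  if ∀ l, legPart m l = 0 then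
    ∑ lam ∈ Fintype.piFinset (fun e => partitionsOf (m (Sum.inl e))),
      X.weight lam (fun _ => ⊥)
  else 0

/-- The open partition function `Z_{X,L} / Z_{X,∅}`. -/
def openPartitionFunction (X : FTCY V E L) : Ser E L :=
  X.partitionFunction * (X.closedPartitionFunction)⁻¹

end FTCY

/-! ## Plethystic exponentials -/

section Plethysm

variable {E L : Type}

/-- The `k`-th Adams operator on scalars, `q^{1/2} ↦ q^{k/2}`. -/
def adamsK (k : ℕ+) : K →+* K :=
  RatFunc.mapRingHom (Polynomial.expand ℚ (k : ℕ)) (fun p hp => by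
    rw [Submonoid.mem_comap, mem_nonZeroDivisors_iff_ne_zero]
    exact (Polynomial.expand_ne_zero k.pos).2 (mem_nonZeroDivisors_iff_ne_zero.1 hp))

/-- The `k`-th Adams operator on monomials: `Q_e ↦ Q_e^k` and `p_n ↦ p_{kn}`. -/
def adamsMon (k : ℕ+) (m : (E ⊕ L × ℕ+) →₀ ℕ) : (E ⊕ L × ℕ+) →₀ ℕ :=
  m.sum fun x a => Sum.elim (fun e => Finsupp.single (Sum.inl e) (k * a))
    (fun y => Finsupp.single (Sum.inr (y.1, k * y.2)) a) x

/-- The `k`-th Adams operator `ψ_k`: it sends `∑ c_m m` to `∑ ψ_k(c_m) ψ_k(m)` (the map `ψ_k` on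
monomials is injective). -/
def adams (k : ℕ+) (x : Ser E L) : Ser E L :=
  Function.extend (adamsMon k) (fun m => adamsK k (MvPowerSeries.coeff m x)) (fun _ => 0)

/-- The exponential of a power series without constant term. -/
def expSer (x : Ser E L) : Ser E L := (PowerSeries.exp K).subst x

/-- The plethystic exponential `Exp(x) = exp (∑_{k ≥ 1} ψ_k(x) / k)`, for `x` without constant term
(then each coefficient of the sum is a finite sum). -/
def Exp (x : Ser E L) : Ser E L :=
  expSer fun m => ∑ᶠ k : ℕ+, (k : K)⁻¹ * MvPowerSeries.coeff m (adams k x)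

/-- The signed plethystic exponential `Exp'(x) = exp (∑_{k ≥ 1} (-1)^{k+1} ψ_k(x) / k)`. -/
def Exp' (x : Ser E L) : Ser E L :=
  expSer fun m =>
    ∑ᶠ k : ℕ+, (-1 : K) ^ ((k : ℕ) + 1) * (k : K)⁻¹ * MvPowerSeries.coeff m (adams k x)

end Plethysm

/-! ## Strips -/

/-- A vertex of a strip is of type `A` if its vertical edge points upward, of type `B` if it points
downward. -/
inductive VertexType : Type
  | A
  | B
  deriving DecidableEq

section Strip

variable {n : ℕ}

/-- The strip with vertices `v_1, …, v_{n+1}` (indexed by `Fin (n + 1)`) of types `ty` is the smooth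
toric Calabi-Yau threefold whose fan is the cone over the following triangulation of a trapezoid
in `{0,1} × ℤ × {1}`: the `k`-th triangle lies between the segments from `(0, top k)` to
`(1, bot k)` and from `(0, top (k+1))` to `(1, bot (k+1))`; a vertex of type `A` advances the end
point on the line `{0} × ℤ`, one of type `B` advances the end point on `{1} × ℤ`.
`top ty k` is the coordinate of the first end point. -/
def top (ty : Fin (n + 1) → VertexType) (k : ℕ) : ℤ :=
  ∑ j : Fin (n + 1), if (j : ℕ) < k ∧ ty j = .A then 1 else 0

/-- The coordinate of the second end point. -/
def bot (ty : Fin (n + 1) → VertexType) (k : ℕ) : ℤ :=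
  ∑ j : Fin (n + 1), if (j : ℕ) < k ∧ ty j = .B then 1 else 0

/-- The edge of the dual graph leaving `v_k` to the left: the outward normal to the left segment,
in the plane where a lattice point `(x, y)` is drawn at `(y, -x)`. -/
def leftVec (ty : Fin (n + 1) → VertexType) (k : ℕ) : ℤ × ℤ := (-1, top ty k - bot ty k)

/-- The edge leaving `v_k` to the right: the outward normal to the right segment. -/
def rightVec (ty : Fin (n + 1) → VertexType) (k : ℕ) : ℤ × ℤ :=
  (1, bot ty (k + 1) - top ty (k + 1))

/-- The edges at `v_k` in cyclic order, the vertical edge being `e₃`: `e₁, e₂, e₃` are the right,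
left, upward edges for type `A`, and the left, right, downward edges for type `B`. -/
def stripVec (ty : Fin (n + 1) → VertexType) (h : Fin (n + 1) × Fin 3) : ℤ × ℤ :=
  match ty h.1 with
  | .A => ![rightVec ty h.1, leftVec ty h.1, (0, 1)] h.2
  | .B => ![leftVec ty h.1, rightVec ty h.1, (0, -1)] h.2

/-- The index of the left edge. -/
def leftIdx : VertexType → Fin 3
  | .A => 1
  | .B => 0

/-- The index of the right edge. -/
def rightIdx : VertexType → Fin 3
  | .A => 0
  | .B => 1

/-- Compact edges join `v_k` to `v_{k+1}`; brane `0` (that is, `L_1`) sits on the left edge of the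
first vertex, brane `1` (that is, `L_2`) on the right edge of the last vertex. -/
def stripSlot (ty : Fin (n + 1) → VertexType) (h : Fin (n + 1) × Fin 3) : Slot (Fin n) (Fin 2) :=
  if h.2 = leftIdx (ty h.1) then
    Fin.cases (motive := fun _ => Slot (Fin n) (Fin 2)) (.brane 0) (fun e => .target e) h.1
  else if h.2 = rightIdx (ty h.1) then
    Fin.lastCases (motive := fun _ => Slot (Fin n) (Fin 2)) (.brane 1) (fun e => .source e) h.1
  else .free

/-- The framing `(f₁, f₂, f₃) = (-1, 0, 0)` at every vertex. -/
def stripFraming (h : Fin (n + 1) × Fin 3) : ℤ := if h.2 = 0 then -1 else 0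

theorem top_succ (ty : Fin (n + 1) → VertexType) (k : Fin (n + 1)) :
    top ty (k + 1) = top ty k + if ty k = .A then 1 else 0 := by
  have h : ∀ j : Fin (n + 1), (if (j : ℕ) < k + 1 ∧ ty j = .A then (1 : ℤ) else 0) =
      (if (j : ℕ) < k ∧ ty j = .A then 1 else 0) + if j = k then (if ty k = .A then 1 else 0) else 0 := by
    intro j
    by_cases hj : j = k
    · subst hj; simp
    · have : (j : ℕ) ≠ k := fun h => hj (Fin.ext h)
      have h2 : (j : ℕ) < k + 1 ↔ (j : ℕ) < k := by omega
      simp [hj, h2]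
  simp only [top, h, Finset.sum_add_distrib, Finset.sum_ite_eq', Finset.mem_univ, if_true]

theorem bot_succ (ty : Fin (n + 1) → VertexType) (k : Fin (n + 1)) :
    bot ty (k + 1) = bot ty k + if ty k = .B then 1 else 0 := by
  have h : ∀ j : Fin (n + 1), (if (j : ℕ) < k + 1 ∧ ty j = .B then (1 : ℤ) else 0) =
      (if (j : ℕ) < k ∧ ty j = .B then 1 else 0) + if j = k then (if ty k = .B then 1 else 0) else 0 := by
    intro j
    by_cases hj : j = k
    · subst hj; simp
    · have : (j : ℕ) ≠ k := fun h => hj (Fin.ext h)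
      have h2 : (j : ℕ) < k + 1 ↔ (j : ℕ) < k := by omega
      simp [hj, h2]
  simp only [bot, h, Finset.sum_add_distrib, Finset.sum_ite_eq', Finset.mem_univ, if_true]

theorem stripVec_left (ty : Fin (n + 1) → VertexType) (k : Fin (n + 1)) :
    stripVec ty (k, leftIdx (ty k)) = leftVec ty k := by
  unfold stripVec leftIdx
  cases ty k <;> simp

theorem stripVec_right (ty : Fin (n + 1) → VertexType) (k : Fin (n + 1)) :
    stripVec ty (k, rightIdx (ty k)) = rightVec ty k := by
  unfold stripVec rightIdx
  cases ty k <;> simp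

/-- With these framings every leg on a left edge points upward. -/
theorem stripLeg_left (ty : Fin (n + 1) → VertexType) (k : Fin (n + 1)) :
    stripVec ty (k, leftIdx (ty k) + 1) -
      stripFraming (k, leftIdx (ty k)) • stripVec ty (k, leftIdx (ty k)) = (0, 1) := by
  have h1 := top_succ ty k
  have h2 := bot_succ ty k
  cases h : ty k <;>
    simp [h, stripVec, stripFraming, leftIdx, leftVec, rightVec] at h1 h2 ⊢
  omega

/-- With these framings every leg on a right edge points downward. -/
theorem stripLeg_right (ty : Fin (n + 1) → VertexType) (k : Fin (n + 1)) :
    stripVec ty (k, rightIdx (ty k) + 1) -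
      stripFraming (k, rightIdx (ty k)) • stripVec ty (k, rightIdx (ty k)) = (0, -1) := by
  have h1 := top_succ ty k
  have h2 := bot_succ ty k
  cases h : ty k <;>
    simp [h, stripVec, stripFraming, rightIdx, leftVec, rightVec] at h1 h2 ⊢
  omega

theorem leftIdx_ne_rightIdx (t : VertexType) : leftIdx t ≠ rightIdx t := by
  cases t <;> decide

/-- The formal toric Calabi-Yau graph of a strip with its two branes.  Both branes have vertical
legs: that of `L_1` points upward and that of `L_2` downward; likewise for the auxiliary branes
on the compact edges. -/
def strip (ty : Fin (n + 1) → VertexType) : FTCY (Fin (n + 1)) (Fin n) (Fin 2) where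
  vec := stripVec ty
  balanced v := by
    have h1 := top_succ ty v
    have h2 := bot_succ ty v
    cases h : ty v <;> simp [h, stripVec, leftVec, rightVec] at h1 h2 ⊢ <;> omega
  smooth v := by
    have h1 := top_succ ty v
    have h2 := bot_succ ty v
    cases h : ty v <;> simp [h, stripVec, leftVec, rightVec] at h1 h2 ⊢ <;> omega
  src e := (e.castSucc, rightIdx (ty e.castSucc))
  tgt e := (e.succ, leftIdx (ty e.succ))
  pos l := if l = 0 then (0, leftIdx (ty 0)) else (Fin.last n, rightIdx (ty (Fin.last n)))
  slot := stripSlot ty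
  slot_source := by
    rintro ⟨v, i⟩ e
    unfold stripSlot
    dsimp only
    split_ifs with h1 h2
    · refine ⟨fun h => ?_, fun h => ?_⟩
      · induction v using Fin.cases <;> simp at h
      · simp only [Prod.mk.injEq] at h
        obtain ⟨rfl, rfl⟩ := h
        exact absurd h1.symm (leftIdx_ne_rightIdx _)
    · subst h2
      induction v using Fin.lastCases with
      | last => simp [(Fin.castSucc_lt_last e).ne']
      | cast j =>
        simp only [Fin.lastCases_castSucc, Slot.source.injEq, Prod.mk.injEq, Fin.castSucc_inj]
        exact ⟨fun h => by subst h; simp, fun h => h.1⟩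
    · simp only [reduceCtorEq, Prod.mk.injEq, false_iff, not_and]
      rintro rfl
      exact h2
  slot_target := by
    rintro ⟨v, i⟩ e
    unfold stripSlot
    dsimp only
    split_ifs with h1 h2
    · subst h1
      induction v using Fin.cases with
      | zero => simp [(Fin.succ_ne_zero e).symm]
      | succ j =>
        simp only [Fin.cases_succ, Slot.target.injEq, Prod.mk.injEq, Fin.succ_inj]
        exact ⟨fun h => by subst h; simp, fun h => h.1⟩
    · refine ⟨fun h => ?_, fun h => ?_⟩
      · induction v using Fin.lastCases <;> simp at h
      · simp only [Prod.mk.injEq] at h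
        obtain ⟨rfl, rfl⟩ := h
        exact absurd rfl h1
    · simp only [reduceCtorEq, Prod.mk.injEq, false_iff, not_and]
      rintro rfl
      exact h1
  slot_brane := by
    rintro ⟨v, i⟩ l
    unfold stripSlot
    dsimp only
    have hl : l = 0 ∨ l = 1 := by omega
    split_ifs with h1 h2 h3 h4 h5
    · subst h1 h2
      induction v using Fin.cases <;> simp
    · have hl' : l = 1 := by tauto
      subst h1 hl'
      refine ⟨fun h => ?_, fun h => ?_⟩
      · induction v using Fin.cases <;> simp at h
      · simp only [Prod.mk.injEq] at h
        obtain ⟨rfl, h⟩ := h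
        exact absurd h (leftIdx_ne_rightIdx _)
    · subst h3 h4
      refine ⟨fun h => ?_, fun h => ?_⟩
      · induction v using Fin.lastCases <;> simp at h
      · simp only [Prod.mk.injEq] at h
        obtain ⟨rfl, h⟩ := h
        exact absurd h.symm (leftIdx_ne_rightIdx _)
    · have hl' : l = 1 := by tauto
      subst h3 hl'
      induction v using Fin.lastCases with
      | last => simp
      | cast j => simp [(Fin.castSucc_lt_last j).ne]
    · simp only [reduceCtorEq, Prod.mk.injEq, false_iff, not_and]
      rintro rfl
      exact h1
    · simp only [reduceCtorEq, Prod.mk.injEq, false_iff, not_and]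
      rintro rfl
      exact h3
  framing := stripFraming
  opposite e := by
    rw [stripVec_left, stripVec_right]
    simp [leftVec, rightVec]
  opposing e := by
    rw [stripLeg_left, stripLeg_right]
    simp

/-- `Q_{i,j} = ∏_{i ≤ l < j} Q_l` (equal to `1` if `i ≥ j`), where `Q_l` is the Kähler parameter of
the edge joining `v_l` to `v_{l+1}`. -/
def QProd (i j : Fin (n + 1)) : Ser (Fin n) (Fin 2) :=
  ∏ l : Fin n, if i ≤ l.castSucc ∧ l.castSucc < j then MvPowerSeries.X (Sum.inl l) else 1

/-- The power sum `p_1` of the brane `L_1` (for `l = 0`) or `L_2` (for `l = 1`). -/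
def p1 (l : Fin 2) : Ser (Fin n) (Fin 2) := MvPowerSeries.X (Sum.inr (l, 1))

/-- The scalar `1 / {1}`. -/
def invQ1 : Ser (Fin n) (Fin 2) := MvPowerSeries.C (qInt 1)⁻¹

/-- The disk factor for `v_k` and `L_1`.  Here `α_k = Q_{1,k}` if `v_k` is of type `A`, and
`β_k = Q_{1,k}` if `v_k` is of type `B`. -/
def diskL1 (ty : Fin (n + 1) → VertexType) (k : Fin (n + 1)) : Ser (Fin n) (Fin 2) :=
  match ty k with
  | .A => Exp (QProd 0 k * invQ1 * p1 0)
  | .B => Exp (-QProd 0 k * invQ1 * p1 0)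

/-- The disk factor for `v_k` and `L_2`; the cases are the types of `v_k` and of the last
vertex. -/
def diskL2 (ty : Fin (n + 1) → VertexType) (k : Fin (n + 1)) : Ser (Fin n) (Fin 2) :=
  match ty k, ty (Fin.last n) with
  | .A, .A => Exp' (QProd k (Fin.last n) * invQ1 * p1 1)
  | .B, .A => Exp' (-QProd k (Fin.last n) * invQ1 * p1 1)
  | .A, .B => Exp (-QProd k (Fin.last n) * invQ1 * p1 1)
  | .B, .B => Exp (QProd k (Fin.last n) * invQ1 * p1 1)

/-- The annulus factor for `L_1` and `L_2`. -/
def annulus (ty : Fin (n + 1) → VertexType) : Ser (Fin n) (Fin 2) :=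
  match ty (Fin.last n) with
  | .A => Exp' (QProd 0 (Fin.last n) * p1 0 * p1 1)
  | .B => Exp (-QProd 0 (Fin.last n) * p1 0 * p1 1)

end Strip

end TopVertex

end

/-! Every vertex of a strip has an empty vertical leg. In the framing `(-1, 0, 0)` such a vertex is
a matrix element of vertex operators: with `a_k = 1/{k}`, the power sums of `q^ρ`, it is the Hall
pairing of `s_μ` with `exp(∑ a_k p_k / k) · s_ν(p + a)`, in other words `⟨μ| Γ_-(a) Γ_+(a) |ν⟩`
(`framedVertexC_eq`). A vertex of type `A` contributes the family `a`. Type `B` has left and right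
exchanged and contributes `ω a`, because the pairing is symmetric (`vertexPairing_comm`) and
compatible with the involution `ω` (`vertexPairing_om`). The transpose on the second half of each
edge makes neighbouring matrix elements composable, and the sign of an edge is the product of signs
attached to its two ends. So the partition function is a chain of operators (`weight_strip`).

The chain is summed from the left. A Schur function passes through a vertex by `∑_μ s_μ(Y) ⟨μ|…|ν⟩ =
exp(∑ a_k Y_k / k) s_ν(Y + a)` (`hasSum_schurAt_mul_vertexPairing`), and an edge with parameter `t`
replaces `Y_k` by `t^k Y_k`. Starting from the power sums of `L_1`, exponential prefactors split off
and the argument collects the parameters of the vertices passed (`hasSum_chainTerm`); the Cauchy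
identity closes the chain at `L_2`. The exponents are products of two sources: vertex with vertex
gives the closed partition function, vertex with brane gives the disks, brane with brane gives the
annulus. Each factor is the exponential of a family `ψ_k(x)/k` for a monomial `x`, up to signs,
hence an `Exp` or an `Exp'`.

The main work is to recognize the vertex. The pairing is a determinant of one-row matrix elements
(`vertexPairing_eq_det`). At `q^ρ` these have a closed form (`hookEntry_aRho`) in which row and
column interact only through `h_n(x_m + ω q^ρ)`, and the bialternant formula `det_hAt_eq` turns the
determinant into a Schur function at `q^{μᵗ+ρ}` (`vertexPairing_aRho`). The facts needed on Schur
functions (orthonormality, completeness, Cauchy identity, transposition) are derived from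
Jacobi-Trudi and the power sum form of the Hall product. -/

noncomputable section
namespace TopVertex
open MvPolynomial Finset

/-! ### Complete homogeneous functions at a specialization of the power sums -/

section Specialization

variable {R : Type*} [CommRing R] [Algebra K R]

/-- The value of `h_n` at the specialization `p_k ↦ X k`. -/
def hAt (X : ℕ+ → R) (n : ℕ) : R := aeval X (hSym n)

/-- The value of `h_n`, for an integer index. -/
def hAtInt (X : ℕ+ → R) (n : ℤ) : R := if 0 ≤ n then hAt X n.toNat else 0

/-- The value of `s_μ` at the specialization `p_k ↦ X k`. -/
def schurAt (X : ℕ+ → R) (μ : YoungDiagram) : R := aeval X (schur μ)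

theorem aeval_hSymInt (X : ℕ+ → R) (n : ℤ) : aeval X (hSymInt n) = hAtInt X n := by
  unfold hSymInt hAtInt
  split_ifs <;> simp [hAt]

theorem hAtInt_natCast (X : ℕ+ → R) (n : ℕ) : hAtInt X n = hAt X n := by simp [hAtInt]

theorem hAtInt_neg (X : ℕ+ → R) {n : ℤ} (hn : n < 0) : hAtInt X n = 0 := by
  simp [hAtInt, not_le.2 hn]

theorem hAt_zero (X : ℕ+ → R) : hAt X 0 = 1 := by simp [hAt, hSym]

theorem hSym_eq_hAt (n : ℕ) : hSym n = hAt (X : ℕ+ → Sym) n := by simp [hAt]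

/-- The generating series of the power sums, shifted by one. -/
def pSeries (X : ℕ+ → R) : PowerSeries R := PowerSeries.mk fun i => X (Nat.succPNat i)

/-- The generating series of the complete homogeneous functions. -/
def hSeries (X : ℕ+ → R) : PowerSeries R := PowerSeries.mk (hAt X)

theorem hAt_succ (X : ℕ+ → R) (n : ℕ) :
    ((n : R) + 1) * hAt X (n + 1) = ∑ p ∈ antidiagonal n, X (Nat.succPNat p.1) * hAt X p.2 := by
  have hK : ((n : K) + 1) ≠ 0 := by exact_mod_cast Nat.succ_ne_zero n
  have h1 : ((n : R) + 1) = algebraMap K R ((n : K) + 1) := by simp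
  rw [hAt, hSym, map_mul, algHom_C, h1, ← mul_assoc, ← map_mul, mul_inv_cancel₀ hK, map_one,
    one_mul, map_sum, Finset.Nat.sum_antidiagonal_eq_sum_range_succ_mk, Finset.sum_range]
  simp [hAt]

theorem cast_succ_mul_cancel {n : ℕ} {x y : R} (h : ((n : R) + 1) * x = ((n : R) + 1) * y) :
    x = y := by
  have hK : ((n : K) + 1) ≠ 0 := by exact_mod_cast Nat.succ_ne_zero n
  have h1 : ((n : R) + 1) = algebraMap K R ((n : K) + 1) := by simp
  rw [h1] at h
  have := congrArg (fun z => algebraMap K R ((n : K) + 1)⁻¹ * z) h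
  simpa only [← mul_assoc, ← map_mul, inv_mul_cancel₀ hK, map_one, one_mul] using this

/-- Newton's identities read as the differential equation `H' = P H`. Together with the uniqueness
in `eq_hSeries`, every identity between such series can be checked by differentiating. -/
theorem derivative_hSeries (X : ℕ+ → R) :
    PowerSeries.derivative R (hSeries X) = pSeries X * hSeries X := by
  ext n
  rw [PowerSeries.coeff_derivative, PowerSeries.coeff_mul, mul_comm]
  simp only [hSeries, pSeries, PowerSeries.coeff_mk]
  exact hAt_succ X n

/-- Newton's identities determine the complete homogeneous functions. -/
theorem eq_hSeries (X : ℕ+ → R) (F : PowerSeries R) (h0 : PowerSeries.coeff 0 F = 1)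
    (h : PowerSeries.derivative R F = pSeries X * F) : F = hSeries X := by
  ext n
  induction n using Nat.strong_induction_on with
  | _ n ih =>
    rcases n with _ | n
    · rw [h0]; simp [hSeries, hAt_zero]
    · apply cast_succ_mul_cancel (n := n)
      have e1 := congrArg (PowerSeries.coeff n) h
      have e2 := congrArg (PowerSeries.coeff n) (derivative_hSeries X)
      rw [PowerSeries.coeff_derivative, PowerSeries.coeff_mul, mul_comm] at e1 e2
      rw [e1, e2]
      refine Finset.sum_congr rfl fun p hp => ?_
      rw [ih p.2 (by have := mem_antidiagonal.1 hp; omega)]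

/-- Formally `H = exp(∑ p_k t^k / k)`, so adding alphabets multiplies generating series. Negative
alphabets are allowed, which is what makes inverse series available later. -/
theorem hSeries_add (X Y : ℕ+ → R) : hSeries (X + Y) = hSeries X * hSeries Y := by
  refine (eq_hSeries _ _ ?_ ?_).symm
  · simp [PowerSeries.coeff_mul, hSeries, hAt_zero]
  · rw [Derivation.leibniz, derivative_hSeries, derivative_hSeries]
    have : pSeries (X + Y) = pSeries X + pSeries Y := by ext; simp [pSeries]
    rw [this, smul_eq_mul, smul_eq_mul]; ring

theorem hAt_add (X Y : ℕ+ → R) (n : ℕ) :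
    hAt (X + Y) n = ∑ p ∈ antidiagonal n, hAt X p.1 * hAt Y p.2 := by
  have := congrArg (PowerSeries.coeff n) (hSeries_add X Y)
  simpa [PowerSeries.coeff_mul, hSeries] using this

theorem hSeries_zero : hSeries (0 : ℕ+ → R) = 1 := by
  refine (eq_hSeries _ _ (by simp) ?_).symm
  have : pSeries (0 : ℕ+ → R) = 0 := by ext; simp [pSeries]
  rw [this, zero_mul, PowerSeries.derivative_one]

theorem hAt_zero_fun (n : ℕ) : hAt (0 : ℕ+ → R) n = if n = 0 then 1 else 0 := by
  have := congrArg (PowerSeries.coeff n) (hSeries_zero (R := R))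
  simpa [PowerSeries.coeff_one, hSeries] using this

theorem hSeries_sum {ι : Type*} (s : Finset ι) (X : ι → ℕ+ → R) :
    hSeries (∑ i ∈ s, X i) = ∏ i ∈ s, hSeries (X i) := by
  classical
  induction s using Finset.induction_on with
  | empty => simp [hSeries_zero]
  | insert a s ha ih => rw [Finset.sum_insert ha, Finset.prod_insert ha, hSeries_add, ih]

theorem hAt_mul_pow (c : R) (X : ℕ+ → R) (n : ℕ) :
    hAt (fun k => c ^ (k : ℕ) * X k) n = c ^ n * hAt X n := by
  have : PowerSeries.rescale c (hSeries X) = hSeries (fun k => c ^ (k : ℕ) * X k) := by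
    refine eq_hSeries _ _ (by simp [hSeries, hAt_zero]) ?_
    ext n
    have h := hAt_succ X n
    rw [PowerSeries.coeff_derivative, PowerSeries.coeff_mul]
    simp only [PowerSeries.coeff_rescale, hSeries, pSeries, PowerSeries.coeff_mk]
    rw [mul_assoc, mul_comm (hAt X (n + 1)), h, Finset.mul_sum]
    refine Finset.sum_congr rfl fun p hp => ?_
    rw [← mem_antidiagonal.1 hp, Nat.succPNat_coe, Nat.succ_eq_add_one]
    ring
  have := congrArg (PowerSeries.coeff n) this
  simpa [hSeries] using this.symm

theorem hAt_pow (c : R) (n : ℕ) : hAt (fun k => c ^ (k : ℕ)) n = c ^ n := by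
  have : PowerSeries.mk (fun n => c ^ n) = hSeries (fun k => c ^ (k : ℕ)) := by
    refine eq_hSeries _ _ (by simp) ?_
    ext n
    rw [PowerSeries.coeff_derivative, PowerSeries.coeff_mul]
    simp only [pSeries, PowerSeries.coeff_mk]
    rw [Finset.sum_congr rfl (g := fun _ => c ^ (n + 1))]
    · simp; ring
    · intro p hp
      rw [← mem_antidiagonal.1 hp, Nat.succPNat_coe, Nat.succ_eq_add_one]
      ring
  have := congrArg (PowerSeries.coeff n) this
  simpa [hSeries] using this.symm

theorem map_hAt {R' : Type*} [CommRing R'] [Algebra K R'] (f : R →ₐ[K] R') (X : ℕ+ → R) (n : ℕ) :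
    f (hAt X n) = hAt (fun k => f (X k)) n := by
  have := comp_aeval_apply (f := X) f (hSym n)
  exact this

theorem map_schurAt {R' : Type*} [CommRing R'] [Algebra K R'] (f : R →ₐ[K] R') (X : ℕ+ → R)
    (μ : YoungDiagram) : f (schurAt X μ) = schurAt (fun k => f (X k)) μ :=
  comp_aeval_apply (f := X) f (schur μ)

end Specialization

/-! ### Weights of monomials and the power sum expansion of `h_n` -/

/-- The weight `∑ k m_k` of a monomial in the power sums. -/
def wt (ρ : ℕ+ →₀ ℕ) : ℕ := ρ.sum fun k c => k * c

theorem wt_add (ρ σ : ℕ+ →₀ ℕ) : wt (ρ + σ) = wt ρ + wt σ :=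
  Finsupp.sum_add_index' (by simp) (by intros; ring)

theorem wt_single (k : ℕ+) (c : ℕ) : wt (Finsupp.single k c) = k * c :=
  Finsupp.sum_single_index (by simp)

theorem zCoeff_add_single (ρ : ℕ+ →₀ ℕ) (k : ℕ+) :
    zCoeff (ρ + Finsupp.single k 1) = k * (ρ k + 1) * zCoeff ρ := by
  classical
  unfold zCoeff
  rw [Finsupp.prod_of_support_subset (s := insert k ρ.support), 
    Finsupp.prod_of_support_subset ρ (s := insert k ρ.support) (by simp),
    ← Finset.mul_prod_erase _ _ (mem_insert_self k _),
    ← Finset.mul_prod_erase _ _ (mem_insert_self k _)]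
  · rw [Finset.prod_congr rfl (g := fun x : ℕ+ => (x : ℕ) ^ ρ x * (ρ x).factorial)]
    · simp [pow_succ, Nat.factorial_succ]; ring
    · intro x hx
      have : k ≠ x := (ne_of_mem_erase hx).symm
      simp [this]
  · simp
  · intro x hx
    by_cases hxk : x = k
    · simp [hxk]
    · have : ¬ k = x := fun h => hxk h.symm
      simp [this] at hx
      simp [hx]
  · simp

theorem zCoeff_ne_zero (ρ : ℕ+ →₀ ℕ) : zCoeff ρ ≠ 0 := by
  unfold zCoeff
  refine Finset.prod_ne_zero_iff.2 fun k _ => ?_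
  exact mul_ne_zero (pow_ne_zero _ k.pos.ne') (Nat.factorial_ne_zero _)

theorem coeff_X_mul_eq (k : ℕ+) (ρ : ℕ+ →₀ ℕ) (f : Sym) :
    coeff (ρ + Finsupp.single k 1) (X k * f) = coeff ρ f := by
  rw [add_comm, coeff_X_mul]

/-- Induction along Newton's recursion: removing one part `k` divides `z_ρ` by `k m_k`, so the terms
of the recursion are `z_ρ⁻¹` with weights `k m_k`, and these weights add up to `n`. -/
theorem coeff_hSym (n : ℕ) (ρ : ℕ+ →₀ ℕ) :
    coeff ρ (hSym n) = if wt ρ = n then (zCoeff ρ : K)⁻¹ else 0 := by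
  classical
  induction n using Nat.strong_induction_on generalizing ρ with
  | _ n ih =>
  rcases n with _ | n
  · have h0 : wt ρ = 0 ↔ ρ = 0 := by
      constructor
      · intro h
        ext k
        unfold wt Finsupp.sum at h
        rw [Finset.sum_eq_zero_iff] at h
        by_contra hk
        have := h k (by simpa using hk)
        simp at this
        exact hk (by simpa using this)
      · rintro rfl; simp [wt]
    simp only [hSym, h0]
    rw [MvPolynomial.coeff_one]
    by_cases h : ρ = 0
    · subst h; simp [zCoeff]
    · simp [h, Ne.symm h]
  · apply cast_succ_mul_cancel (n := n)
    have h1 := congrArg (coeff ρ) (hAt_succ (X : ℕ+ → Sym) n)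
    simp only [← hSym_eq_hAt] at h1
    have e : ((n : Sym) + 1) = C ((n : K) + 1) := by simp
    rw [e, coeff_C_mul, coeff_sum] at h1
    rw [h1]
    have h2 : ∀ p ∈ antidiagonal n, coeff ρ (X (Nat.succPNat p.1) * hSym p.2) =
        if wt ρ = n + 1 then ((p.1 : K) + 1) * ρ (Nat.succPNat p.1) * (zCoeff ρ : K)⁻¹ else 0 := by
      intro p hp
      have hp' := mem_antidiagonal.1 hp
      by_cases hk : ρ (Nat.succPNat p.1) = 0
      · rw [coeff_X_mul', if_neg (by simpa using hk)]
        simp [hk]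
      · obtain ⟨σ, rfl⟩ : ∃ σ, ρ = σ + Finsupp.single (Nat.succPNat p.1) 1 :=
          ⟨ρ - Finsupp.single (Nat.succPNat p.1) 1, (tsub_add_cancel_of_le (by
            simpa using Nat.one_le_iff_ne_zero.2 hk)).symm⟩
        rw [coeff_X_mul_eq, ih p.2 (by omega), wt_add, wt_single, zCoeff_add_single]
        have e2 : wt σ = p.2 ↔ wt σ + (Nat.succPNat p.1 : ℕ) * 1 = n + 1 := by
          rw [Nat.succPNat_coe]; omega
        simp only [e2]
        split_ifs
        · have hz : (zCoeff σ : K) ≠ 0 := by exact_mod_cast zCoeff_ne_zero σ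
          have h3 : ((p.1 : K) + 1) ≠ 0 := by exact_mod_cast Nat.succ_ne_zero p.1
          have h4 : ((σ (Nat.succPNat p.1) : K) + 1) ≠ 0 := by
            exact_mod_cast Nat.succ_ne_zero (σ (Nat.succPNat p.1))
          simp only [Finsupp.add_apply, Finsupp.single_eq_same, Nat.succPNat_coe,
            Nat.succ_eq_add_one]
          push_cast
          field_simp
        · rfl
    rw [Finset.sum_congr rfl h2]
    split_ifs with hw
    · rw [← Finset.sum_mul]
      congr 1
      rw [Finset.Nat.sum_antidiagonal_eq_sum_range_succ_mk]
      have h5 : wt ρ = ∑ i ∈ range (n + 1), (i + 1) * ρ (Nat.succPNat i) := by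
        unfold wt Finsupp.sum
        rw [← Finset.sum_filter_of_ne (s := range (n + 1)) (p := fun i => ρ (Nat.succPNat i) ≠ 0)
          (fun x _ h h' => h (by simp [h']))]
        refine Finset.sum_bij' (fun k _ => k.natPred) (fun i _ => Nat.succPNat i) ?_ ?_ ?_ ?_ ?_
        · intro k hk
          simp only [mem_filter, mem_range, PNat.succPNat_natPred]
          have hk' := Finsupp.mem_support_iff.1 hk
          refine ⟨?_, hk'⟩
          have : (k : ℕ) * ρ k ≤ wt ρ := Finset.single_le_sum (f := fun k : ℕ+ => (k : ℕ) * ρ k)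
            (fun _ _ => Nat.zero_le _) hk
          have h6 : (k : ℕ) ≤ k * ρ k := Nat.le_mul_of_pos_right _ (Nat.pos_of_ne_zero hk')
          have := PNat.natPred_add_one k
          omega
        · intro i hi; simpa using (mem_filter.1 hi).2
        · intro k _; simp
        · intro i _; simp
        · intro k _; simp [PNat.natPred_add_one]
      have h7 : ((n : K) + 1) = ((wt ρ : ℕ) : K) := by rw [hw]; push_cast; ring
      rw [h7, h5]
      push_cast
      rfl
    · simp

end TopVertex
end

noncomputable section
namespace TopVertex
open MvPolynomial Finset

/-! ### The bialternant formula with an extra alphabet -/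

section Bialternant

variable {R : Type*} [CommRing R] [Algebra K R]

/-- The power sums of a single variable. -/
def pw (c : R) : ℕ+ → R := fun k => c ^ (k : ℕ)

theorem hAt_pw (c : R) (n : ℕ) : hAt (pw c) n = c ^ n := hAt_pow c n

/-- The shifted parts `μ_i + N - 1 - i`. -/
def shifted (N : ℕ) (μ : YoungDiagram) (i : Fin N) : ℕ := μ.rowLen i + (N - 1 - i)

theorem rowLen_eq_zero {μ : YoungDiagram} {i : ℕ} (h : μ.colLen 0 ≤ i) : μ.rowLen i = 0 := by
  by_contra h0
  have h1 : (i, 0) ∈ μ := YoungDiagram.mem_iff_lt_rowLen.2 (Nat.pos_of_ne_zero h0)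
  have := YoungDiagram.mem_iff_lt_colLen.1 h1
  omega

/-- The Jacobi-Trudi determinant may be taken of any size at least the number of rows. -/
theorem schurAt_eq_det (X : ℕ+ → R) (μ : YoungDiagram) {N : ℕ} (hN : μ.colLen 0 ≤ N) :
    schurAt X μ = Matrix.det (Matrix.of fun i j : Fin N =>
      hAtInt X ((μ.rowLen i : ℤ) - (i : ℤ) + (j : ℤ))) := by
  induction N, hN using Nat.le_induction with
  | base =>
    unfold schurAt schur
    rw [AlgHom.map_det]
    congr 1
    ext i j
    simp [aeval_hSymInt]
  | succ N hN ih =>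
    -- The added row belongs to a part of length zero, so it is `(0, …, 0, 1)`: all entries left of
    -- the diagonal have a negative index.
    rw [ih, Matrix.det_succ_row _ (Fin.last N), Fin.sum_univ_castSucc, Finset.sum_eq_zero, zero_add]
    · have h1 : hAtInt X ((μ.rowLen N : ℤ) - (N : ℤ) + (N : ℤ)) = 1 := by
        rw [rowLen_eq_zero hN]; simp [hAtInt, hAt_zero]
      simp only [Matrix.of_apply, Fin.val_last, h1, ← two_mul, pow_mul]
      simp only [even_two, Even.neg_pow, one_pow, mul_one, one_mul]
      congr 1
      ext i j
      simp
    · intro j _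
      have : hAtInt X ((μ.rowLen N : ℤ) - (N : ℤ) + (j : ℤ)) = 0 := by
        rw [rowLen_eq_zero hN]; exact hAtInt_neg _ (by have := j.2; push_cast; omega)
      simp [this]

theorem rowLen_sub_add (N : ℕ) (μ : YoungDiagram) (i j : Fin N) :
    (μ.rowLen i : ℤ) - (i : ℤ) + (j : ℤ) = (shifted N μ i : ℤ) - ((N - 1 - j : ℕ) : ℤ) := by
  unfold shifted
  have := i.2
  have := j.2
  omega

/-- Adding one variable `c` divides the generating series by `1 - c t`; cleared of the denominator
this is a two-term recursion. -/
theorem hAt_add_pw_succ (Y : ℕ+ → R) (c : R) (n : ℕ) :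
    hAt (Y + pw c) (n + 1) = hAt Y (n + 1) + c * hAt (Y + pw c) n := by
  rw [hAt_add, hAt_add, Finset.Nat.sum_antidiagonal_succ', Finset.mul_sum]
  simp only [hAt_pw, pow_zero, mul_one]
  congr 1
  exact Finset.sum_congr rfl fun p _ => by ring

/-- The series of a negative finite alphabet is the polynomial `∏ (1 - t_i t)`, of degree at most
the number of variables. -/
theorem hAt_neg_sum_pw {ι : Type*} (s : Finset ι) (t : ι → R) (n : ℕ) (hn : #s < n) :
    hAt (-∑ i ∈ s, pw (t i)) n = 0 := by
  classical
  induction s using Finset.induction_on generalizing n with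
  | empty => simp [hAt_zero_fun, (by simpa using hn : 0 < n).ne']
  | insert a s ha ih =>
    rw [card_insert_of_notMem ha] at hn
    obtain ⟨n, rfl⟩ : ∃ k, n = k + 1 := ⟨n - 1, by omega⟩
    have := hAt_add_pw_succ (-∑ i ∈ insert a s, pw (t i)) (t a) n
    rw [Finset.sum_insert ha, neg_add_rev, neg_add_cancel_right, ih _ (by omega),
      ih _ (by omega)] at this
    rw [Finset.sum_insert ha, neg_add_rev]
    simpa using this.symm

/-- A single variable together with `T` is the full alphabet minus the other `N - 1` variables. The
subtracted alphabet has a polynomial series of degree below `N`, so the convolution has only `N`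
terms and is a product of `N × N` matrices. -/
theorem hAt_mul_eq_matrix_mul {N : ℕ} (m : Fin N → ℕ) (t : Fin N → R) (T : ℕ+ → R) :
    (Matrix.of fun r i => hAt (pw (t i) + T) (m r)) =
      (Matrix.of fun r j : Fin N =>
        hAtInt (∑ l, pw (t l) + T) ((m r : ℤ) - ((N - 1 - j : ℕ) : ℤ))) *
      Matrix.of fun (j : Fin N) i => hAt (-∑ l ∈ univ.erase i, pw (t l)) (N - 1 - j) := by
  ext r i
  rw [Matrix.mul_apply]
  simp only [Matrix.of_apply]
  have e : pw (t i) + T = (∑ l, pw (t l) + T) + -∑ l ∈ univ.erase i, pw (t l) := by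
    rw [← Finset.add_sum_erase univ (fun l => pw (t l)) (mem_univ i)]; abel
  set X := ∑ l, pw (t l) + T
  set Y := -∑ l ∈ univ.erase i, pw (t l) with hY
  have hY0 : ∀ n, N ≤ n → hAt Y n = 0 := fun n hn => by
    apply hAt_neg_sum_pw
    rw [card_erase_of_mem (mem_univ i), card_univ, Fintype.card_fin]
    have := i.2
    omega
  set f : ℕ → R := fun j => hAtInt X ((m r : ℤ) - (j : ℤ)) * hAt Y j with hf
  -- Both ranges of summation, `j < N` and `j ≤ m r`, extend to a common one: beyond `N` the second
  -- factor vanishes by degree, beyond `m r` the first one has a negative index.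
  have h1 : ∑ j : Fin N, f (N - 1 - j) = ∑ j ∈ range N, f j := by
    rw [← Finset.sum_range_reflect, Finset.sum_range]
  have h2 : ∑ j ∈ range N, f j = ∑ j ∈ range (m r + 1 + N), f j := by
    refine Finset.sum_subset (range_mono (by omega)) fun j _ hj => ?_
    simp only [mem_range, not_lt] at hj
    simp [hf, hY0 j hj]
  have h3 : ∑ j ∈ range (m r + 1), f j = ∑ j ∈ range (m r + 1 + N), f j := by
    refine Finset.sum_subset (range_mono (by omega)) fun j _ hj => ?_
    simp only [mem_range, not_lt] at hj
    simp only [hf]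
    rw [hAtInt_neg _ (by omega), zero_mul]
  rw [e, add_comm, hAt_add, h1, h2, ← h3,
    Finset.Nat.sum_antidiagonal_eq_sum_range_succ_mk]
  refine Finset.sum_congr rfl fun j hj => ?_
  have hj' : j ≤ m r := by simpa [Nat.lt_succ_iff] using hj
  simp [hf, ← Nat.cast_sub hj', hAtInt_natCast, mul_comm]

/-- In the matrix factorization the first determinant is Jacobi-Trudi for the full alphabet, and the
second depends neither on `ν` nor on `T`. The case of the empty diagram and `T = 0` identifies the
latter as the Vandermonde determinant. -/
theorem det_hAt_eq {N : ℕ} (ν : YoungDiagram) (hN : ν.colLen 0 ≤ N) (t : Fin N → R)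
    (T : ℕ+ → R) :
    Matrix.det (Matrix.of fun r i => hAt (pw (t i) + T) (shifted N ν r)) =
      schurAt (∑ l, pw (t l) + T) ν * Matrix.det (Matrix.of fun r i : Fin N => t i ^ (N - 1 - r)) := by
  have h1 : ∀ (ν : YoungDiagram) (hN : ν.colLen 0 ≤ N) (T : ℕ+ → R),
      Matrix.det (Matrix.of fun r i => hAt (pw (t i) + T) (shifted N ν r)) =
      schurAt (∑ l, pw (t l) + T) ν * Matrix.det 
      (Matrix.of fun (j : Fin N) i => hAt (-∑ l ∈ univ.erase i, pw (t l)) (N - 1 - j)) := by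
    intro ν hN T
    rw [hAt_mul_eq_matrix_mul, Matrix.det_mul, schurAt_eq_det _ _ hN]
    simp only [rowLen_sub_add]
  have hbot : (⊥ : YoungDiagram).colLen 0 = 0 := by
    rw [YoungDiagram.colLen_eq_card]; rfl
  have h2 := h1 ⊥ (by omega) 0
  have h3 : schurAt (∑ l, pw (t l) + 0) (⊥ : YoungDiagram) = 1 := by
    rw [schurAt_eq_det _ _ hbot.le]; simp
  rw [h3, one_mul] at h2
  rw [h1 ν hN T, ← h2]
  congr 2
  ext r i
  simp only [Matrix.of_apply, add_zero, hAt_pw]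
  rw [shifted, rowLen_eq_zero (by omega), zero_add]

end Bialternant

end TopVertex
end

noncomputable section
namespace TopVertex
open MvPolynomial Finset

/-! ### Duality of the products of `h_n` with monomials, in coefficients -/

section Extraction

variable {N : ℕ}

theorem hAt_sum {R : Type*} [CommRing R] [Algebra K R] (W : Fin N → ℕ+ → R) (d : ℕ) :
    hAt (∑ i, W i) d = ∑ l ∈ finsuppAntidiag univ d, ∏ i, hAt (W i) (l i) := by
  have := congrArg (PowerSeries.coeff d) (hSeries_sum univ W)
  rw [PowerSeries.coeff_prod] at this
  simpa [hSeries] using this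

/-- The power sums of the variables `t_1, …, t_N`. -/
def tSum (N : ℕ) : ℕ+ → MvPolynomial (Fin N) K := ∑ i, pw (X i)

/-- The substitution `p_k ↦ p_k P_k(x)` keeps the power sums as a second set of variables, so that
coefficients in both sets can be compared. -/
theorem coeff_coeff_aeval (P : ℕ+ → MvPolynomial (Fin N) K) (f : Sym) (ρ : ℕ+ →₀ ℕ)
    (α : Fin N →₀ ℕ) :
    coeff ρ (coeff α (aeval (fun k => C (X k) * map C (P k) : ℕ+ → MvPolynomial (Fin N) Sym) f)) =
      coeff ρ f * coeff α (aeval P (monomial ρ (1 : K))) := by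
  induction f using MvPolynomial.induction_on' with
  | monomial σ c =>
    have : aeval (fun k => C (X k) * map C (P k) : ℕ+ → MvPolynomial (Fin N) Sym) (monomial σ c) =
        C (monomial σ c) * map C (aeval P (monomial σ (1 : K))) := by
      rw [aeval_monomial, aeval_monomial, monomial_eq]
      simp only [mul_pow, Finsupp.prod, Finset.prod_mul_distrib, map_mul, map_prod, map_pow,
        map_one, one_mul]
      rw [mul_assoc]
      rfl
    rw [this, coeff_C_mul, coeff_map, mul_comm, coeff_C_mul, coeff_monomial]
    split_ifs with h
    · rw [h, mul_comm]
    · simp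
  | add p q hp hq => rw [map_add, coeff_add, coeff_add, hp, hq, coeff_add, add_mul]

theorem prod_X_pow_mul_C {A : Type*} [CommRing A] (l : Fin N →₀ ℕ) (c : Fin N → A) :
    ∏ i, ((X i : MvPolynomial (Fin N) A) ^ l i * C (c i)) = monomial l (∏ i, c i) := by
  rw [Finset.prod_mul_distrib, monomial_eq, mul_comm, map_prod,
    Finsupp.prod_fintype _ _ (by simp)]

/-- The Cauchy kernel `h_d`, evaluated at `p_k ∑ x_i^k`, is expanded in two ways: by power sums, and
as the degree `d` part of a product over the variables `x_i`. -/
theorem coeff_prod_hSym (d : ℕ) (ρ : ℕ+ →₀ ℕ) (α : Fin N →₀ ℕ) :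
    coeff ρ (hSym d) * coeff α (aeval (tSum N) (monomial ρ (1 : K))) =
      if ∑ i, α i = d then coeff ρ (∏ i, hSym (α i)) else 0 := by
  classical
  rw [← coeff_coeff_aeval]
  have e : (fun k => C (X k) * map C (tSum N k) : ℕ+ → MvPolynomial (Fin N) Sym) =
      ∑ i, fun k : ℕ+ => (X i) ^ (k : ℕ) * C (X k) := by
    ext1 k
    simp [tSum, pw, mul_comm (C (X k)), Finset.sum_mul]
  have e2 : ∀ n, hAt (fun k => C (X k) : ℕ+ → MvPolynomial (Fin N) Sym) n = C (hSym n) := by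
    intro n
    have := map_hAt (IsScalarTower.toAlgHom K Sym (MvPolynomial (Fin N) Sym)) X n
    rw [← hSym_eq_hAt] at this
    exact this.symm
  rw [← hAt, e, hAt_sum]
  simp only [hAt_mul_pow, e2, prod_X_pow_mul_C]
  rw [coeff_sum]
  simp only [coeff_monomial, Finset.sum_ite_eq', mem_finsuppAntidiag, subset_univ, and_true]
  split_ifs <;> simp

theorem coeff_prod_hSym_of_ne (ρ : ℕ+ →₀ ℕ) (α : Fin N →₀ ℕ) (h : wt ρ ≠ ∑ i, α i) :
    coeff ρ (∏ i, hSym (α i)) = 0 := by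
  have := coeff_prod_hSym (∑ i, α i) ρ α
  rw [if_pos rfl, coeff_hSym, if_neg h, zero_mul] at this
  exact this.symm

theorem coeff_prod_hSym_mul_zCoeff (ρ : ℕ+ →₀ ℕ) (α : Fin N →₀ ℕ) :
    coeff ρ (∏ i, hSym (α i)) * zCoeff ρ = coeff α (aeval (tSum N) (monomial ρ (1 : K))) := by
  have hz : (zCoeff ρ : K) ≠ 0 := by exact_mod_cast zCoeff_ne_zero ρ
  have h := coeff_prod_hSym (wt ρ) ρ α
  rw [coeff_hSym, if_pos rfl] at h
  by_cases hw : ∑ i, α i = wt ρ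
  · rw [if_pos hw] at h
    rw [← h]
    field_simp
  · rw [coeff_prod_hSym_of_ne ρ α (Ne.symm hw), zero_mul]
    rw [if_neg hw] at h
    exact ((mul_eq_zero.1 h).resolve_left (inv_ne_zero hz)).symm

end Extraction

/-! ### The Hall inner product and orthonormality of Schur functions -/

section Hall

theorem hall_eq_sum {f g : Sym} (s : Finset (ℕ+ →₀ ℕ)) (h : f.support ⊆ s) :
    hall f g = ∑ a ∈ s, coeff a f * coeff a g * (zCoeff a : K) :=
  Finset.sum_subset h fun a _ ha => by rw [notMem_support_iff.1 ha]; ring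

theorem hall_comm (f g : Sym) : hall f g = hall g f := by
  classical
  rw [hall_eq_sum (f.support ∪ g.support) subset_union_left,
    hall_eq_sum (f.support ∪ g.support) subset_union_right]
  exact Finset.sum_congr rfl fun a _ => by ring

/-- The Hall inner product as a bilinear map. -/
def hallL : Sym →ₗ[K] Sym →ₗ[K] K :=
  LinearMap.mk₂ K hall
    (fun f g h => by
      rw [hall_comm, hall_comm f, hall_comm g]
      simp [hall, mul_add, add_mul, Finset.sum_add_distrib])
    (fun c f g => by
      rw [hall_comm, hall_comm f]
      simp only [hall, coeff_smul, smul_eq_mul, Finset.mul_sum]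
      exact Finset.sum_congr rfl fun _ _ => by ring)
    (fun f g h => by simp [hall, mul_add, add_mul, Finset.sum_add_distrib])
    (fun c f g => by
      simp only [hall, coeff_smul, smul_eq_mul, Finset.mul_sum]
      exact Finset.sum_congr rfl fun _ _ => by ring)

theorem hallL_apply (f g : Sym) : hallL f g = hall f g := rfl

theorem hall_monomial (ρ : ℕ+ →₀ ℕ) (c : K) (g : Sym) :
    hall (monomial ρ c) g = c * coeff ρ g * zCoeff ρ := by
  classical
  rw [hall_eq_sum {ρ} support_monomial_subset]
  simp

variable {N : ℕ}

theorem hall_prod_hSym (f : Sym) (α : Fin N →₀ ℕ) :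
    hall f (∏ i, hSym (α i)) = coeff α (aeval (tSum N) f) := by
  induction f using MvPolynomial.induction_on' with
  | monomial ρ c =>
    have : monomial ρ c = c • (monomial ρ (1 : K)) := by simp [smul_monomial]
    rw [hall_monomial, mul_assoc, coeff_prod_hSym_mul_zCoeff, this, map_smul, coeff_smul,
      smul_eq_mul]
  | add p q hp hq =>
    rw [map_add, coeff_add, ← hp, ← hq, ← hallL_apply, map_add]
    rfl

/-- The exponent `μ + δ`. -/
def shiftedF (N : ℕ) (μ : YoungDiagram) : Fin N →₀ ℕ := Finsupp.equivFunOnFinite.symm (shifted N μ)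

theorem shiftedF_apply (μ : YoungDiagram) (i : Fin N) : shiftedF N μ i = shifted N μ i := rfl

/-- The Vandermonde determinant of the variables. -/
def vdm (N : ℕ) : MvPolynomial (Fin N) K := Matrix.det (Matrix.of fun r i : Fin N => X i ^ (N - 1 - r))

/-- Expanding Jacobi-Trudi over permutations and pairing each product of `h`'s by `hall_prod_hSym`
gives coefficients of `f(x)` at `μ + δ - σ(δ)`. With their signs these assemble to a coefficient of
the Vandermonde determinant times `f(x)`. -/
theorem hall_schur (f : Sym) (μ : YoungDiagram) (hN : μ.colLen 0 ≤ N) :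
    hall f (schur μ) = coeff (shiftedF N μ) (vdm N * aeval (tSum N) f) := by
  classical
  have e : schur μ = schurAt (X : ℕ+ → Sym) μ := by simp [schurAt]
  rw [e, schurAt_eq_det _ _ hN, ← Matrix.det_transpose, Matrix.det_apply, vdm, Matrix.det_apply,
    ← hallL_apply, map_sum, Finset.sum_mul, coeff_sum]
  refine Finset.sum_congr rfl fun σ _ => ?_
  rw [LinearMap.map_smul_of_tower, smul_mul_assoc, coeff_smul]
  congr 1
  simp only [Matrix.transpose_apply, Matrix.of_apply, rowLen_sub_add]
  set δ : Fin N →₀ ℕ := Finsupp.equivFunOnFinite.symm fun i => N - 1 - (σ i : ℕ) with hδ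
  have e2 : ∏ i, (X i : MvPolynomial (Fin N) K) ^ (N - 1 - (σ i : ℕ)) = monomial δ 1 := by
    rw [monomial_eq, Finsupp.prod_fintype _ _ (by simp)]
    simp [hδ]
  rw [e2, coeff_monomial_mul', one_mul]
  -- If the exponent does not dominate `δ`, both sides are zero: no monomial on one side, an `h` of
  -- negative index on the other.
  by_cases h : δ ≤ shiftedF N μ
  · rw [if_pos h, ← hall_prod_hSym, hallL_apply]
    congr 1
    refine Finset.prod_congr rfl fun i _ => ?_
    have hi : N - 1 - (σ i : ℕ) ≤ shifted N μ i := h i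
    rw [← Nat.cast_sub hi, hAtInt_natCast, ← hSym_eq_hAt]
    rfl
  · rw [if_neg h]
    obtain ⟨i, hi⟩ : ∃ i, ¬ N - 1 - (σ i : ℕ) ≤ shifted N μ i := by
      by_contra hc
      push Not at hc
      exact h hc
    rw [Finset.prod_eq_zero (mem_univ i) (hAtInt_neg _ (by omega)), map_zero]

theorem coeff_prod_aeval_X (f : Fin N → Polynomial K) (α : Fin N →₀ ℕ) :
    coeff α (∏ i, Polynomial.aeval (X i : MvPolynomial (Fin N) K) (f i)) =
      ∏ i, (f i).coeff (α i) := by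
  classical
  obtain ⟨D, hD⟩ : ∃ D, ∀ i, (f i).natDegree < D ∧ α i < D := by
    refine ⟨∑ i, ((f i).natDegree + α i) + 1, fun i => ?_⟩
    have := Finset.single_le_sum (f := fun i => (f i).natDegree + α i) (fun _ _ => Nat.zero_le _)
      (mem_univ i)
    omega
  have h1 : ∀ i, Polynomial.aeval (X i : MvPolynomial (Fin N) K) (f i) =
      ∑ e ∈ range D, X i ^ e * C ((f i).coeff e) := by
    intro i
    rw [Polynomial.aeval_eq_sum_range' (hD i).1]
    exact Finset.sum_congr rfl fun e _ => by rw [smul_eq_C_mul, mul_comm]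
  simp only [h1]
  rw [Finset.prod_univ_sum, coeff_sum, Finset.sum_eq_single (fun i => α i)]
  · rw [prod_X_pow_mul_C α, coeff_monomial, if_pos rfl]
  · intro l _ hl
    rw [show (∏ i, (X i : MvPolynomial (Fin N) K) ^ l i * C ((f i).coeff (l i))) =
      _ from prod_X_pow_mul_C (Finsupp.equivFunOnFinite.symm l) (fun i => (f i).coeff (l i)),
      coeff_monomial, if_neg]
    rintro rfl
    exact hl (by ext; simp)
  · intro h
    exact absurd (Fintype.mem_piFinset.2 fun i => mem_range.2 (hD i).2) h

theorem coeff_det_aeval_X (f : Fin N → Polynomial K) (α : Fin N →₀ ℕ) :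
    coeff α (Matrix.det (Matrix.of fun r i =>
      Polynomial.aeval (X i : MvPolynomial (Fin N) K) (f r))) =
      Matrix.det (Matrix.of fun r i => (f r).coeff (α i)) := by
  rw [Matrix.det_apply, Matrix.det_apply, coeff_sum]
  refine Finset.sum_congr rfl fun σ _ => ?_
  rw [coeff_smul]
  congr 1
  exact coeff_prod_aeval_X (fun i => f (σ i)) α

theorem vdm_mul_schurAt (ν : YoungDiagram) (hN : ν.colLen 0 ≤ N) (T : ℕ+ → K) :
    vdm N * schurAt (tSum N + fun k => C (T k)) ν =
      Matrix.det (Matrix.of fun r i => Polynomial.aeval (X i : MvPolynomial (Fin N) K)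
        (hAt (pw Polynomial.X + fun k => Polynomial.C (T k)) (shifted N ν r))) := by
  rw [vdm, tSum, mul_comm, ← det_hAt_eq ν hN]
  congr 2
  ext1 r; ext1 i
  rw [map_hAt]
  congr 1
  ext1 k
  simp [pw]

theorem shifted_strictAnti (N : ℕ) (μ : YoungDiagram) : StrictAnti (shifted N μ) := by
  intro i j hij
  have h1 := μ.rowLen_anti i j (le_of_lt hij)
  have h2 : (i : ℕ) < j := hij
  have := j.2
  simp only [shifted]
  omega

theorem eq_of_shifted_eq {μ ν : YoungDiagram} (hμ : μ.colLen 0 ≤ N) (hν : ν.colLen 0 ≤ N)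
    (h : shifted N μ = shifted N ν) : μ = ν := by
  ext ⟨i, j⟩
  rw [YoungDiagram.mem_cells, YoungDiagram.mem_cells, YoungDiagram.mem_iff_lt_rowLen,
    YoungDiagram.mem_iff_lt_rowLen]
  by_cases hi : i < N
  · have := congrFun h ⟨i, hi⟩
    simp only [shifted] at this
    rw [show μ.rowLen i = ν.rowLen i by omega]
  · rw [rowLen_eq_zero (by omega), rowLen_eq_zero (by omega)]

-- By `hall_schur` and the bialternant formula with `T = 0`, the pairing is the coefficient of
-- `x^{μ+δ}` in the alternant with exponents `ν + δ`. Both exponent vectors are strictly decreasing,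
-- so only the identity permutation can match them.
open scoped Classical in
theorem hall_schur_schur (ν μ : YoungDiagram) :
    hall (schur ν) (schur μ) = if ν = μ then 1 else 0 := by
  set N := max (ν.colLen 0) (μ.colLen 0) with hNdef
  have hν : ν.colLen 0 ≤ N := le_max_left _ _
  have hμ : μ.colLen 0 ≤ N := le_max_right _ _
  have h1 := vdm_mul_schurAt ν hν 0
  have e1 : tSum N + (fun k => C ((0 : ℕ+ → K) k)) = tSum N := by ext1 k; simp
  have e2 : (pw Polynomial.X + fun k => Polynomial.C ((0 : ℕ+ → K) k)) = pw Polynomial.X := by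
    ext1 k; simp
  rw [e1, e2] at h1
  rw [hall_schur _ _ hμ, show aeval (tSum N) (schur ν) = schurAt (tSum N) ν from rfl, h1,
    coeff_det_aeval_X, Matrix.det_apply]
  simp only [Matrix.of_apply, hAt_pw, Polynomial.coeff_X_pow, Finset.prod_ite_zero,
    Finset.prod_const_one, shiftedF_apply]
  have key : ∀ σ : Equiv.Perm (Fin N), (∀ i ∈ univ, shifted N μ i = shifted N ν (σ i)) →
      σ = 1 ∧ ν = μ := by
    intro σ hσ
    have hmono : StrictMono σ := by
      intro i j hij
      have := shifted_strictAnti N μ hij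
      rw [hσ i (mem_univ _), hσ j (mem_univ _)] at this
      exact (shifted_strictAnti N ν).lt_iff_gt.1 this
    have h1 : σ = 1 := by
      ext i
      have := Subsingleton.elim (hmono.orderIsoOfSurjective σ σ.surjective) (OrderIso.refl _)
      have := congrArg (fun f => f i) this
      simpa using congrArg Fin.val this
    refine ⟨h1, (eq_of_shifted_eq hμ hν ?_).symm⟩
    ext i
    rw [hσ i (mem_univ _), h1]
    rfl
  rw [Finset.sum_eq_single 1]
  · split_ifs with h1 h2 h2
    · simp
    · exact absurd (key 1 h1).2 h2
    · exact absurd (fun i _ => by rw [h2]; rfl) h1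
    · simp
  · intro σ _ hσ
    rw [if_neg fun h => hσ (key σ h).1, smul_zero]
  · simp

end Hall

end TopVertex
end

noncomputable section
namespace TopVertex
open MvPolynomial Finset

/-! ### Counting cells -/

section Cells

theorem sum_cells {M : Type*} [AddCommMonoid M] (μ : YoungDiagram) {N : ℕ} (hN : μ.colLen 0 ≤ N)
    (f : ℕ × ℕ → M) :
    ∑ c ∈ μ.cells, f c = ∑ i ∈ range N, ∑ j ∈ range (μ.rowLen i), f (i, j) := by
  rw [← Finset.sum_fiberwise_of_maps_to (s := μ.cells) (t := range N) (g := Prod.fst)]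
  · refine Finset.sum_congr rfl fun i _ => ?_
    have : ∑ c ∈ μ.row i, f c = ∑ j ∈ range (μ.rowLen i), f (i, j) := by
      rw [YoungDiagram.row_eq_prod, Finset.sum_product]
      simp
    exact this
  · rintro ⟨i, j⟩ h
    rw [YoungDiagram.mem_cells] at h
    have h1 := YoungDiagram.mem_iff_lt_colLen.1 h
    have h2 := μ.colLen_anti 0 j (Nat.zero_le _)
    exact mem_range.2 (by omega)

theorem card_eq_sum_rowLen (μ : YoungDiagram) {N : ℕ} (hN : μ.colLen 0 ≤ N) :
    μ.card = ∑ i ∈ range N, μ.rowLen i := by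
  have := sum_cells μ hN (fun _ => 1)
  simpa using this

theorem card_transpose (μ : YoungDiagram) : μ.transpose.card = μ.card := by
  change Finset.card (μ.cells.map _) = _
  rw [card_map]

theorem mem_partitionsOf {μ : YoungDiagram} {n : ℕ} : μ ∈ partitionsOf n ↔ μ.card = n := by
  simp [partitionsOf]

theorem card_eq_zero_iff {μ : YoungDiagram} : μ.card = 0 ↔ μ = ⊥ := by
  constructor
  · intro h
    have : μ.cells = ∅ := Finset.card_eq_zero.1 h
    exact YoungDiagram.ext this
  · rintro rfl; rfl

theorem partitionsOf_zero : partitionsOf 0 = {⊥} := by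
  ext μ
  rw [mem_partitionsOf, card_eq_zero_iff, mem_singleton]

end Cells

/-! ### Completeness of Schur functions and the Cauchy identity -/

section Complete

/-- The Young diagram with `m_k` rows of length `k`. -/
def diagramOf (ρ : ℕ+ →₀ ℕ) : YoungDiagram :=
  YoungDiagram.ofRowLens (((Finsupp.toMultiset ρ).map (fun k : ℕ+ => (k : ℕ))).sort (· ≥ ·))
    (List.sortedGE_iff_pairwise.2 (Multiset.pairwise_sort _ _))

theorem rowLens_diagramOf (ρ : ℕ+ →₀ ℕ) : (diagramOf ρ).rowLens =
    ((Finsupp.toMultiset ρ).map (fun k : ℕ+ => (k : ℕ))).sort (· ≥ ·) := by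
  refine YoungDiagram.rowLens_ofRowLens_eq_self fun x hx => ?_
  rw [Multiset.mem_sort, Multiset.mem_map] at hx
  obtain ⟨k, _, rfl⟩ := hx
  exact k.pos

theorem diagramOf_injective : Function.Injective diagramOf := by
  intro ρ σ h
  have h1 := congrArg (fun μ => (μ.rowLens : Multiset ℕ)) h
  simp only [rowLens_diagramOf, Multiset.sort_eq] at h1
  exact Multiset.toFinsupp.symm.injective (Multiset.map_injective PNat.coe_injective h1)

theorem card_diagramOf (ρ : ℕ+ →₀ ℕ) : (diagramOf ρ).card = wt ρ := by
  rw [card_eq_sum_rowLen _ le_rfl]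
  have h1 : ∑ i ∈ range ((diagramOf ρ).colLen 0), (diagramOf ρ).rowLen i =
      ((diagramOf ρ).rowLens : Multiset ℕ).sum := by
    rw [YoungDiagram.rowLens, Multiset.sum_coe]
    rfl
  rw [h1, rowLens_diagramOf, Multiset.sort_eq]
  clear h1
  induction ρ using Finsupp.induction_linear with
  | zero => simp [wt]
  | add f g hf hg => rw [map_add, Multiset.map_add, Multiset.sum_add, hf, hg, wt_add]
  | single k c => simp [wt_single, mul_comm, Multiset.map_nsmul, Multiset.sum_nsmul]

theorem finite_wt_eq (d : ℕ) : {ρ : ℕ+ →₀ ℕ | wt ρ = d}.Finite := by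
  refine Set.Finite.of_finite_image ((finite_card_eq d).subset ?_) diagramOf_injective.injOn
  rintro _ ⟨ρ, hρ, rfl⟩
  exact (card_diagramOf ρ).trans hρ

/-- The monomials of weight `d`. -/
def monomialsOf (d : ℕ) : Finset (ℕ+ →₀ ℕ) := (finite_wt_eq d).toFinset

theorem mem_monomialsOf {ρ : ℕ+ →₀ ℕ} {d : ℕ} : ρ ∈ monomialsOf d ↔ wt ρ = d := by
  simp [monomialsOf]

/-- One half of the equality of dimensions; the other half follows from orthonormality inside
`sum_coeff_schur_mul`, so surjectivity of `diagramOf` is never needed. -/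
theorem card_monomialsOf_le (d : ℕ) : #(monomialsOf d) ≤ #(partitionsOf d) :=
  Finset.card_le_card_of_injOn diagramOf
    (fun ρ hρ => mem_partitionsOf.2 ((card_diagramOf ρ).trans (mem_monomialsOf.1 hρ)))
    diagramOf_injective.injOn

/-- Schur functions are homogeneous. -/
theorem coeff_schur_of_ne {ρ : ℕ+ →₀ ℕ} {μ : YoungDiagram} (h : wt ρ ≠ μ.card) :
    coeff ρ (schur μ) = 0 := by
  have e : schur μ = schurAt (X : ℕ+ → Sym) μ := by simp [schurAt]
  rw [e, schurAt_eq_det _ _ le_rfl, Matrix.det_apply, coeff_sum]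
  refine Finset.sum_eq_zero fun σ _ => ?_
  rw [coeff_smul]
  by_cases hn : ∀ i : Fin (μ.colLen 0), 0 ≤ (μ.rowLen (σ i) : ℤ) - (σ i : ℤ) + (i : ℤ)
  · choose α hα using fun i => Int.eq_ofNat_of_zero_le (hn i)
    have h1 : ∑ i, α i = μ.card := by
      have h2 : ∑ i, (α i : ℤ) = ∑ i, ((μ.rowLen (σ i) : ℤ) - (σ i : ℤ) + (i : ℤ)) :=
        Finset.sum_congr rfl fun i _ => (hα i).symm
      rw [Finset.sum_add_distrib, Finset.sum_sub_distrib,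
        Equiv.sum_comp σ (fun i => (μ.rowLen i : ℤ)), Equiv.sum_comp σ (fun i => ((i : ℕ) : ℤ)),
        sub_add_cancel] at h2
      rw [card_eq_sum_rowLen μ le_rfl, Finset.sum_range]
      exact_mod_cast h2
    have h3 : ∏ i, (Matrix.of fun i j : Fin (μ.colLen 0) =>
        hAtInt (X : ℕ+ → Sym) ((μ.rowLen i : ℤ) - (i : ℤ) + (j : ℤ))) (σ i) i =
        ∏ i, hSym ((Finsupp.equivFunOnFinite.symm α) i) := by
      refine Finset.prod_congr rfl fun i _ => ?_
      rw [Matrix.of_apply, hα, hAtInt_natCast, ← hSym_eq_hAt]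
      rfl
    rw [h3, coeff_prod_hSym_of_ne, smul_zero]
    simpa [h1] using h
  · push Not at hn
    obtain ⟨i, hi⟩ := hn
    rw [Finset.prod_eq_zero (mem_univ i), coeff_zero, smul_zero]
    exact hAtInt_neg _ hi

theorem support_schur_subset (μ : YoungDiagram) : (schur μ).support ⊆ monomialsOf μ.card := by
  intro ρ hρ
  rw [mem_monomialsOf]
  by_contra h
  exact mem_support_iff.1 hρ (coeff_schur_of_ne h)

/-- Completeness of the Schur functions. -/
theorem sum_coeff_schur_mul {ρ : ℕ+ →₀ ℕ} (σ : ℕ+ →₀ ℕ) {s : Finset YoungDiagram}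
    (hs : partitionsOf (wt ρ) ⊆ s) :
    ∑ μ ∈ s, coeff ρ (schur μ) * coeff σ (schur μ) = if ρ = σ then (zCoeff ρ : K)⁻¹ else 0 := by
  classical
  have hz : (zCoeff ρ : K) ≠ 0 := by exact_mod_cast zCoeff_ne_zero ρ
  rw [← Finset.sum_subset hs fun μ _ hμ => by
    rw [coeff_schur_of_ne, zero_mul]
    exact fun h => hμ (mem_partitionsOf.2 h.symm)]
  by_cases hw : wt σ = wt ρ
  swap
  · rw [if_neg (fun h => hw (by rw [h]))]
    refine Finset.sum_eq_zero fun μ hμ => ?_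
    rw [coeff_schur_of_ne (ρ := σ), mul_zero]
    rwa [mem_partitionsOf.1 hμ]
  set d := wt ρ with hd
  set A : Matrix (partitionsOf d) (monomialsOf d) K :=
    Matrix.of fun μ τ => coeff τ.1 (schur μ.1) * (zCoeff τ.1 : K) with hA
  set B : Matrix (monomialsOf d) (partitionsOf d) K :=
    Matrix.of fun τ μ => coeff τ.1 (schur μ.1) with hB
  -- Orthonormality says `A B = 1`. A left inverse makes `B` injective, hence the matrices are
  -- square, and then `B A = 1` is the completeness relation.
  have hAB : A * B = 1 := by
    ext μ ν
    rw [Matrix.mul_apply, Matrix.one_apply]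
    have h1 := hall_schur_schur μ.1 ν.1
    have h2 := support_schur_subset μ.1
    rw [mem_partitionsOf.1 μ.2] at h2
    rw [hall_eq_sum _ h2, ← Finset.sum_coe_sort] at h1
    simp only [Subtype.ext_iff]
    rw [← h1]
    exact Finset.sum_congr rfl fun τ _ => by simp [hA, hB]; ring
  have hcard : Fintype.card (partitionsOf d) = Fintype.card (monomialsOf d) := by
    refine le_antisymm ?_ (by simpa using card_monomialsOf_le d)
    refine card_le_of_injective K B.mulVecLin (Function.LeftInverse.injective (g := A.mulVecLin) ?_)
    intro v
    simp [Matrix.mulVec_mulVec, hAB]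
  have hBA := (Matrix.mul_eq_one_comm_of_card_eq _ _ K hcard).1 hAB
  have h := congrFun (congrFun hBA ⟨σ, mem_monomialsOf.2 hw⟩) ⟨ρ, mem_monomialsOf.2 rfl⟩
  rw [Matrix.mul_apply, Matrix.one_apply] at h
  simp only [hA, hB, Matrix.of_apply, ← mul_assoc] at h
  rw [← Finset.sum_mul, Finset.sum_coe_sort (partitionsOf d)
    (fun μ => coeff σ (schur μ) * coeff ρ (schur μ))] at h
  simp only [Subtype.mk.injEq] at h
  rw [Finset.sum_congr rfl fun μ _ => mul_comm (coeff ρ (schur μ)) (coeff σ (schur μ)),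
    eq_div_of_mul_eq hz h]
  by_cases hρ : ρ = σ
  · simp [hρ]
  · simp [hρ, Ne.symm hρ]

/-- Every symmetric function is the sum of its components along the Schur functions. -/
theorem eq_sum_hall_smul_schur (f : Sym) {s : Finset YoungDiagram}
    (hs : ∀ ρ ∈ f.support, partitionsOf (wt ρ) ⊆ s) :
    f = ∑ μ ∈ s, hall f (schur μ) • schur μ := by
  ext σ
  rw [coeff_sum]
  simp only [coeff_smul, smul_eq_mul, hall, Finset.sum_mul]
  rw [Finset.sum_comm]
  have h1 : ∀ ρ ∈ f.support, ∑ μ ∈ s, coeff ρ f * coeff ρ (schur μ) * (zCoeff ρ : K) *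
      coeff σ (schur μ) = if ρ = σ then coeff ρ f else 0 := by
    intro ρ hρ
    have hz : (zCoeff ρ : K) ≠ 0 := by exact_mod_cast zCoeff_ne_zero ρ
    rw [Finset.sum_congr rfl (g := fun μ => coeff ρ f * (zCoeff ρ : K) *
      (coeff ρ (schur μ) * coeff σ (schur μ))) (fun _ _ => by ring), ← Finset.mul_sum,
      sum_coeff_schur_mul σ (hs ρ hρ)]
    split_ifs
    · field_simp
    · simp
  rw [Finset.sum_congr rfl h1, Finset.sum_ite_eq']
  split_ifs with h
  · rfl
  · exact notMem_support_iff.1 h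

variable {R : Type*} [CommRing R] [Algebra K R]

theorem aeval_eq_sum_of_support_subset (Y : ℕ+ → R) (f : Sym) {s : Finset (ℕ+ →₀ ℕ)}
    (hs : f.support ⊆ s) :
    aeval Y f = ∑ ρ ∈ s, coeff ρ f • ρ.prod fun k c => Y k ^ c := by
  rw [← Finset.sum_subset hs fun ρ _ hρ => by rw [notMem_support_iff.1 hρ, zero_smul]]
  conv_lhs => rw [f.as_sum, map_sum]
  refine Finset.sum_congr rfl fun ρ _ => ?_
  rw [aeval_monomial, Algebra.smul_def]

theorem schurAt_eq_sum (Y : ℕ+ → R) (μ : YoungDiagram) :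
    schurAt Y μ = ∑ ρ ∈ monomialsOf μ.card, coeff ρ (schur μ) • ρ.prod fun k c => Y k ^ c :=
  aeval_eq_sum_of_support_subset Y _ (support_schur_subset μ)

theorem prod_mul_pow {A : Type*} [CommRing A] (c : A) (Y : ℕ+ → A) (ρ : ℕ+ →₀ ℕ) :
    (ρ.prod fun k e => (c ^ (k : ℕ) * Y k) ^ e) = c ^ wt ρ * ρ.prod fun k e => Y k ^ e := by
  simp only [mul_pow, Finsupp.prod, Finset.prod_mul_distrib, wt, Finsupp.sum, ← pow_mul,
    Finset.prod_pow_eq_pow_sum]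

theorem schurAt_mul_pow (c : R) (Y : ℕ+ → R) (μ : YoungDiagram) :
    schurAt (fun k => c ^ (k : ℕ) * Y k) μ = c ^ μ.card * schurAt Y μ := by
  rw [schurAt_eq_sum, schurAt_eq_sum, Finset.mul_sum]
  refine Finset.sum_congr rfl fun ρ hρ => ?_
  rw [prod_mul_pow, mem_monomialsOf.1 hρ, mul_smul_comm]

/-- The Cauchy identity in a fixed degree. -/
theorem sum_schurAt_mul_schurAt (Y Z : ℕ+ → R) (d : ℕ) :
    ∑ μ ∈ partitionsOf d, schurAt Y μ * schurAt Z μ = hAt (Y * Z) d := by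
  classical
  have hs : (hSym d).support ⊆ monomialsOf d := by
    intro ρ hρ
    rw [mem_monomialsOf]
    by_contra h
    rw [mem_support_iff, coeff_hSym, if_neg h] at hρ
    exact hρ rfl
  have h1 : ∀ μ ∈ partitionsOf d, schurAt Y μ * schurAt Z μ =
      ∑ ρ ∈ monomialsOf d, ∑ σ ∈ monomialsOf d, (coeff ρ (schur μ) * coeff σ (schur μ)) •
        ((ρ.prod fun k c => Y k ^ c) * σ.prod fun k c => Z k ^ c) := by
    intro μ hμ
    rw [schurAt_eq_sum, schurAt_eq_sum, Finset.sum_mul_sum, mem_partitionsOf.1 hμ]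
    refine Finset.sum_congr rfl fun ρ _ => Finset.sum_congr rfl fun σ _ => ?_
    rw [smul_mul_smul_comm]
  rw [Finset.sum_congr rfl h1, Finset.sum_comm, hAt, aeval_eq_sum_of_support_subset _ _ hs]
  refine Finset.sum_congr rfl fun ρ hρ => ?_
  rw [Finset.sum_comm]
  simp only [← Finset.sum_smul]
  have h2 : partitionsOf (wt ρ) ⊆ partitionsOf d := by rw [mem_monomialsOf.1 hρ]
  simp only [sum_coeff_schur_mul _ h2, ite_smul, zero_smul]
  rw [Finset.sum_ite_eq, if_pos hρ, coeff_hSym, if_pos (mem_monomialsOf.1 hρ)]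
  simp [Finsupp.prod, mul_pow, Finset.prod_mul_distrib]

end Complete

end TopVertex
end

noncomputable section
namespace TopVertex
open MvPolynomial Finset

/-! ### Matrix elements of vertex operators as determinants -/

section Pairing

/-- The degree `d` part in `a p` of `exp (∑ a_k p_k / k) s_ν(p + a)`. -/
def vertexTerm (a : ℕ+ → K) (ν : YoungDiagram) (d : ℕ) : Sym :=
  hAt (fun k => C (a k) * X k) d * schurAt (fun k => X k + C (a k)) ν

/-- The pairing of `s_μ` with `exp (∑ a_k p_k / k) s_ν(p + a)`. -/
def vertexPairing (a : ℕ+ → K) (μ ν : YoungDiagram) : K :=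
  ∑ d ∈ range (μ.card + 1), hall (vertexTerm a ν d) (schur μ)

theorem hAt_C_mul_X (a : ℕ+ → K) (d : ℕ) : (hAt (fun k => C (a k) * X k) d : Sym) =
    ∑ ρ ∈ monomialsOf d, monomial ρ (coeff ρ (hSym d) * ρ.prod fun k c => a k ^ c) := by
  have hs : (hSym d).support ⊆ monomialsOf d := by
    intro ρ hρ
    rw [mem_monomialsOf]
    by_contra h
    rw [mem_support_iff, coeff_hSym, if_neg h] at hρ
    exact hρ rfl
  rw [hAt, aeval_eq_sum_of_support_subset _ _ hs]
  refine Finset.sum_congr rfl fun ρ _ => ?_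
  rw [MvPolynomial.monomial_eq, MvPolynomial.smul_eq_C_mul, C_mul, mul_assoc]
  congr 1
  simp [Finsupp.prod, mul_pow, Finset.prod_mul_distrib, map_prod]

/-- The factor `h_d` has weight `d`, so the term has no monomial of weight below `d`, whereas `s_μ`
lives in weight `|μ|`. This justifies the finite sum in `vertexPairing`. -/
theorem hall_vertexTerm_of_lt (a : ℕ+ → K) (μ ν : YoungDiagram) {d : ℕ} (h : μ.card < d) :
    hall (vertexTerm a ν d) (schur μ) = 0 := by
  rw [hall_comm, hall]
  refine Finset.sum_eq_zero fun ρ hρ => ?_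
  have hρ' := mem_monomialsOf.1 (support_schur_subset μ hρ)
  have : coeff ρ (vertexTerm a ν d) = 0 := by
    rw [vertexTerm, hAt_C_mul_X, Finset.sum_mul, coeff_sum]
    refine Finset.sum_eq_zero fun σ hσ => ?_
    rw [coeff_monomial_mul', if_neg]
    intro hle
    have h1 := wt_add σ (ρ - σ)
    rw [add_tsub_cancel_of_le hle, mem_monomialsOf.1 hσ] at h1
    omega
  rw [this]
  ring

theorem sum_hall_vertexTerm (a : ℕ+ → K) (μ ν : YoungDiagram) {D : ℕ} (h : μ.card ≤ D) :
    ∑ d ∈ range (D + 1), hall (vertexTerm a ν d) (schur μ) = vertexPairing a μ ν := by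
  refine (Finset.sum_subset (range_mono (by omega)) fun d _ hd => ?_).symm
  exact hall_vertexTerm_of_lt _ _ _ (by simpa using hd)

/-- The matrix elements in one row and one column. -/
def hookEntry (a : ℕ+ → K) (m n : ℕ) : K :=
  ∑ p ∈ antidiagonal m, hAt a p.1 * hAtInt a ((n : ℤ) - (p.2 : ℤ))

theorem coeff_hAt_pw_add (a : ℕ+ → K) (n e : ℕ) :
    (hAt (pw Polynomial.X + fun k => Polynomial.C (a k)) n).coeff e =
      hAtInt a ((n : ℤ) - (e : ℤ)) := by
  have h1 : ∀ j, hAt (fun k => Polynomial.C (a k)) j = Polynomial.C (hAt a j) := fun j =>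
    (map_hAt (Polynomial.CAlgHom (R := K) (A := K)) a j).symm
  rw [hAt_add, Polynomial.finsetSum_coeff]
  simp only [hAt_pw, h1, Polynomial.coeff_X_pow_mul', Polynomial.coeff_C]
  by_cases h : e ≤ n
  · rw [Finset.sum_eq_single (e, n - e), ← Nat.cast_sub h, hAtInt_natCast]
    · simp
    · rintro ⟨i, j⟩ hp hne
      have hp' := mem_antidiagonal.1 hp
      simp only at hp'
      by_cases hi : i ≤ e
      · rw [if_pos hi, if_neg]
        intro h0
        apply hne
        ext <;> simp <;> omega
      · rw [if_neg hi]
    · intro h'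
      exact absurd (HasAntidiagonal.mem_antidiagonal.2 (by simp [h])) h'
  · rw [hAtInt_neg _ (by omega)]
    refine Finset.sum_eq_zero fun p hp => ?_
    have hp' := mem_antidiagonal.1 hp
    split_ifs <;> first | rfl | omega

theorem aeval_vertexTerm {R : Type*} [CommRing R] [Algebra K R] (a : ℕ+ → K) (ν : YoungDiagram)
    (d : ℕ) (Y : ℕ+ → R) : aeval Y (vertexTerm a ν d) =
      hAt (fun k => algebraMap K R (a k) * Y k) d * schurAt (Y + fun k => algebraMap K R (a k)) ν := by
  rw [vertexTerm, map_mul, map_hAt (aeval Y), map_schurAt (aeval Y)]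
  congr 2
  · ext1 k
    rw [map_mul, aeval_X, algHom_C]
  · ext1 k
    rw [map_add, aeval_X, algHom_C]
    rfl

/-- In `N` variables the exponential becomes `∏ H_a(x_i)`, and the Vandermonde determinant times
`s_ν(x + a)` is the determinant of the `h_n(x_i + a)`. Distributing the product over the columns,
one extracts the coefficient of `x^{μ+δ}` one variable at a time. -/
theorem vertexPairing_eq_det (a : ℕ+ → K) {μ ν : YoungDiagram} {N : ℕ} (hμ : μ.colLen 0 ≤ N)
    (hν : ν.colLen 0 ≤ N) : vertexPairing a μ ν =
      Matrix.det (Matrix.of fun i j : Fin N => hookEntry a (shifted N μ i) (shifted N ν j)) := by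
  classical
  -- A common cutoff: at least `|μ|`, so that the pairing is complete, and at least the total degree
  -- of the coefficient to be extracted.
  set D := μ.card + ∑ i, shifted N μ i with hD
  rw [← sum_hall_vertexTerm a μ ν (show μ.card ≤ D by omega)]
  set q : Polynomial K := ∑ e ∈ range (D + 1), Polynomial.monomial e (hAt a e) with hq
  set f : Fin N → Polynomial K := fun r =>
    hAt (pw Polynomial.X + fun k => Polynomial.C (a k)) (shifted N ν r) with hf
  have hqc : ∀ e, e ≤ D → q.coeff e = hAt a e := by
    intro e he
    rw [hq, Polynomial.finsetSum_coeff]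
    simp only [Polynomial.coeff_monomial]
    rw [Finset.sum_ite_eq', if_pos (mem_range.2 (by omega))]
  set A : MvPolynomial (Fin N) K := ∑ d ∈ range (D + 1), hAt (fun k => C (a k) * tSum N k) d with hA
  have hAc : ∀ l : Fin N →₀ ℕ, ∑ i, l i ≤ D → coeff l A = ∏ i, hAt a (l i) := by
    intro l hl
    have e : (fun k => C (a k) * tSum N k) =
        ∑ i, fun k : ℕ+ => (X i : MvPolynomial (Fin N) K) ^ (k : ℕ) * C (a k) := by
      ext1 k
      simp [tSum, pw, mul_comm (C (a k)), Finset.sum_mul]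
    have e2 : ∀ n, hAt (fun k => C (a k) : ℕ+ → MvPolynomial (Fin N) K) n = C (hAt a n) := by
      intro n
      exact (map_hAt (Algebra.ofId K (MvPolynomial (Fin N) K)) a n).symm
    rw [hA, e, coeff_sum]
    simp only [hAt_sum, hAt_mul_pow, e2, prod_X_pow_mul_C, coeff_sum, coeff_monomial,
      Finset.sum_ite_eq', mem_finsuppAntidiag, subset_univ, and_true]
    rw [Finset.sum_ite_eq, if_pos (mem_range.2 (Nat.lt_succ_of_le hl))]
  have hstep : ∑ d ∈ range (D + 1), hall (vertexTerm a ν d) (schur μ) =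
      coeff (shiftedF N μ) (A * Matrix.det (Matrix.of fun r i =>
        Polynomial.aeval (X i : MvPolynomial (Fin N) K) (f r))) := by
    have h6 : ∀ d, hall (vertexTerm a ν d) (schur μ) = coeff (shiftedF N μ)
        (vdm N * (hAt (fun k => C (a k) * tSum N k) d * schurAt (tSum N + fun k => C (a k)) ν)) := by
      intro d
      rw [hall_schur _ _ hμ, aeval_vertexTerm]
      rfl
    rw [Finset.sum_congr rfl fun d _ => h6 d, ← coeff_sum, ← Finset.mul_sum, ← Finset.sum_mul,
      ← vdm_mul_schurAt ν hν, mul_left_comm]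
  have hm : ∑ i, shiftedF N μ i ≤ D := by rw [hD]; exact Nat.le_add_left _ _
  -- The truncation `A` by total degree and the product of the truncations `q` in each variable
  -- differ only in degrees above `D`, which the extracted coefficient does not see.
  have hswap : coeff (shiftedF N μ) (A * Matrix.det (Matrix.of fun r i =>
        Polynomial.aeval (X i : MvPolynomial (Fin N) K) (f r))) =
      coeff (shiftedF N μ) ((∏ i, Polynomial.aeval (X i : MvPolynomial (Fin N) K) q) *
        Matrix.det (Matrix.of fun r i =>
        Polynomial.aeval (X i : MvPolynomial (Fin N) K) (f r))) := by
    rw [coeff_mul, coeff_mul]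
    refine Finset.sum_congr rfl fun p hp => ?_
    have hp' : p.1 ≤ shiftedF N μ := by
      rw [← mem_antidiagonal.1 hp]; exact le_self_add
    have hs : ∑ i, p.1 i ≤ D := (Finset.sum_le_sum fun i _ => hp' i).trans hm
    rw [hAc _ hs, coeff_prod_aeval_X]
    congr 1
    refine Finset.prod_congr rfl fun i _ => (hqc _ ?_).symm
    exact (Finset.single_le_sum (f := fun i => p.1 i) (fun _ _ => Nat.zero_le _)
      (mem_univ i)).trans hs
  rw [hstep, hswap, ← Matrix.det_mul_row]
  have e3 : (Matrix.of fun r i => Polynomial.aeval (X i : MvPolynomial (Fin N) K) q *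
      (Matrix.of fun r i => Polynomial.aeval (X i : MvPolynomial (Fin N) K) (f r)) r i) =
      Matrix.of fun r i => Polynomial.aeval (X i : MvPolynomial (Fin N) K) (q * f r) := by
    ext r i : 2
    simp
  rw [e3, coeff_det_aeval_X, ← Matrix.det_transpose]
  congr 1
  ext i r
  simp only [Matrix.transpose_apply, Matrix.of_apply, Polynomial.coeff_mul, hookEntry]
  refine Finset.sum_congr rfl fun p hp => ?_
  have hp' := mem_antidiagonal.1 hp
  have h4 : shifted N μ i ≤ D := (Finset.single_le_sum (f := fun i => shiftedF N μ i)
    (fun _ _ => Nat.zero_le _) (mem_univ i)).trans hm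
  rw [hqc _ (by omega), hf, coeff_hAt_pw_add]

end Pairing

end TopVertex
end

noncomputable section
namespace TopVertex
open MvPolynomial Finset

/-! ### Shifted rows and complementary shifted columns of a diagram -/

section Complement

variable {N M : ℕ}

theorem rowLen_le {μ : YoungDiagram} (hM : μ.rowLen 0 ≤ M) (i : ℕ) : μ.rowLen i ≤ M :=
  (μ.rowLen_anti 0 i (Nat.zero_le _)).trans hM

theorem colLen_le {μ : YoungDiagram} (hN : μ.colLen 0 ≤ N) (j : ℕ) : μ.colLen j ≤ N :=
  (μ.colLen_anti 0 j (Nat.zero_le _)).trans hN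

/-- The shifted rows of a diagram inside an `N × M` rectangle, together with the complementary
set of shifted columns. -/
def shiftFun (N M : ℕ) (μ : YoungDiagram) : Fin N ⊕ Fin M → ℕ :=
  Sum.elim (fun i => μ.rowLen i + (N - 1 - i)) (fun j => N + j - μ.colLen j)

theorem shiftFun_lt {μ : YoungDiagram} (hM : μ.rowLen 0 ≤ M) (x : Fin N ⊕ Fin M) :
    shiftFun N M μ x < N + M := by
  rcases x with i | j
  · have := rowLen_le hM i
    have := i.2
    simp only [shiftFun, Sum.elim_inl]
    omega
  · have := j.2
    simp only [shiftFun, Sum.elim_inr]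
    omega

/-- Inside the diagram the sum is at least `i + j + 2`, outside it is at most `i + j`. This gap
separates the shifted rows from the complementary columns. -/
theorem rowLen_add_colLen_ne (μ : YoungDiagram) (i j : ℕ) :
    μ.rowLen i + μ.colLen j ≠ i + j + 1 := by
  by_cases h : (i, j) ∈ μ
  · have := YoungDiagram.mem_iff_lt_rowLen.1 h
    have := YoungDiagram.mem_iff_lt_colLen.1 h
    omega
  · have h1 : ¬ j < μ.rowLen i := fun h' => h (YoungDiagram.mem_iff_lt_rowLen.2 h')
    have h2 : ¬ i < μ.colLen j := fun h' => h (YoungDiagram.mem_iff_lt_colLen.2 h')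
    omega

theorem shiftFun_injective {μ : YoungDiagram} (hN : μ.colLen 0 ≤ N) :
    Function.Injective (shiftFun N M μ) := by
  have hrow : ∀ i j : Fin N, i < j → shiftFun N M μ (.inl j) < shiftFun N M μ (.inl i) :=
    fun i j h => shifted_strictAnti N μ h
  have hcol : ∀ i j : Fin M, i < j → shiftFun N M μ (.inr i) < shiftFun N M μ (.inr j) := by
    intro i j h
    have h1 := μ.colLen_anti i j (le_of_lt h)
    have h2 := colLen_le hN i
    have h3 : (i : ℕ) < j := h
    simp only [shiftFun, Sum.elim_inr]
    omega
  have hmix : ∀ (i : Fin N) (j : Fin M), shiftFun N M μ (.inl i) ≠ shiftFun N M μ (.inr j) := by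
    intro i j h
    have h1 := rowLen_add_colLen_ne μ i j
    have h2 := colLen_le hN j
    have h3 := i.2
    simp only [shiftFun, Sum.elim_inr, Sum.elim_inl] at h
    omega
  rintro (i | i) (j | j) h
  · rcases lt_trichotomy i j with h1 | h1 | h1
    · exact absurd h (hrow i j h1).ne'
    · rw [h1]
    · exact absurd h (hrow j i h1).ne
  · exact absurd h (hmix i j)
  · exact absurd h.symm (hmix j i)
  · rcases lt_trichotomy i j with h1 | h1 | h1
    · exact absurd h (hcol i j h1).ne
    · rw [h1]
    · exact absurd h (hcol j i h1).ne'

/-- `shiftFun` as a bijection. -/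
def shiftEquiv (μ : YoungDiagram) (hN : μ.colLen 0 ≤ N) (hM : μ.rowLen 0 ≤ M) :
    Fin N ⊕ Fin M ≃ Fin (N + M) :=
  Equiv.ofBijective (fun x => ⟨shiftFun N M μ x, shiftFun_lt hM x⟩) <|
    (Fintype.bijective_iff_injective_and_card _).2
      ⟨fun _ _ h => shiftFun_injective hN (congrArg Fin.val h), by simp⟩

theorem shiftEquiv_val (μ : YoungDiagram) (hN : μ.colLen 0 ≤ N) (hM : μ.rowLen 0 ≤ M)
    (x : Fin N ⊕ Fin M) : (shiftEquiv μ hN hM x : ℕ) = shiftFun N M μ x := rfl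

/-- The corner removed is the last cell of the last row; the statement records exactly what an
induction on the size needs. -/
theorem exists_corner {μ : YoungDiagram} (h : μ ≠ ⊥) : ∃ (μ' : YoungDiagram) (i j : ℕ),
    μ'.card + 1 = μ.card ∧ (i, j) ∈ μ ∧ μ.rowLen i = j + 1 ∧ μ.colLen j = i + 1 ∧
    μ'.rowLen i = j ∧ μ'.colLen j = i ∧ (∀ a, a ≠ i → μ'.rowLen a = μ.rowLen a) ∧
    ∀ b, b ≠ j → μ'.colLen b = μ.colLen b := by
  have h0 : 0 < μ.colLen 0 := by
    by_contra hc
    apply h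
    apply YoungDiagram.ext
    refine Finset.eq_empty_of_forall_notMem fun c hc' => ?_
    have := YoungDiagram.mem_iff_lt_colLen.1 ((YoungDiagram.mem_cells _).1 hc')
    have := μ.colLen_anti 0 c.2 (Nat.zero_le _)
    omega
  obtain ⟨i, hi⟩ : ∃ i, μ.colLen 0 = i + 1 := ⟨μ.colLen 0 - 1, by omega⟩
  have h1 : (i, 0) ∈ μ := YoungDiagram.mem_iff_lt_colLen.2 (by omega)
  have h2 := YoungDiagram.mem_iff_lt_rowLen.1 h1
  obtain ⟨j, hj⟩ : ∃ j, μ.rowLen i = j + 1 := ⟨μ.rowLen i - 1, by omega⟩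
  have hij : (i, j) ∈ μ := YoungDiagram.mem_iff_lt_rowLen.2 (by omega)
  have hmax : ∀ c ∈ μ, (i, j) ≤ c → c = (i, j) := by
    rintro ⟨a, b⟩ hc ⟨h3, h4⟩
    have h5 := YoungDiagram.mem_iff_lt_colLen.1 hc
    have h6 := μ.colLen_anti 0 b (Nat.zero_le _)
    simp only at h3 h4
    obtain rfl : a = i := by omega
    have h7 := YoungDiagram.mem_iff_lt_rowLen.1 hc
    rw [show b = j by omega]
  let μ' : YoungDiagram :=
    { cells := μ.cells.erase (i, j)
      isLowerSet := by
        intro c c' hle hc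
        simp only [coe_erase, Set.mem_sdiff, Finset.mem_coe, YoungDiagram.mem_cells,
          Set.mem_singleton_iff] at hc ⊢
        exact ⟨μ.isLowerSet hle hc.1, fun he => hc.2 (hmax c hc.1 (he ▸ hle))⟩ }
  have hmem : ∀ a b, (a, b) ∈ μ' ↔ (a, b) ∈ μ ∧ ¬ (a = i ∧ b = j) := by
    intro a b
    have : (a, b) ∈ μ' ↔ (a, b) ∈ μ.cells.erase (i, j) := Iff.rfl
    rw [this, mem_erase, YoungDiagram.mem_cells, and_comm, ne_eq, Prod.mk.injEq]
  have hcol : μ.colLen j = i + 1 := by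
    have h8 := YoungDiagram.mem_iff_lt_colLen.1 hij
    have h9 := μ.colLen_anti 0 j (Nat.zero_le _)
    omega
  refine ⟨μ', i, j, ?_, hij, hj, hcol, ?_, ?_, ?_, ?_⟩
  · exact card_erase_add_one ((YoungDiagram.mem_cells _).2 hij)
  · refine eq_of_forall_lt_iff fun b => ?_
    rw [← YoungDiagram.mem_iff_lt_rowLen, hmem, YoungDiagram.mem_iff_lt_rowLen, hj]
    omega
  · refine eq_of_forall_lt_iff fun b => ?_
    rw [← YoungDiagram.mem_iff_lt_colLen, hmem, YoungDiagram.mem_iff_lt_colLen, hcol]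
    omega
  · intro a ha
    refine eq_of_forall_lt_iff fun b => ?_
    rw [← YoungDiagram.mem_iff_lt_rowLen, hmem, YoungDiagram.mem_iff_lt_rowLen]
    tauto
  · intro b hb
    refine eq_of_forall_lt_iff fun a => ?_
    rw [← YoungDiagram.mem_iff_lt_colLen, hmem, YoungDiagram.mem_iff_lt_colLen]
    tauto

theorem colLen_bot (j : ℕ) : (⊥ : YoungDiagram).colLen j = 0 := by
  rw [YoungDiagram.colLen_eq_card]; rfl

theorem rowLen_bot (j : ℕ) : (⊥ : YoungDiagram).rowLen j = 0 := by
  rw [YoungDiagram.rowLen_eq_card]; rfl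

/-- Removing a corner `(i, j)` exchanges the values of row `i` and column `j`, namely `N + j - i`
and `N + j - i - 1`, and fixes all others. Each cell therefore contributes one transposition. -/
theorem sign_shiftEquiv (μ : YoungDiagram) (hN : μ.colLen 0 ≤ N) (hM : μ.rowLen 0 ≤ M)
    (hN0 : (⊥ : YoungDiagram).colLen 0 ≤ N) (hM0 : (⊥ : YoungDiagram).rowLen 0 ≤ M) :
    Equiv.Perm.sign ((shiftEquiv ⊥ hN0 hM0).symm.trans (shiftEquiv μ hN hM)) =
      (-1) ^ μ.card := by
  induction hn : μ.card generalizing μ with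
  | zero =>
    obtain rfl := card_eq_zero_iff.1 hn
    simp
  | succ n ih =>
    have hne : μ ≠ ⊥ := by
      rintro rfl
      rw [card_eq_zero_iff.2 rfl] at hn
      omega
    obtain ⟨μ', i, j, hcard, hmem, h1, h2, h3, h4, h5, h6⟩ := exists_corner hne
    have hi : i < N := by have := colLen_le hN j; omega
    have hj : j < M := by have := rowLen_le hM i; omega
    have hN' : μ'.colLen 0 ≤ N := by
      by_cases h : 0 = j
      · rw [h, h4]; omega
      · rw [h6 0 h]; exact hN
    have hM' : μ'.rowLen 0 ≤ M := by
      by_cases h : 0 = i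
      · rw [h, h3]; omega
      · rw [h5 0 h]; exact hM
    have e1 : shiftEquiv μ' hN' hM' (.inl ⟨i, hi⟩) = shiftEquiv μ hN hM (.inr ⟨j, hj⟩) := by
      apply Fin.ext
      simp only [shiftEquiv_val, shiftFun, Sum.elim_inl, Sum.elim_inr, h3, h2]
      omega
    have e2 : shiftEquiv μ' hN' hM' (.inr ⟨j, hj⟩) = shiftEquiv μ hN hM (.inl ⟨i, hi⟩) := by
      apply Fin.ext
      simp only [shiftEquiv_val, shiftFun, Sum.elim_inl, Sum.elim_inr, h4, h1]
      omega
    have e3 : ∀ x, x ≠ .inl ⟨i, hi⟩ → x ≠ .inr ⟨j, hj⟩ →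
        shiftEquiv μ' hN' hM' x = shiftEquiv μ hN hM x := by
      rintro (x | x) hx1 hx2 <;> apply Fin.ext <;>
        simp only [shiftEquiv_val, shiftFun, Sum.elim_inl, Sum.elim_inr]
      · rw [h5]
        rintro h
        exact hx1 (by simp [← h])
      · rw [h6]
        rintro h
        exact hx2 (by simp [← h])
    set p := shiftEquiv μ hN hM (.inl ⟨i, hi⟩) with hp
    set q := shiftEquiv μ hN hM (.inr ⟨j, hj⟩) with hq
    have hpq : p ≠ q := fun h => by simpa using (shiftEquiv μ hN hM).injective h
    have e4 : shiftEquiv μ hN hM = (shiftEquiv μ' hN' hM').trans (Equiv.swap p q) := by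
      ext1 x
      rw [Equiv.trans_apply]
      by_cases hx1 : x = .inl ⟨i, hi⟩
      · rw [hx1, e1, Equiv.swap_apply_right]
      · by_cases hx2 : x = .inr ⟨j, hj⟩
        · rw [hx2, e2, Equiv.swap_apply_left]
        · rw [e3 x hx1 hx2, Equiv.swap_apply_of_ne_of_ne]
          · exact fun h => hx1 ((shiftEquiv μ hN hM).injective h)
          · exact fun h => hx2 ((shiftEquiv μ hN hM).injective h)
    rw [e4, ← Equiv.trans_assoc, Equiv.Perm.sign_trans, Equiv.Perm.sign_swap hpq,
      ih μ' hN' hM' (by omega), pow_succ, mul_comm]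

end Complement

/-! ### Transposition of diagrams -/

section Transpose

variable {R : Type*} [CommRing R] [Algebra K R]

/-- Complementary minors of inverse matrices. -/
theorem det_mul_det_toBlocks₂₂ {m n : Type*} [Fintype m] [Fintype n] [DecidableEq m]
    [DecidableEq n] {A : Type*} [CommRing A] (P Q : Matrix (m ⊕ n) (m ⊕ n) A) (h : P * Q = 1) :
    P.det * Q.toBlocks₂₂.det = P.toBlocks₁₁.det := by
  -- Replacing the first block column of `Q` by that of the identity turns the product into a block
  -- triangular matrix, and all determinants become visible.
  have h1 : P * Matrix.fromBlocks 1 Q.toBlocks₁₂ 0 Q.toBlocks₂₂ =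
      Matrix.fromBlocks P.toBlocks₁₁ 0 P.toBlocks₂₁ 1 := by
    conv_lhs => rw [← Matrix.fromBlocks_toBlocks P]
    rw [← Matrix.fromBlocks_toBlocks P, ← Matrix.fromBlocks_toBlocks Q, Matrix.fromBlocks_multiply,
      ← Matrix.fromBlocks_one, Matrix.fromBlocks_inj] at h
    rw [Matrix.fromBlocks_multiply]
    simp [h.2.1, h.2.2.2]
  have h2 := congrArg Matrix.det h1
  rw [Matrix.det_mul, Matrix.det_fromBlocks_zero₂₁, Matrix.det_fromBlocks_zero₁₂] at h2
  simpa using h2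

/-- The Toeplitz matrix of the complete homogeneous functions. -/
def hMatrix (Y : ℕ+ → R) (L : ℕ) : Matrix (Fin L) (Fin L) R :=
  Matrix.of fun i j => hAtInt Y ((i : ℤ) - (j : ℤ))

/-- Lower triangular Toeplitz matrices multiply like truncated power series, and the series of `Y`
and `-Y` are mutually inverse. -/
theorem hMatrix_mul_neg (Y : ℕ+ → R) (L : ℕ) : hMatrix Y L * hMatrix (-Y) L = 1 := by
  ext a b
  rw [Matrix.mul_apply, Matrix.one_apply]
  simp only [hMatrix, Matrix.of_apply]
  by_cases hab : b ≤ a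
  · obtain ⟨n, hn⟩ : ∃ n, (a : ℕ) = b + n := ⟨a - b, by have : (b : ℕ) ≤ a := hab; omega⟩
    have h1 := hAt_add (-Y) Y n
    rw [neg_add_cancel, hAt_zero_fun, Finset.Nat.sum_antidiagonal_eq_sum_range_succ_mk] at h1
    have h2 : (if a = b then (1 : R) else 0) = if n = 0 then 1 else 0 := by
      have : a = b ↔ n = 0 := by rw [Fin.ext_iff]; omega
      simp only [this]
    set f : ℕ → R := fun c => hAtInt Y ((a : ℤ) - (c : ℤ)) * hAtInt (-Y) ((c : ℤ) - (b : ℤ)) with hf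
    have h3 : ∑ c ∈ range L, f c = ∑ c ∈ Ico (b : ℕ) (b + (n + 1)), f c := by
      refine (Finset.sum_subset (fun c hc => ?_) fun c _ hc => ?_).symm
      · have := mem_Ico.1 hc
        have := a.2
        exact mem_range.2 (by omega)
      · rw [mem_Ico] at hc
        simp only [hf]
        by_cases h : c < b
        · rw [hAtInt_neg (-Y) (by omega), mul_zero]
        · rw [hAtInt_neg Y (by omega), zero_mul]
    rw [h2, h1, ← Finset.sum_range f, h3, Finset.sum_Ico_eq_sum_range]
    refine Finset.sum_congr (by simp) fun c hc => ?_
    rw [mem_range] at hc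
    rw [hf]
    simp only
    rw [show (a : ℤ) - ((b + c : ℕ) : ℤ) = ((n - c : ℕ) : ℤ) by omega,
      show ((b + c : ℕ) : ℤ) - (b : ℤ) = (c : ℤ) by omega, hAtInt_natCast, hAtInt_natCast, mul_comm]
  · rw [if_neg (fun h => hab h.symm.le)]
    refine Finset.sum_eq_zero fun c _ => ?_
    have : (a : ℕ) < b := not_le.1 hab
    by_cases h : a < c
    · have : (a : ℕ) < c := h
      rw [hAtInt_neg _ (by omega), zero_mul]
    · have : (c : ℕ) ≤ a := not_lt.1 h
      rw [hAtInt_neg (-Y) (by omega), mul_zero]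

theorem det_hMatrix (Y : ℕ+ → R) (L : ℕ) : (hMatrix Y L).det = 1 := by
  rw [Matrix.det_of_isLowerTriangular]
  · simp [hMatrix, hAtInt, hAt_zero]
  · intro i j hij
    have : (i : ℕ) < j := hij
    exact hAtInt_neg _ (by omega)

/-- The two Jacobi-Trudi determinants are complementary minors of the inverse Toeplitz matrices of
`Y` and `-Y`: the shifted rows of `μ` select one and the complementary columns the other. The sign
is that of the reindexing. -/
theorem schurAt_eq_neg (Y : ℕ+ → R) (μ : YoungDiagram) :
    schurAt Y μ = (-1) ^ μ.card * schurAt (-Y) μ.transpose := by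
  set N := μ.colLen 0 with hN
  set M := μ.rowLen 0 with hM
  have hN0 : (⊥ : YoungDiagram).colLen 0 ≤ N := by rw [colLen_bot]; omega
  have hM0 : (⊥ : YoungDiagram).rowLen 0 ≤ M := by rw [rowLen_bot]; omega
  set e := shiftEquiv μ hN.ge hM.ge with he
  set e0 := shiftEquiv ⊥ hN0 hM0 with he0
  have h1 := det_mul_det_toBlocks₂₂ ((hMatrix Y (N + M)).submatrix e e0)
    ((hMatrix (-Y) (N + M)).submatrix e0 e) (by
      rw [Matrix.submatrix_mul_equiv, hMatrix_mul_neg, Matrix.submatrix_one_equiv])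
  have h2 : ((hMatrix Y (N + M)).submatrix e e0).det = (-1) ^ μ.card := by
    have : (hMatrix Y (N + M)).submatrix e e0 =
        ((hMatrix Y (N + M)).submatrix (e0.symm.trans e) id).submatrix e0 e0 := by
      ext; simp
    rw [this, Matrix.det_submatrix_equiv_self, Matrix.det_permute, he, he0, sign_shiftEquiv,
      det_hMatrix]
    simp
  have h3 : ((hMatrix Y (N + M)).submatrix e e0).toBlocks₁₁.det = schurAt Y μ := by
    rw [schurAt_eq_det _ _ hN.ge]
    congr 1
    ext i j
    simp only [Matrix.toBlocks₁₁, Matrix.of_apply, Matrix.submatrix_apply, hMatrix, he, he0,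
      shiftEquiv_val, shiftFun, Sum.elim_inl, rowLen_bot]
    congr 1
    have := i.2
    have := j.2
    omega
  have h4 : ((hMatrix (-Y) (N + M)).submatrix e0 e).toBlocks₂₂.det =
      schurAt (-Y) μ.transpose := by
    rw [schurAt_eq_det _ _ (N := M) (by rw [YoungDiagram.colLen_transpose]), ← Matrix.det_transpose]
    congr 1
    ext i j
    simp only [Matrix.toBlocks₂₂, Matrix.of_apply, Matrix.submatrix_apply, hMatrix, he, he0,
      shiftEquiv_val, shiftFun, Sum.elim_inr, colLen_bot, Matrix.transpose_apply,
      YoungDiagram.rowLen_transpose]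
    congr 1
    have := colLen_le hN.ge i
    omega
  rw [← h3, ← h1, h2, h4]

/-- The involution `p_k ↦ (-1)^{k-1} p_k`. -/
def om {A : Type*} [CommRing A] (Y : ℕ+ → A) : ℕ+ → A := fun k => (-1) ^ ((k : ℕ) + 1) * Y k

theorem om_om {A : Type*} [CommRing A] (Y : ℕ+ → A) : om (om Y) = Y := by
  ext1 k
  simp only [om]
  rw [← mul_assoc, ← mul_pow]
  simp

theorem schurAt_transpose (Y : ℕ+ → R) (μ : YoungDiagram) :
    schurAt Y μ.transpose = schurAt (om Y) μ := by
  have h1 : (fun k : ℕ+ => (-1) ^ (k : ℕ) * om Y k) = -Y := by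
    ext1 k
    simp only [om, pow_succ, Pi.neg_apply]
    rw [← mul_assoc, ← mul_assoc, ← mul_pow]
    simp
  rw [schurAt_eq_neg, YoungDiagram.transpose_transpose, card_transpose, ← h1, schurAt_mul_pow,
    ← mul_assoc, ← mul_pow]
  simp

end Transpose

end TopVertex
end

noncomputable section
namespace TopVertex
open MvPolynomial Finset

/-! ### The involution `ω` and the pairing -/

section Omega

/-- The involution is diagonal in the power sum monomials with eigenvalues `±1`, and the Hall
product is diagonal there too. -/
theorem hall_om (f g : Sym) : hall (aeval (om (X : ℕ+ → Sym)) f) (aeval (om (X : ℕ+ → Sym)) g) =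
    hall f g := by
  have h1 : ∀ (f : Sym) (ρ : ℕ+ →₀ ℕ), coeff ρ (aeval (om (X : ℕ+ → Sym)) f) =
      (ρ.prod fun k c => ((-1 : K) ^ ((k : ℕ) + 1)) ^ c) * coeff ρ f := by
    intro f ρ
    induction f using MvPolynomial.induction_on' with
    | monomial σ c =>
      have : aeval (om (X : ℕ+ → Sym)) (monomial σ c) =
          monomial σ ((σ.prod fun k c => ((-1 : K) ^ ((k : ℕ) + 1)) ^ c) * c) := by
        rw [aeval_monomial, MvPolynomial.monomial_eq, C_mul]
        simp only [om, mul_pow, Finsupp.prod, Finset.prod_mul_distrib, map_prod, map_pow, map_neg,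
          map_one, algebraMap_eq]
        ring
      rw [this, coeff_monomial, coeff_monomial]
      split_ifs with h
      · rw [h]
      · simp
    | add p q hp hq => rw [map_add, coeff_add, hp, hq, coeff_add, mul_add]
  have h2 : ∀ ρ : ℕ+ →₀ ℕ, (ρ.prod fun k c => ((-1 : K) ^ ((k : ℕ) + 1)) ^ c) *
      (ρ.prod fun k c => ((-1 : K) ^ ((k : ℕ) + 1)) ^ c) = 1 := by
    intro ρ
    rw [← Finsupp.prod_mul]
    refine Finset.prod_eq_one fun k _ => ?_
    beta_reduce
    rw [← mul_pow, ← mul_pow]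
    simp
  have h3 : (aeval (om (X : ℕ+ → Sym)) f).support ⊆ f.support := by
    intro ρ hρ
    rw [mem_support_iff, h1] at hρ
    exact mem_support_iff.2 (right_ne_zero_of_mul hρ)
  rw [hall_eq_sum _ h3, hall]
  refine Finset.sum_congr rfl fun ρ _ => ?_
  rw [h1, h1]
  linear_combination coeff ρ f * coeff ρ g * (zCoeff ρ : K) * h2 ρ

/-- Apply the isometry `ω` to both entries: it transposes the Schur functions, and in `a_k p_k` the
sign can be moved from `p_k` to `a_k`. -/
theorem vertexPairing_om (a : ℕ+ → K) (μ ν : YoungDiagram) :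
    vertexPairing (om a) μ ν = vertexPairing a μ.transpose ν.transpose := by
  unfold vertexPairing
  rw [card_transpose]
  refine Finset.sum_congr rfl fun d _ => ?_
  rw [← hall_om (vertexTerm a ν.transpose d), aeval_vertexTerm]
  have e1 : aeval (om (X : ℕ+ → Sym)) (schur μ.transpose) = schur μ := by
    have := schurAt_transpose (om (X : ℕ+ → Sym)) μ
    rw [om_om] at this
    exact this.trans (by simp [schurAt])
  have e2 : (fun k => C (om a k) * X k : ℕ+ → Sym) = fun k => C (a k) * om X k := by
    ext1 k
    simp only [om, map_mul, map_pow, map_neg, map_one]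
    ring
  have e3 : om (om (X : ℕ+ → Sym) + fun k => C (a k)) = fun k => X k + C (om a k) := by
    ext1 k
    have := congrFun (om_om (X : ℕ+ → Sym)) k
    rw [← this]
    simp only [om, map_mul, map_pow, map_neg, map_one, Pi.add_apply]
    ring
  rw [e1, schurAt_transpose, vertexTerm, e2, ← e3]
  rfl

end Omega

/-! ### Matrix elements at the principal specialization -/

section Principal

theorem qHalf_ne_zero : qHalf ≠ 0 := RatFunc.X_ne_zero

theorem qHalf_pow_ne_one {n : ℕ} (hn : n ≠ 0) : qHalf ^ n ≠ 1 := by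
  intro h
  have h1 : algebraMap (Polynomial ℚ) K (Polynomial.X ^ n) = algebraMap (Polynomial ℚ) K 1 := by
    simpa [qHalf] using h
  have h2 := RatFunc.algebraMap_injective ℚ h1
  have := congrArg Polynomial.natDegree h2
  simp at this
  exact hn this

theorem qInt_ne_zero {n : ℕ} (hn : n ≠ 0) : qInt n ≠ 0 := by
  unfold qInt
  intro h
  have h0 : qHalf ^ n ≠ 0 := pow_ne_zero _ qHalf_ne_zero
  have h1 : qHalf ^ (2 * n) = 1 := by
    field_simp at h
    rw [two_mul, pow_add]
    linear_combination h
  exact qHalf_pow_ne_one (by omega) h1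

/-- The power sums of `q^ρ`. -/
def aRho : ℕ+ → K := fun k => (qInt k)⁻¹

theorem powerSumAt_bot : powerSumAt ⊥ = aRho := by
  ext1 k
  simp [powerSumAt, aRho, colLen_bot]

/-- `(q^n - 1) h_n(q^ρ) = q^{n - 1/2} h_{n-1}(q^ρ)`. -/
theorem hAt_aRho_succ (n : ℕ) : (qHalf ^ (2 * (n + 1)) - 1) * hAt aRho (n + 1) =
    qHalf ^ (2 * n + 1) * hAt aRho n := by
  have h1 : (fun k : ℕ+ => (qHalf ^ 2) ^ (k : ℕ) * aRho k) = aRho + pw qHalf := by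
    ext1 k
    have h0 := qInt_ne_zero k.ne_zero
    have h2 : qHalf ^ (k : ℕ) ≠ 0 := pow_ne_zero _ qHalf_ne_zero
    simp only [aRho, Pi.add_apply, pw]
    field_simp
    unfold qInt
    field_simp
    ring
  have h2 := hAt_add_pw_succ aRho qHalf n
  rw [← h1, hAt_mul_pow, hAt_mul_pow] at h2
  rw [← pow_mul, ← pow_mul] at h2
  rw [sub_mul, h2, pow_succ]
  ring

/-- The image under `ω` of `q^k/{k} = 1/{k} + q^{k/2}`: scaling the alphabet by `q` amounts to
removing the variable `-q^{1/2}`. -/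
theorem qHalf_pow_mul_om_aRho (k : ℕ+) :
    (qHalf ^ 2) ^ (k : ℕ) * om aRho k + (-qHalf) ^ (k : ℕ) = om aRho k := by
  have h0 := qInt_ne_zero k.ne_zero
  have h2 : qHalf ^ (k : ℕ) ≠ 0 := pow_ne_zero _ qHalf_ne_zero
  have h3 : (qHalf ^ 2) ^ (k : ℕ) * aRho k = aRho k + qHalf ^ (k : ℕ) := by
    simp only [aRho]
    field_simp
    unfold qInt
    field_simp
    ring
  rw [om, mul_left_comm, h3, neg_pow qHalf, pow_succ]
  ring

theorem hAt_om_aRho_succ (n : ℕ) : (qHalf ^ (2 * (n + 1)) - 1) * hAt (om aRho) (n + 1) =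
    qHalf * hAt (om aRho) n := by
  have h1 : (fun k : ℕ+ => (qHalf ^ 2) ^ (k : ℕ) * om aRho k) + pw (-qHalf) = om aRho := by
    ext1 k
    exact qHalf_pow_mul_om_aRho k
  have h2 := hAt_add_pw_succ (fun k : ℕ+ => (qHalf ^ 2) ^ (k : ℕ) * om aRho k) (-qHalf) n
  rw [h1, hAt_mul_pow, ← pow_mul] at h2
  linear_combination -h2

/-- Compares the recursions of `h_n` and `e_n` at `q^ρ`, whose ratio is a power of `q`. It supplies
the base case and the induction step of `hookEntry_aRho`. -/
theorem hAt_aRho_eq (n : ℕ) : qHalf ^ (2 * n) * hAt aRho n = qHalf ^ (n * (n + 1)) * hAt (om aRho) n := by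
  induction n with
  | zero => simp [hAt_zero]
  | succ n ih =>
    have h0 : qHalf ^ (2 * (n + 1)) - 1 ≠ 0 := sub_ne_zero.2 (qHalf_pow_ne_one (by omega))
    apply mul_left_cancel₀ h0
    have h1 := hAt_aRho_succ n
    have h2 := hAt_om_aRho_succ n
    have e1 : qHalf ^ ((n + 1) * (n + 1 + 1)) = qHalf ^ (n * (n + 1)) * qHalf ^ (2 * (n + 1)) := by
      rw [← pow_add]; congr 1; ring
    have e2 : qHalf ^ (2 * n + 1) = qHalf ^ (2 * n) * qHalf := pow_succ _ _
    rw [e2] at h1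
    rw [e1]
    linear_combination qHalf ^ (2 * (n + 1)) * h1 + qHalf ^ (2 * (n + 1)) * qHalf * ih -
      qHalf ^ (n * (n + 1)) * qHalf ^ (2 * (n + 1)) * h2

theorem hookEntry_zero_left (a : ℕ+ → K) (n : ℕ) : hookEntry a 0 n = hAt a n := by
  simp [hookEntry, hAt_zero, hAtInt_natCast]

theorem hookEntry_zero_right (a : ℕ+ → K) (m : ℕ) : hookEntry a m 0 = hAt a m := by
  rw [hookEntry, Finset.sum_eq_single (m, 0)]
  · simp [hAtInt, hAt_zero]
  · rintro ⟨i, j⟩ hp hne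
    have hp' := mem_antidiagonal.1 hp
    rw [hAtInt_neg, mul_zero]
    have : j ≠ 0 := by
      rintro rfl
      simp only [add_zero] at hp'
      exact hne (by rw [hp'])
    simp only
    omega
  · intro h
    exact absurd (HasAntidiagonal.mem_antidiagonal.2 (by simp)) h

theorem hookEntry_succ_succ (a : ℕ+ → K) (m n : ℕ) :
    hookEntry a (m + 1) (n + 1) = hAt a (m + 1) * hAt a (n + 1) + hookEntry a m n := by
  rw [hookEntry, Finset.Nat.sum_antidiagonal_succ', hookEntry]
  congr 1
  refine Finset.sum_congr rfl fun p _ => ?_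
  push_cast
  rw [add_sub_add_right_eq_sub]

/-- Induction on both indices along `hookEntry_succ_succ`. The point of the closed form is that, up
to a factor for `m` and a factor for `n`, the entry is `h_n` of an alphabet in which `m` only moves
the single variable `x_m = -q^{-m-1/2}`; this is the shape required by `det_hAt_eq`. -/
theorem hookEntry_aRho (m n : ℕ) : hookEntry aRho m n =
    hAt aRho m * (qHalf ^ (n * (n + 1)) * hAt (pw (-(qHalf ^ (2 * m + 1))⁻¹) + om aRho) n) := by
  induction m generalizing n with
  | zero =>
    have h1 : (fun k : ℕ+ => (qHalf ^ 2) ^ (k : ℕ) *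
        (pw (-(qHalf ^ (2 * 0 + 1))⁻¹) + om aRho) k) = om aRho := by
      ext1 k
      have h2 : qHalf ≠ 0 := qHalf_ne_zero
      have e : -qHalf = qHalf ^ 2 * -(qHalf ^ (2 * 0 + 1))⁻¹ := by field_simp; simp
      have := qHalf_pow_mul_om_aRho k
      rw [e, mul_pow] at this
      rw [Pi.add_apply, pw]
      linear_combination this
    have h3 := hAt_mul_pow (qHalf ^ 2) (pw (-(qHalf ^ (2 * 0 + 1))⁻¹) + om aRho) n
    rw [h1, ← pow_mul] at h3
    have h4 := hAt_aRho_eq n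
    rw [h3, mul_left_comm] at h4
    rw [hookEntry_zero_left, hAt_zero, one_mul]
    exact mul_left_cancel₀ (pow_ne_zero _ qHalf_ne_zero) h4
  | succ m ih =>
    rcases n with _ | n
    · simp [hookEntry_zero_right, hAt_zero]
    · set x := -(qHalf ^ (2 * m + 1))⁻¹ with hx
      set x' := -(qHalf ^ (2 * (m + 1) + 1))⁻¹ with hx'
      have hq : qHalf ≠ 0 := qHalf_ne_zero
      have hxx : x = qHalf ^ 2 * x' := by
        rw [hx, hx', show 2 * (m + 1) + 1 = (2 * m + 1) + 2 by ring, pow_add]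
        field_simp
        ring
      have hm : hAt aRho m = (qHalf + x) * hAt aRho (m + 1) := by
        have h1 := hAt_aRho_succ m
        have h2 : qHalf ^ (2 * m + 1) ≠ 0 := pow_ne_zero _ hq
        apply mul_left_cancel₀ h2
        rw [← h1, hx]
        field_simp
        ring
      have h5 := hAt_mul_pow (qHalf ^ 2) (pw x' + om aRho) (n + 1)
      -- Since `x_m = q x_{m+1}`, the alphabet at `m` is the one at `m + 1` scaled by `q`, with
      -- `-q^{1/2}` added. Computing `h_{n+1}` through this and through adding `x` to `ω q^ρ` gives
      -- the recursion.
      have h6 : (fun k : ℕ+ => (qHalf ^ 2) ^ (k : ℕ) * (pw x' + om aRho) k) + pw (-qHalf) =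
          om aRho + pw x := by
        ext1 k
        have := qHalf_pow_mul_om_aRho k
        simp only [Pi.add_apply, pw, hxx, mul_pow] at this ⊢
        linear_combination this
      have h7 := hAt_add_pw_succ
        (fun k : ℕ+ => (qHalf ^ 2) ^ (k : ℕ) * (pw x' + om aRho) k) (-qHalf) n
      rw [h6, h5, hAt_add_pw_succ, ← pow_mul] at h7
      have h8 := hAt_aRho_eq (n + 1)
      have e1 : qHalf ^ ((n + 1) * (n + 1 + 1)) = qHalf ^ (n * (n + 1)) * qHalf ^ (2 * (n + 1)) := by
        rw [← pow_add]; congr 1; ring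
      rw [e1, mul_comm (qHalf ^ (n * (n + 1))), mul_assoc] at h8
      have h9 := mul_left_cancel₀ (pow_ne_zero _ hq) h8
      rw [hookEntry_succ_succ, ih, hm, h9, e1, add_comm (pw x)]
      linear_combination hAt aRho (m + 1) * qHalf ^ (n * (n + 1)) * h7

end Principal

end TopVertex
end

noncomputable section
namespace TopVertex
open MvPolynomial Finset

/-! ### Contents and the power sums of `q^{μᵗ+ρ}` -/

section Contents

theorem sum_cells_transpose {M : Type*} [AddCommMonoid M] (μ : YoungDiagram) (f : ℕ × ℕ → M) :
    ∑ c ∈ μ.transpose.cells, f c = ∑ c ∈ μ.cells, f c.swap := by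
  refine Finset.sum_equiv (Equiv.prodComm ℕ ℕ) (fun c => ?_) fun c _ => ?_
  · simp
  · simp

theorem kappa_eq_sum_cells (μ : YoungDiagram) :
    kappa μ = ∑ c ∈ μ.cells, 2 * ((c.2 : ℤ) - (c.1 : ℤ)) := by
  rw [sum_cells μ le_rfl, kappa]
  refine Finset.sum_congr rfl fun i _ => ?_
  generalize μ.rowLen i = r
  induction r with
  | zero => simp
  | succ r ih =>
    rw [Finset.sum_range_succ, ← ih]
    push_cast
    ring

theorem kappa_transpose (μ : YoungDiagram) : kappa μ.transpose = -kappa μ := by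
  rw [kappa_eq_sum_cells, kappa_eq_sum_cells, sum_cells_transpose, ← Finset.sum_neg_distrib]
  refine Finset.sum_congr rfl fun c _ => ?_
  simp only [Prod.fst_swap, Prod.snd_swap]
  ring

theorem kappa_eq_sum_range (μ : YoungDiagram) {N : ℕ} (hN : μ.colLen 0 ≤ N) :
    kappa μ = ∑ i ∈ range N, (μ.rowLen i : ℤ) * (μ.rowLen i - 2 * (i + 1) + 1) := by
  rw [kappa]
  refine Finset.sum_subset (range_mono hN) fun i _ hi => ?_
  rw [rowLen_eq_zero (by simpa using hi)]
  simp

variable {k : ℕ}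

theorem zpow_sub_eq_sum (r i : ℕ) :
    qHalf ^ ((k : ℤ) * (2 * (r : ℤ) - 2 * (i : ℤ) - 1)) - qHalf ^ ((k : ℤ) * (-2 * (i : ℤ) - 1)) =
      qInt k * ∑ j ∈ range r, qHalf ^ ((k : ℤ) * (2 * ((j : ℤ) - (i : ℤ)))) := by
  have hq := qHalf_ne_zero
  induction r with
  | zero => simp
  | succ r ih =>
    rw [Finset.sum_range_succ, mul_add (qInt k), ← ih, qInt, sub_mul, ← zpow_natCast, ← zpow_neg,
      ← zpow_add₀ hq, ← zpow_add₀ hq]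
    have e1 : (k : ℤ) + k * (2 * ((r : ℤ) - i)) = k * (2 * ((r + 1 : ℕ) : ℤ) - 2 * i - 1) := by
      push_cast; ring
    have e2 : -(k : ℤ) + k * (2 * ((r : ℤ) - i)) = k * (2 * (r : ℤ) - 2 * i - 1) := by ring
    rw [e1, e2]
    ring

theorem zpow_sub_eq_sum' (r i : ℕ) :
    qHalf ^ ((k : ℤ) * (2 * (i : ℤ) + 1)) - qHalf ^ ((k : ℤ) * (2 * (i : ℤ) + 1 - 2 * (r : ℤ))) =
      qInt k * ∑ j ∈ range r, qHalf ^ ((k : ℤ) * (2 * ((i : ℤ) - (j : ℤ)))) := by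
  have hq := qHalf_ne_zero
  induction r with
  | zero => simp
  | succ r ih =>
    rw [Finset.sum_range_succ, mul_add (qInt k), ← ih, qInt, sub_mul, ← zpow_natCast, ← zpow_neg,
      ← zpow_add₀ hq, ← zpow_add₀ hq]
    have e1 : (k : ℤ) + k * (2 * ((i : ℤ) - r)) = k * (2 * (i : ℤ) + 1 - 2 * r) := by ring
    have e2 : -(k : ℤ) + k * (2 * ((i : ℤ) - r)) = k * (2 * (i : ℤ) + 1 - 2 * ((r + 1 : ℕ) : ℤ)) := by
      push_cast; ring
    rw [e1, e2]
    ring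

/-- The corrections computed from the rows of `μ` and of `μᵗ` are both `{k}` times a sum of powers
of `q` over the contents of the cells. The alphabet is thus expressed by the rows of `μ`, which are
the data in the determinant. -/
theorem powerSumAt_transpose (μ : YoungDiagram) {N : ℕ} (hN : μ.colLen 0 ≤ N) (k : ℕ+) :
    powerSumAt μ.transpose k = (qHalf ^ (2 * N)) ^ (k : ℕ) * aRho k -
      ∑ i ∈ range N, qHalf ^ ((k : ℤ) * (2 * (i : ℤ) + 1 - 2 * (μ.rowLen i : ℤ))) := by
  have hk : (k : ℕ) ≠ 0 := k.ne_zero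
  have hq := qHalf_ne_zero
  have h0 := qInt_ne_zero hk
  have h1 : powerSumAt μ.transpose k = aRho k +
      qInt k * ∑ c ∈ μ.cells, qHalf ^ ((k : ℤ) * (2 * ((c.1 : ℤ) - (c.2 : ℤ)))) := by
    rw [powerSumAt, Finset.sum_congr rfl fun i _ => zpow_sub_eq_sum (μ.transpose.rowLen i) i,
      ← Finset.mul_sum, ← sum_cells μ.transpose le_rfl fun c : ℕ × ℕ =>
        qHalf ^ ((k : ℤ) * (2 * ((c.2 : ℤ) - (c.1 : ℤ)))), sum_cells_transpose]
    rfl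
  have h2 : ∑ i ∈ range N, qHalf ^ ((k : ℤ) * (2 * (i : ℤ) + 1)) -
      ∑ i ∈ range N, qHalf ^ ((k : ℤ) * (2 * (i : ℤ) + 1 - 2 * (μ.rowLen i : ℤ))) =
      qInt k * ∑ c ∈ μ.cells, qHalf ^ ((k : ℤ) * (2 * ((c.1 : ℤ) - (c.2 : ℤ)))) := by
    rw [← Finset.sum_sub_distrib, sum_cells μ hN, Finset.mul_sum]
    exact Finset.sum_congr rfl fun i _ => zpow_sub_eq_sum' _ i
  have h3 : ∀ N : ℕ, aRho k + ∑ i ∈ range N, qHalf ^ ((k : ℤ) * (2 * (i : ℤ) + 1)) =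
      (qHalf ^ (2 * N)) ^ (k : ℕ) * aRho k := by
    intro N
    induction N with
    | zero => simp
    | succ N ih =>
      rw [Finset.sum_range_succ, ← add_assoc, ih]
      have e1 : qHalf ^ ((k : ℤ) * (2 * (N : ℤ) + 1)) =
          (qHalf ^ (2 * N)) ^ (k : ℕ) * qHalf ^ (k : ℕ) := by
        rw [← pow_mul, ← pow_add, ← zpow_natCast]
        congr 1
        push_cast; ring
      have e2 : (qHalf ^ (2 * (N + 1))) ^ (k : ℕ) =
          (qHalf ^ (2 * N)) ^ (k : ℕ) * (qHalf ^ (k : ℕ) * qHalf ^ (k : ℕ)) := by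
        rw [← pow_mul, ← pow_mul, ← pow_add, ← pow_add]
        congr 1
        ring
      have e3 : (qHalf ^ (k : ℕ) * qHalf ^ (k : ℕ) - 1) * aRho k = qHalf ^ (k : ℕ) := by
        have h2 : qHalf ^ (k : ℕ) ≠ 0 := pow_ne_zero _ hq
        simp only [aRho]
        field_simp
        unfold qInt
        field_simp
      rw [e1, e2]
      linear_combination -(qHalf ^ (2 * N)) ^ (k : ℕ) * e3
  rw [h1, ← h2, ← h3 N]
  ring

end Contents

/-! ### The vertex with one empty leg -/

section Vertex

theorem prod_zpow_eq_zpow_sum {ι : Type*} (s : Finset ι) (f : ι → ℤ) :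
    ∏ i ∈ s, qHalf ^ f i = qHalf ^ ∑ i ∈ s, f i := by
  classical
  induction s using Finset.induction_on with
  | empty => simp
  | insert a s ha ih =>
    rw [Finset.prod_insert ha, Finset.sum_insert ha, ih, zpow_add₀ qHalf_ne_zero]

theorem schur_bot : schur ⊥ = 1 := by
  unfold schur
  have : IsEmpty (Fin ((⊥ : YoungDiagram).colLen 0)) := by rw [colLen_bot]; infer_instance
  exact Matrix.det_isEmpty

theorem schurAt_bot {R : Type*} [CommRing R] [Algebra K R] (Y : ℕ+ → R) : schurAt Y ⊥ = 1 := by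
  simp [schurAt, schur_bot]

theorem hall_hAt_C_mul_X (a : ℕ+ → K) (μ : YoungDiagram) (d : ℕ) :
    hall (hAt (fun k => C (a k) * X k) d) (schur μ) = if d = μ.card then schurAt a μ else 0 := by
  rw [hAt_C_mul_X, ← hallL_apply, map_sum, LinearMap.sum_apply]
  simp only [hallL_apply, hall_monomial]
  split_ifs with h
  · rw [schurAt_eq_sum, h]
    refine Finset.sum_congr rfl fun ρ hρ => ?_
    have hz : (zCoeff ρ : K) ≠ 0 := by exact_mod_cast zCoeff_ne_zero ρ
    rw [coeff_hSym, if_pos (mem_monomialsOf.1 hρ), smul_eq_mul]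
    field_simp
  · refine Finset.sum_eq_zero fun ρ hρ => ?_
    rw [coeff_schur_of_ne (by rw [mem_monomialsOf.1 hρ]; exact h)]
    ring

theorem vertexPairing_bot (a : ℕ+ → K) (μ : YoungDiagram) : vertexPairing a μ ⊥ = schurAt a μ := by
  unfold vertexPairing vertexTerm
  simp [schurAt_bot, hall_hAt_C_mul_X]

/-- The closed form of the entries splits the determinant into row factors, column factors and a
determinant covered by the bialternant formula. The factors independent of `ν` need not be computed:
they are found from the case of empty `ν`, where the pairing is `s_μ(q^ρ)`. -/
theorem vertexPairing_aRho (μ ν : YoungDiagram) : vertexPairing aRho μ ν =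
    schurAt aRho μ * qHalf ^ kappa ν * schurAt (om (powerSumAt μ.transpose)) ν := by
  have hq := qHalf_ne_zero
  set N := max (μ.colLen 0) (ν.colLen 0) with hN
  have hμ : μ.colLen 0 ≤ N := le_max_left _ _
  have hν : ν.colLen 0 ≤ N := le_max_right _ _
  -- The scaling by `q^N` makes the variables `-q^{i+1/2-μ_i}` (with `i` from `0`), independent of
  -- `N`; the term `-2 N n` in `E` compensates it.
  set t : Fin N → K := fun i => qHalf ^ (2 * N) * -(qHalf ^ (2 * shifted N μ i + 1))⁻¹ with ht
  set T : ℕ+ → K := fun k => (qHalf ^ (2 * N)) ^ (k : ℕ) * om aRho k with hT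
  set E : ℕ → ℤ := fun n => (n : ℤ) * (n + 1) - 2 * N * n with hE
  set V := Matrix.det (Matrix.of fun r i : Fin N => t i ^ (N - 1 - r)) with hV
  set P := ∏ i : Fin N, hAt aRho (shifted N μ i) with hP
  have key : ∀ ν : YoungDiagram, ν.colLen 0 ≤ N → vertexPairing aRho μ ν =
      P * (∏ j, qHalf ^ E (shifted N ν j)) * (schurAt (∑ l, pw (t l) + T) ν * V) := by
    intro ν hν
    rw [vertexPairing_eq_det _ hμ hν, hV, ← det_hAt_eq ν hν, ← Matrix.det_transpose (Matrix.of
      fun r i => hAt (pw (t i) + T) (shifted N ν r)), mul_assoc, ← Matrix.det_mul_row,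
      ← Matrix.det_mul_column]
    congr 1
    ext i j
    simp only [Matrix.of_apply, Matrix.transpose_apply]
    rw [hookEntry_aRho]
    congr 1
    have e1 : pw (t i) + T = fun k : ℕ+ => (qHalf ^ (2 * N)) ^ (k : ℕ) *
        (pw (-(qHalf ^ (2 * shifted N μ i + 1))⁻¹) + om aRho) k := by
      ext1 k
      simp only [ht, hT, Pi.add_apply, pw, mul_pow]
      ring
    rw [e1, hAt_mul_pow, ← mul_assoc]
    congr 1
    rw [← pow_mul, ← zpow_natCast, ← zpow_natCast, ← zpow_add₀ hq]
    congr 1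
    simp only [hE]
    push_cast
    ring
  have hbot := key ⊥ (by rw [colLen_bot]; omega)
  rw [schurAt_bot, one_mul, vertexPairing_bot] at hbot
  have hexp : ∏ j, qHalf ^ E (shifted N ν j) =
      (∏ j, qHalf ^ E (shifted N ⊥ j)) * qHalf ^ kappa ν := by
    rw [kappa_eq_sum_range ν hν, Finset.sum_range, ← prod_zpow_eq_zpow_sum,
      ← Finset.prod_mul_distrib]
    refine Finset.prod_congr rfl fun j _ => ?_
    rw [← zpow_add₀ hq]
    congr 1
    have hj : ((N - 1 - j : ℕ) : ℤ) = N - 1 - j := by have := j.2; omega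
    simp only [hE, shifted, rowLen_bot, zero_add]
    push_cast [hj]
    ring
  have hom : ∑ l, pw (t l) + T = om (powerSumAt μ.transpose) := by
    ext1 k
    rw [om, powerSumAt_transpose μ hμ, Finset.sum_range, mul_sub, Finset.mul_sum]
    simp only [Pi.add_apply, Finset.sum_apply, pw, hT, om]
    rw [sub_eq_add_neg, ← Finset.sum_neg_distrib, add_comm]
    congr 1
    · ring
    · refine Finset.sum_congr rfl fun i _ => ?_
      have e2 : t i = -qHalf ^ (2 * (i : ℤ) + 1 - 2 * (μ.rowLen i : ℤ)) := by
        rw [ht]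
        simp only [mul_neg, neg_inj]
        rw [← zpow_natCast, ← zpow_natCast, ← zpow_neg, ← zpow_add₀ hq]
        congr 1
        have hj : ((N - 1 - i : ℕ) : ℤ) = N - 1 - i := by have := i.2; omega
        simp only [shifted]
        push_cast [hj]
        ring
      rw [e2, neg_pow, ← zpow_natCast (qHalf ^ _), ← zpow_mul, mul_comm ((k : ℕ) : ℤ), pow_succ]
      ring
  rw [key ν hν, hbot, hexp, hom]
  ring

theorem evalAt_schur (ν μ : YoungDiagram) : evalAt ν (schur μ) = schurAt (powerSumAt ν) μ := rfl

theorem transpose_bot : (⊥ : YoungDiagram).transpose = ⊥ := by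
  rw [← card_eq_zero_iff, card_transpose]; rfl

theorem skewSchur_bot_right (μ : YoungDiagram) : skewSchur μ ⊥ = schur μ := by
  classical
  have h0 : (⊥ : YoungDiagram).card = 0 := rfl
  unfold skewSchur
  simp only [schur_bot, one_mul, hall_schur_schur, h0, Nat.sub_zero, ite_smul, one_smul, zero_smul]
  rw [Finset.sum_ite_eq, if_pos (mem_partitionsOf.2 rfl)]

open scoped Classical in
theorem skewSchur_bot_left (η : YoungDiagram) : skewSchur ⊥ η = if η = ⊥ then 1 else 0 := by
  have h0 : (⊥ : YoungDiagram).card = 0 := rfl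
  unfold skewSchur
  rw [h0, Nat.zero_sub, partitionsOf_zero, Finset.sum_singleton, schur_bot, mul_one, ← schur_bot,
    hall_schur_schur, schur_bot]
  by_cases h : η = ⊥
  · simp [h]
  · simp [h, Ne.symm h]

/-- The vertex with one trivial leg, in the framing `(-1, 0, 0)`. -/
theorem framedVertexC_eq (l m : YoungDiagram) :
    framedVertexC ![-1, 0, 0] ![l, m, ⊥] = vertexPairing aRho m l.transpose := by
  classical
  have hq := qHalf_ne_zero
  have hk : kappa ⊥ = 0 := by simp [kappa, colLen_bot]
  have h1 : vertexC ![l, m, ⊥] = schurAt aRho m * schurAt (powerSumAt m.transpose) l := by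
    unfold vertexC
    simp only [Matrix.cons_val_zero, Matrix.cons_val_one, Matrix.cons_val, hk, zpow_zero, one_mul,
      transpose_bot, evalAt_schur, powerSumAt_bot]
    congr 1
    -- With the third leg empty, only the empty `η` survives.
    rw [Finset.sum_eq_single 0]
    · rw [partitionsOf_zero, Finset.sum_singleton, skewSchur_bot_right, skewSchur_bot_left,
        if_pos rfl, evalAt_schur]
      simp [evalAt]
    · intro d _ hd
      refine Finset.sum_eq_zero fun η hη => ?_
      rw [skewSchur_bot_left, if_neg]
      · simp [evalAt]
      · rintro rfl
        exact hd (mem_partitionsOf.1 hη).symm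
    · simp
  rw [framedVertexC, h1, vertexPairing_aRho, kappa_transpose, schurAt_transpose, om_om]
  simp only [Fin.sum_univ_three, Matrix.cons_val_zero, Matrix.cons_val_one, Matrix.cons_val]
  simp only [zero_mul, add_zero, neg_mul, one_mul]
  ring

end Vertex

end TopVertex
end

noncomputable section
namespace TopVertex
open Finset
open scoped MvPowerSeries.WithPiTopology

/-! ### Filtration of power series by weight -/

section Graded

variable {σ : Type*} (w : σ → ℕ)

/-- A power series all of whose monomials have weight at least `n`. -/
def OrdGE (n : ℕ) (f : MvPowerSeries σ K) : Prop :=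
  ∀ m, Finsupp.weight w m < n → MvPowerSeries.coeff m f = 0

variable {w}

theorem ordGE_zero (f : MvPowerSeries σ K) : OrdGE w 0 f := fun _ h => absurd h (Nat.not_lt_zero _)

theorem OrdGE.add {n : ℕ} {f g : MvPowerSeries σ K} (hf : OrdGE w n f) (hg : OrdGE w n g) :
    OrdGE w n (f + g) := fun m hm => by rw [map_add, hf m hm, hg m hm, add_zero]

theorem OrdGE.mul {n n' : ℕ} {f g : MvPowerSeries σ K} (hf : OrdGE w n f) (hg : OrdGE w n' g) :
    OrdGE w (n + n') (f * g) := by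
  classical
  intro m hm
  rw [MvPowerSeries.coeff_mul]
  refine Finset.sum_eq_zero fun p hp => ?_
  rw [HasAntidiagonal.mem_antidiagonal] at hp
  rw [← hp, map_add] at hm
  by_cases h : Finsupp.weight w p.1 < n
  · rw [hf _ h, zero_mul]
  · rw [hg _ (by omega), mul_zero]

theorem OrdGE.mul_right {n : ℕ} {f : MvPowerSeries σ K} (hf : OrdGE w n f)
    (g : MvPowerSeries σ K) : OrdGE w n (f * g) := hf.mul (ordGE_zero g)

theorem OrdGE.mul_left {n : ℕ} {f : MvPowerSeries σ K} (hf : OrdGE w n f)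
    (g : MvPowerSeries σ K) : OrdGE w n (g * f) := by rw [mul_comm]; exact hf.mul_right g

theorem OrdGE.smul {n : ℕ} {f : MvPowerSeries σ K} (hf : OrdGE w n f) (c : K) :
    OrdGE w n (c • f) := fun m hm => by rw [MvPowerSeries.coeff_smul, hf m hm, mul_zero]

theorem OrdGE.pow {n : ℕ} {f : MvPowerSeries σ K} (hf : OrdGE w n f) (k : ℕ) :
    OrdGE w (n * k) (f ^ k) := by
  induction k with
  | zero => exact ordGE_zero _
  | succ k ih => rw [pow_succ, Nat.mul_succ]; exact ih.mul hf

theorem OrdGE.sum {ι : Type*} {n : ℕ} (s : Finset ι) (f : ι → MvPowerSeries σ K)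
    (h : ∀ i ∈ s, OrdGE w n (f i)) : OrdGE w n (∑ i ∈ s, f i) := fun m hm => by
  rw [map_sum]
  exact Finset.sum_eq_zero fun i hi => h i hi m hm

theorem OrdGE.prod {ι : Type*} (s : Finset ι) (n : ι → ℕ) (f : ι → MvPowerSeries σ K)
    (h : ∀ i ∈ s, OrdGE w (n i) (f i)) : OrdGE w (∑ i ∈ s, n i) (∏ i ∈ s, f i) := by
  classical
  induction s using Finset.induction_on with
  | empty => exact ordGE_zero _
  | insert a s ha ih =>
    rw [Finset.sum_insert ha, Finset.prod_insert ha]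
    exact (h a (mem_insert_self _ _)).mul (ih fun i hi => h i (mem_insert_of_mem hi))

variable (w) in
/-- A family of power sums with values in power series, the `k`-th one of weight at least `k`. -/
def Small (Y : ℕ+ → MvPowerSeries σ K) : Prop := ∀ k : ℕ+, OrdGE w k (Y k)

theorem Small.add {Y Z : ℕ+ → MvPowerSeries σ K} (hY : Small w Y) (hZ : Small w Z) :
    Small w (Y + Z) := fun k => (hY k).add (hZ k)

theorem Small.mul_right {Y : ℕ+ → MvPowerSeries σ K} (hY : Small w Y)
    (Z : ℕ+ → MvPowerSeries σ K) : Small w (Y * Z) := fun k => (hY k).mul_right _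

theorem Small.mul_left {Y : ℕ+ → MvPowerSeries σ K} (hY : Small w Y)
    (Z : ℕ+ → MvPowerSeries σ K) : Small w (Z * Y) := fun k => (hY k).mul_left _

theorem Small.prod_pow {Y : ℕ+ → MvPowerSeries σ K} (hY : Small w Y) (ρ : ℕ+ →₀ ℕ) :
    OrdGE w (wt ρ) (ρ.prod fun k c => Y k ^ c) :=
  OrdGE.prod _ _ _ fun k _ => (hY k).pow _

theorem Small.hAt {Y : ℕ+ → MvPowerSeries σ K} (hY : Small w Y) (n : ℕ) :
    OrdGE w n (hAt Y n) := by
  have hs : (hSym n).support ⊆ monomialsOf n := by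
    intro ρ hρ
    rw [mem_monomialsOf]
    by_contra h
    rw [MvPolynomial.mem_support_iff, coeff_hSym, if_neg h] at hρ
    exact hρ rfl
  rw [TopVertex.hAt, aeval_eq_sum_of_support_subset _ _ hs]
  refine OrdGE.sum _ _ fun ρ hρ => ?_
  rw [← mem_monomialsOf.1 hρ]
  exact (hY.prod_pow ρ).smul _

theorem Small.schurAt {Y : ℕ+ → MvPowerSeries σ K} (hY : Small w Y) (μ : YoungDiagram) :
    OrdGE w μ.card (schurAt Y μ) := by
  rw [schurAt_eq_sum]
  refine OrdGE.sum _ _ fun ρ hρ => ?_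
  rw [← mem_monomialsOf.1 hρ]
  exact (hY.prod_pow ρ).smul _

end Graded

/-! ### Infinite sums over partitions -/

section Sums

variable {σ : Type*} {w : σ → ℕ}

/-- The sum `∑_d h_d(Y) = exp (∑_k Y_k / k)`. -/
def hSum (Y : ℕ+ → MvPowerSeries σ K) : MvPowerSeries σ K :=
  fun m => ∑ᶠ d, MvPowerSeries.coeff m (hAt Y d)

theorem finite_card_le (n : ℕ) : {μ : YoungDiagram | μ.card ≤ n}.Finite := by
  classical
  refine (Finset.finite_toSet ((range (n + 1)).biUnion partitionsOf)).subset fun μ hμ => ?_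
  have : μ.card ≤ n := hμ
  simp only [coe_biUnion, Set.mem_iUnion, Finset.mem_coe, mem_partitionsOf, mem_range]
  exact ⟨μ.card, by omega, rfl⟩

variable [TopologicalSpace K]

theorem summable_of_finite {ι : Type*} {f : ι → MvPowerSeries σ K}
    (h : ∀ m, {i | MvPowerSeries.coeff m (f i) ≠ 0}.Finite) : Summable f :=
  MvPowerSeries.WithPiTopology.summable_iff_summable_coeff.2 fun m =>
    summable_of_hasFiniteSupport (h m)

theorem summable_of_ordGE {ι : Type*} {f : ι → MvPowerSeries σ K} (s : ι → ℕ)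
    (hs : ∀ n, {i | s i ≤ n}.Finite) (h : ∀ i, OrdGE w (s i) (f i)) : Summable f := by
  refine summable_of_finite fun m => (hs (Finsupp.weight w m)).subset fun i hi => ?_
  by_contra hc
  exact hi (h i m (not_le.1 hc))

theorem hasSum_of_coeff_eq_finsum {ι : Type*} {f : ι → MvPowerSeries σ K} (s : ι → ℕ)
    (hs : ∀ n, {i | s i ≤ n}.Finite) (h : ∀ i, OrdGE w (s i) (f i)) {g : MvPowerSeries σ K}
    (hg : ∀ m, MvPowerSeries.coeff m g = ∑ᶠ i, MvPowerSeries.coeff m (f i)) : HasSum f g := by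
  refine MvPowerSeries.WithPiTopology.hasSum_iff_hasSum_coeff.2 fun m => ?_
  have hfin : Function.HasFiniteSupport fun i => MvPowerSeries.coeff m (f i) :=
    (hs (Finsupp.weight w m)).subset fun i hi => by
      by_contra hc
      exact hi (h i m (not_le.1 hc))
  rw [hg, ← tsum_eq_finsum (L := SummationFilter.unconditional _) hfin]
  exact (summable_of_hasFiniteSupport hfin).hasSum

theorem hasSum_hSum {Y : ℕ+ → MvPowerSeries σ K} (hY : Small w Y) : HasSum (hAt Y) (hSum Y) :=
  hasSum_of_coeff_eq_finsum (fun d => d) (fun n => Set.finite_Iic n) hY.hAt fun _ => rfl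

variable [DiscreteTopology K]

/-- The product of two families, the degrees of which add up. -/
theorem hasSum_antidiagonal {f g : ℕ → MvPowerSeries σ K} (hf : ∀ d, OrdGE w d (f d))
    (hg : ∀ d, OrdGE w d (g d)) {a b : MvPowerSeries σ K} (ha : HasSum f a) (hb : HasSum g b) :
    HasSum (fun n => ∑ p ∈ antidiagonal n, f p.1 * g p.2) (a * b) := by
  have h1 : Summable fun x : ℕ × ℕ => f x.1 * g x.2 := by
    refine summable_of_ordGE (w := w) (fun x => x.1 + x.2) (fun n => ?_) fun x => (hf _).mul (hg _)
    refine ((Set.finite_Iic n).prod (Set.finite_Iic n)).subset fun x hx => ?_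
    have : x.1 + x.2 ≤ n := hx
    simp only [Set.mem_prod, Set.mem_Iic]
    omega
  have h2 := Summable.tsum_mul_tsum_eq_tsum_sum_antidiagonal ha.summable hb.summable h1
  rw [ha.tsum_eq, hb.tsum_eq] at h2
  rw [h2]
  refine (summable_of_ordGE (w := w) (fun d => d) (fun n => Set.finite_Iic n) fun d => ?_).hasSum
  refine OrdGE.sum _ _ fun p hp => ?_
  rw [← HasAntidiagonal.mem_antidiagonal.1 hp]
  exact (hf _).mul (hg _)

theorem hSum_add {Y Z : ℕ+ → MvPowerSeries σ K} (hY : Small w Y) (hZ : Small w Z) :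
    hSum (Y + Z) = hSum Y * hSum Z := by
  have h := hasSum_antidiagonal hY.hAt hZ.hAt (hasSum_hSum hY) (hasSum_hSum hZ)
  simp only [← hAt_add] at h
  exact (hasSum_hSum (hY.add hZ)).unique h

theorem hSum_zero : hSum (0 : ℕ+ → MvPowerSeries σ K) = 1 := by
  have h : Small (fun _ : σ => 0) (0 : ℕ+ → MvPowerSeries σ K) := fun k m _ => rfl
  refine (hasSum_hSum h).unique ?_
  have := hasSum_ite_eq (0 : ℕ) (1 : MvPowerSeries σ K)
  simpa only [← hAt_zero_fun] using this

theorem hSum_sum {ι : Type*} (s : Finset ι) {Y : ι → ℕ+ → MvPowerSeries σ K}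
    (hY : ∀ i ∈ s, Small w (Y i)) : hSum (∑ i ∈ s, Y i) = ∏ i ∈ s, hSum (Y i) := by
  classical
  suffices h : Small w (∑ i ∈ s, Y i) ∧ hSum (∑ i ∈ s, Y i) = ∏ i ∈ s, hSum (Y i) from h.2
  induction s using Finset.induction_on with
  | empty => exact ⟨fun k m _ => rfl, by simp [hSum_zero]⟩
  | insert a s ha ih =>
    obtain ⟨h1, h2⟩ := ih fun i hi => hY i (mem_insert_of_mem hi)
    have h3 := hY a (mem_insert_self _ _)
    rw [Finset.sum_insert ha, Finset.prod_insert ha]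
    exact ⟨h3.add h1, by rw [hSum_add h3 h1, h2]⟩

theorem hasSum_partitionsOf {f : YoungDiagram → MvPowerSeries σ K} (hf : Summable f) :
    HasSum (fun d => ∑ μ ∈ partitionsOf d, f μ) (∑' μ, f μ) := by
  have h1 : HasSum (fun x : Σ d, {μ : YoungDiagram // μ.card = d} => f x.2) (∑' μ, f μ) :=
    (Equiv.sigmaFiberEquiv YoungDiagram.card).hasSum_iff.2 hf.hasSum
  refine h1.sigma fun d => ?_
  have h2 := (partitionsOf d).hasSum f
  exact (Equiv.subtypeEquivRight fun μ => (mem_partitionsOf (μ := μ) (n := d)).symm).hasSum_iff.2 h2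

/-- The Cauchy identity. -/
theorem hasSum_schurAt_mul_schurAt {Y : ℕ+ → MvPowerSeries σ K} (hY : Small w Y)
    (Z : ℕ+ → MvPowerSeries σ K) :
    HasSum (fun μ => schurAt Y μ * schurAt Z μ) (hSum (Y * Z)) := by
  have h1 : Summable fun μ => schurAt Y μ * schurAt Z μ :=
    summable_of_ordGE (w := w) YoungDiagram.card finite_card_le fun μ => (hY.schurAt μ).mul_right _
  have h2 := hasSum_partitionsOf h1
  simp only [sum_schurAt_mul_schurAt] at h2
  rw [(hasSum_hSum (hY.mul_right Z)).unique h2]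
  exact h1.hasSum

/-- The sum over the partitions on one leg of a vertex. -/
theorem hasSum_schurAt_mul_vertexPairing {Y : ℕ+ → MvPowerSeries σ K} (hY : Small w Y)
    (a : ℕ+ → K) (ν : YoungDiagram) :
    HasSum (fun μ => schurAt Y μ * MvPowerSeries.C (vertexPairing a μ ν))
      (hSum ((fun k => MvPowerSeries.C (a k)) * Y) *
        schurAt (Y + fun k => MvPowerSeries.C (a k)) ν) := by
  -- A double sum evaluated in two orders: summing over `μ` first expands `vertexTerm` in Schur
  -- functions, summing over `d` first gives the pairing.
  set g : ℕ × YoungDiagram → MvPowerSeries σ K := fun x =>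
    schurAt Y x.2 * MvPowerSeries.C (hall (vertexTerm a ν x.1) (schur x.2)) with hg
  have hsum : Summable g := by
    refine summable_of_finite fun m => ?_
    refine ((Set.finite_Iic (Finsupp.weight w m)).prod
      (finite_card_le (Finsupp.weight w m))).subset fun x hx => ?_
    have h1 : x.2.card ≤ Finsupp.weight w m := by
      by_contra hc
      exact hx (((hY.schurAt x.2).mul_right _) m (not_le.1 hc))
    have h2 : x.1 ≤ x.2.card := by
      by_contra hc
      apply hx
      simp only [hg]
      rw [hall_vertexTerm_of_lt _ _ _ (not_le.1 hc), map_zero, mul_zero, map_zero]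
    exact ⟨h2.trans h1, h1⟩
  have h0 := hsum.hasSum
  have hrow : ∀ d, HasSum (fun μ => g (d, μ)) (MvPolynomial.aeval Y (vertexTerm a ν d)) := by
    intro d
    classical
    set s := (vertexTerm a ν d).support.biUnion fun ρ => partitionsOf (wt ρ) with hs
    have h1 := eq_sum_hall_smul_schur (vertexTerm a ν d) (s := s) fun ρ hρ =>
      Finset.subset_biUnion_of_mem (fun ρ => partitionsOf (wt ρ)) hρ
    have h2 : MvPolynomial.aeval Y (vertexTerm a ν d) = ∑ μ ∈ s, g (d, μ) := by
      conv_lhs => rw [h1]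
      rw [map_sum]
      refine Finset.sum_congr rfl fun μ _ => ?_
      rw [map_smul, MvPowerSeries.smul_eq_C_mul, mul_comm]
      rfl
    rw [h2]
    refine hasSum_sum_of_ne_finset_zero fun μ hμ => ?_
    have : hall (vertexTerm a ν d) (schur μ) = 0 := by
      rw [hall]
      refine Finset.sum_eq_zero fun ρ hρ => ?_
      rw [coeff_schur_of_ne (μ := μ) (ρ := ρ)]
      · ring
      · intro h
        exact hμ (Finset.mem_biUnion.2 ⟨ρ, hρ, mem_partitionsOf.2 h.symm⟩)
    simp only [hg]
    rw [this, map_zero, mul_zero]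
  have hA := h0.prod_fiberwise hrow
  have hcol : ∀ μ, HasSum (fun d => g (d, μ))
      (schurAt Y μ * MvPowerSeries.C (vertexPairing a μ ν)) := by
    intro μ
    rw [vertexPairing, map_sum, Finset.mul_sum]
    refine hasSum_sum_of_ne_finset_zero fun d hd => ?_
    simp only [hg]
    rw [hall_vertexTerm_of_lt _ _ _ (by simpa using hd), map_zero, mul_zero]
  have hB := ((Equiv.prodComm YoungDiagram ℕ).hasSum_iff.2 h0).prod_fiberwise hcol
  have hC : HasSum (fun d => MvPolynomial.aeval Y (vertexTerm a ν d))
      (hSum ((fun k => MvPowerSeries.C (a k)) * Y) *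
        schurAt (Y + fun k => MvPowerSeries.C (a k)) ν) := by
    simp only [aeval_vertexTerm]
    exact (hasSum_hSum (hY.mul_left _)).mul_right _
  rw [hC.unique hA]
  exact hB

end Sums

end TopVertex
end

noncomputable section
namespace TopVertex
open Finset
open scoped MvPowerSeries.WithPiTopology

/-! ### The sum of all `h_d` as an exponential -/

section Exponential

variable {σ : Type*} {w : σ → ℕ}

/-- The terms `Y_d / d` of the logarithm of the generating series of the `h_d(Y)`. -/
def logTerm (Y : ℕ+ → MvPowerSeries σ K) : ℕ → MvPowerSeries σ K
  | 0 => 0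
  | n + 1 => ((n : K) + 1)⁻¹ • Y (Nat.succPNat n)

theorem Small.logTerm {Y : ℕ+ → MvPowerSeries σ K} (hY : Small w Y) :
    ∀ d, OrdGE w d (logTerm Y d)
  | 0 => ordGE_zero _
  | n + 1 => (hY (Nat.succPNat n)).smul _

theorem hasSubst_logTerm (Y : ℕ+ → MvPowerSeries σ K) :
    PowerSeries.HasSubst (PowerSeries.mk (logTerm Y)) :=
  PowerSeries.HasSubst.of_constantCoeff_zero' (by
    simp [← PowerSeries.coeff_zero_eq_constantCoeff_apply, logTerm])

theorem hSeries_eq_exp_subst (Y : ℕ+ → MvPowerSeries σ K) :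
    hSeries Y = (PowerSeries.exp (MvPowerSeries σ K)).subst (PowerSeries.mk (logTerm Y)) := by
  refine (eq_hSeries _ _ ?_ ?_).symm
  · rw [PowerSeries.coeff_subst' (hasSubst_logTerm Y), finsum_eq_single _ 0]
    · simp
    · intro n hn
      rw [PowerSeries.coeff_zero_eq_constantCoeff_apply, map_pow,
        ← PowerSeries.coeff_zero_eq_constantCoeff_apply, PowerSeries.coeff_mk]
      simp [logTerm, hn]
  · rw [PowerSeries.derivative_subst (hasSubst_logTerm Y), PowerSeries.derivative_exp, mul_comm]
    congr 1
    ext1 n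
    rw [PowerSeries.coeff_derivative, pSeries, PowerSeries.coeff_mk, PowerSeries.coeff_mk]
    have hK : ((n : K) + 1) ≠ 0 := by exact_mod_cast Nat.succ_ne_zero n
    have h1 : ((n : MvPowerSeries σ K) + 1) = MvPowerSeries.C ((n : K) + 1) := by simp
    rw [logTerm, h1, mul_comm, ← MvPowerSeries.smul_eq_C_mul, smul_smul, mul_inv_cancel₀ hK,
      one_smul]

variable [TopologicalSpace K]

theorem hasSum_logTerm {Y : ℕ+ → MvPowerSeries σ K} (hY : Small w Y) {u : MvPowerSeries σ K}
    (hu : ∀ m, MvPowerSeries.coeff m u = ∑ᶠ k : ℕ+, (k : K)⁻¹ * MvPowerSeries.coeff m (Y k)) :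
    HasSum (logTerm Y) u := by
  have h1 : HasSum (fun k : ℕ+ => (k : K)⁻¹ • Y k) u :=
    hasSum_of_coeff_eq_finsum (w := w) (fun k : ℕ+ => (k : ℕ))
      (fun n => (Set.finite_Iic n).preimage PNat.coe_injective.injOn) (fun k => (hY k).smul _) hu
  refine (PNat.coe_injective.hasSum_iff ?_).1 ?_
  · intro n hn
    rcases n with _ | n
    · rfl
    · exact absurd ⟨Nat.succPNat n, rfl⟩ hn
  · convert! h1 using 1
    funext k
    obtain ⟨n, rfl⟩ : ∃ n, k = Nat.succPNat n := ⟨PNat.natPred k, (PNat.succPNat_natPred k).symm⟩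
    simp [logTerm]

variable [DiscreteTopology K]

theorem hasSum_coeff_logTerm_pow {Y : ℕ+ → MvPowerSeries σ K} (hY : Small w Y)
    {u : MvPowerSeries σ K} (hu : HasSum (logTerm Y) u) (n : ℕ) :
    (∀ d, OrdGE w d (PowerSeries.coeff d (PowerSeries.mk (logTerm Y) ^ n))) ∧
      HasSum (fun d => PowerSeries.coeff d (PowerSeries.mk (logTerm Y) ^ n)) (u ^ n) := by
  induction n with
  | zero =>
    refine ⟨fun d => ?_, ?_⟩
    · rcases d with _ | d
      · exact ordGE_zero _
      · intro m _
        simp [PowerSeries.coeff_one]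
    · simp only [pow_zero, PowerSeries.coeff_one]
      exact hasSum_ite_eq (0 : ℕ) (1 : MvPowerSeries σ K)
  | succ n ih =>
    simp only [pow_succ, PowerSeries.coeff_mul, PowerSeries.coeff_mk]
    refine ⟨fun d => OrdGE.sum _ _ fun p hp => ?_, hasSum_antidiagonal ih.1 hY.logTerm ih.2 hu⟩
    rw [← HasAntidiagonal.mem_antidiagonal.1 hp]
    exact (ih.1 _).mul (hY.logTerm _)

/-- `hSeries_eq_exp_subst` gives the identity with an auxiliary variable marking the degree. Setting
that variable to `1` is legitimate because the weights grow; it is done by exchanging the sums over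
the degree and over the power in the exponential series. -/
theorem hSum_eq_exp_subst {Y : ℕ+ → MvPowerSeries σ K} (hY : Small w Y) {u : MvPowerSeries σ K}
    (hu : ∀ m, MvPowerSeries.coeff m u = ∑ᶠ k : ℕ+, (k : K)⁻¹ * MvPowerSeries.coeff m (Y k)) :
    hSum Y = (PowerSeries.exp K).subst u := by
  have hL := hasSum_coeff_logTerm_pow hY (hasSum_logTerm hY hu)
  set L := PowerSeries.mk (logTerm Y) with hLdef
  have hX : PowerSeries.X ∣ L := by
    rw [PowerSeries.X_dvd_iff, ← PowerSeries.coeff_zero_eq_constantCoeff_apply, hLdef,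
      PowerSeries.coeff_mk, logTerm]
  have hlt : ∀ d n, d < n → PowerSeries.coeff d (L ^ n) = 0 := fun d n h =>
    PowerSeries.X_pow_dvd_iff.1 (pow_dvd_pow_of_dvd hX n) d h
  have hexp : ∀ n, ∀ f : MvPowerSeries σ K, PowerSeries.coeff n (PowerSeries.exp (MvPowerSeries σ K)) • f =
      PowerSeries.coeff n (PowerSeries.exp K) • f := by
    intro n f
    rw [PowerSeries.coeff_exp, PowerSeries.coeff_exp, smul_eq_mul, ← Algebra.smul_def,
      algebraMap_smul]
  set g : ℕ × ℕ → MvPowerSeries σ K := fun x =>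
    PowerSeries.coeff x.2 (PowerSeries.exp K) • PowerSeries.coeff x.1 (L ^ x.2) with hg
  have hsum : Summable g := by
    refine summable_of_finite fun m => ?_
    refine ((Set.finite_Iic (Finsupp.weight w m)).prod
      (Set.finite_Iic (Finsupp.weight w m))).subset fun x hx => ?_
    have h1 : x.1 ≤ Finsupp.weight w m := by
      by_contra hc
      exact hx ((((hL x.2).1 x.1).smul _) m (not_le.1 hc))
    have h2 : x.2 ≤ x.1 := by
      by_contra hc
      apply hx
      simp only [hg]
      rw [hlt _ _ (not_le.1 hc), smul_zero, map_zero]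
    exact ⟨h1, h2.trans h1⟩
  have hrow : ∀ d, HasSum (fun n => g (d, n)) (hAt Y d) := by
    intro d
    have h1 : hAt Y d = PowerSeries.coeff d (hSeries Y) := by rw [hSeries, PowerSeries.coeff_mk]
    rw [h1, hSeries_eq_exp_subst, PowerSeries.coeff_subst' (hasSubst_logTerm Y),
      finsum_eq_sum_of_support_subset (s := range (d + 1))]
    · simp only [hexp]
      refine hasSum_sum_of_ne_finset_zero fun n hn => ?_
      simp only [hg]
      rw [hlt _ _ (by simpa using hn), smul_zero]
    · intro n hn
      by_contra hc
      apply hn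
      simp only
      rw [hlt _ _ (by simpa using hc), smul_zero]
  have hcol : ∀ n, HasSum (fun d => g (d, n)) (PowerSeries.coeff n (PowerSeries.exp K) • u ^ n) := by
    intro n
    simp only [hg, MvPowerSeries.smul_eq_C_mul]
    exact (hL n).2.mul_left _
  have hA := hsum.hasSum.prod_fiberwise hrow
  have hB := ((Equiv.prodComm ℕ ℕ).hasSum_iff.2 hsum.hasSum).prod_fiberwise hcol
  have h0 : MvPowerSeries.constantCoeff u = 0 := by
    rw [← MvPowerSeries.coeff_zero_eq_constantCoeff_apply, hu]
    refine finsum_eq_zero_of_forall_eq_zero fun k => ?_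
    rw [hY k 0 (by simp), mul_zero]
  have hus := PowerSeries.HasSubst.of_constantCoeff_zero h0
  have hC : HasSum (fun n => PowerSeries.coeff n (PowerSeries.exp K) • u ^ n)
      ((PowerSeries.exp K).subst u) := by
    refine MvPowerSeries.WithPiTopology.hasSum_iff_hasSum_coeff.2 fun m => ?_
    have hfin := PowerSeries.coeff_subst_finite hus (PowerSeries.exp K) m
    rw [PowerSeries.coeff_subst hus, ← tsum_eq_finsum (L := SummationFilter.unconditional _) hfin]
    exact (summable_of_hasFiniteSupport hfin).hasSum
  rw [(hasSum_hSum hY).unique hA, hC.unique hB]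

end Exponential

end TopVertex
end

noncomputable section
namespace TopVertex
open Finset

/-! ### Adams operations on monomials and plethystic exponentials -/

section Adams

variable {E L : Type}

/-- The grading in which the Kähler parameters have degree one and `p_k` has degree `k`. -/
def serWeight : E ⊕ L × ℕ+ → ℕ := Sum.elim (fun _ => 1) (fun y => y.2)

theorem adamsMon_add (k : ℕ+) (m m' : (E ⊕ L × ℕ+) →₀ ℕ) :
    adamsMon k (m + m') = adamsMon k m + adamsMon k m' := by
  classical
  refine Finsupp.sum_add_index' (fun x => ?_) fun x a b => ?_
  · cases x <;> simp
  · cases x <;> simp [mul_add]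

theorem adamsMon_zero (k : ℕ+) : adamsMon k (0 : (E ⊕ L × ℕ+) →₀ ℕ) = 0 := Finsupp.sum_zero_index

theorem adamsMon_single_inl (k : ℕ+) (e : E) (a : ℕ) :
    adamsMon k (Finsupp.single (Sum.inl e : E ⊕ L × ℕ+) a) = Finsupp.single (Sum.inl e) (k * a) := by
  rw [adamsMon, Finsupp.sum_single_index] <;> simp

theorem adamsMon_single_inr (k : ℕ+) (l : L) (n : ℕ+) (a : ℕ) :
    adamsMon k (Finsupp.single (Sum.inr (l, n) : E ⊕ L × ℕ+) a) =
      Finsupp.single (Sum.inr (l, k * n)) a := by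
  rw [adamsMon, Finsupp.sum_single_index] <;> simp

theorem adamsMon_apply_inl (k : ℕ+) (m : (E ⊕ L × ℕ+) →₀ ℕ) (e : E) :
    adamsMon k m (Sum.inl e) = k * m (Sum.inl e) := by
  classical
  induction m using Finsupp.induction_linear with
  | zero => simp [adamsMon_zero]
  | add f g hf hg => rw [adamsMon_add, Finsupp.add_apply, hf, hg, Finsupp.add_apply, mul_add]
  | single x a =>
    rcases x with e' | ⟨l, n⟩
    · rw [adamsMon_single_inl, Finsupp.single_apply, Finsupp.single_apply]
      split_ifs <;> simp
    · rw [adamsMon_single_inr]; simp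

theorem adamsMon_apply_inr (k : ℕ+) (m : (E ⊕ L × ℕ+) →₀ ℕ) (l : L) (n : ℕ+) :
    adamsMon k m (Sum.inr (l, k * n)) = m (Sum.inr (l, n)) := by
  classical
  induction m using Finsupp.induction_linear with
  | zero => simp [adamsMon_zero]
  | add f g hf hg => rw [adamsMon_add, Finsupp.add_apply, hf, hg, Finsupp.add_apply]
  | single x a =>
    rcases x with e' | ⟨l, n⟩
    · rw [adamsMon_single_inl]; simp
    · rw [adamsMon_single_inr, Finsupp.single_apply, Finsupp.single_apply]
      simp

theorem adamsMon_injective (k : ℕ+) :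
    Function.Injective (adamsMon k : ((E ⊕ L × ℕ+) →₀ ℕ) → (E ⊕ L × ℕ+) →₀ ℕ) := by
  intro m m' h
  ext x
  rcases x with e | ⟨l, n⟩
  · have := adamsMon_apply_inl k m e
    rw [h, adamsMon_apply_inl] at this
    exact (Nat.eq_of_mul_eq_mul_left k.pos this).symm
  · rw [← adamsMon_apply_inr k m, h, adamsMon_apply_inr]

theorem adams_monomial (k : ℕ+) (m : (E ⊕ L × ℕ+) →₀ ℕ) (c : K) :
    adams k (MvPowerSeries.monomial m c) =
      MvPowerSeries.monomial (adamsMon k m) (adamsK k c) := by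
  classical
  ext m'
  have h0 : MvPowerSeries.coeff m' (adams k (MvPowerSeries.monomial m c)) =
    Function.extend (adamsMon k) (fun m₀ => adamsK k (MvPowerSeries.coeff m₀
      (MvPowerSeries.monomial m c))) (fun _ => 0) m' := rfl
  rw [h0]
  by_cases h : ∃ m₀, adamsMon k m₀ = m'
  · obtain ⟨m₀, rfl⟩ := h
    rw [(adamsMon_injective k).extend_apply, MvPowerSeries.coeff_monomial,
      MvPowerSeries.coeff_monomial]
    simp only [(adamsMon_injective k).eq_iff]
    split_ifs <;> simp
  · rw [Function.extend_apply' _ _ _ h, MvPowerSeries.coeff_monomial, if_neg]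
    rintro rfl
    exact h ⟨m, rfl⟩

theorem adamsK_qHalf (k : ℕ+) : adamsK k qHalf = qHalf ^ (k : ℕ) := by
  have h := RatFunc.map_apply_div (Polynomial.expand ℚ (k : ℕ)) (fun p hp => by
    rw [Submonoid.mem_comap, mem_nonZeroDivisors_iff_ne_zero]
    exact (Polynomial.expand_ne_zero k.pos).2 (mem_nonZeroDivisors_iff_ne_zero.1 hp))
    Polynomial.X 1
  simp only [map_one, div_one, RatFunc.algebraMap_X, Polynomial.expand_X, map_pow] at h
  exact h

theorem adamsK_inv_qInt (k : ℕ+) : adamsK k (qInt 1)⁻¹ = aRho k := by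
  simp [qInt, aRho, adamsK_qHalf]

/-- `x` is a term `c m` with a monomial `m`, and `Y k` is its image under the Adams operation. -/
def IsAdams (x : Ser E L) (Y : ℕ+ → Ser E L) : Prop :=
  ∃ m c, x = MvPowerSeries.monomial m c ∧
    ∀ k, Y k = MvPowerSeries.monomial (adamsMon k m) (adamsK k c)

theorem IsAdams.mul {x x' : Ser E L} {Y Y' : ℕ+ → Ser E L} (h : IsAdams x Y)
    (h' : IsAdams x' Y') : IsAdams (x * x') (Y * Y') := by
  obtain ⟨m, c, rfl, hY⟩ := h
  obtain ⟨m', c', rfl, hY'⟩ := h'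
  refine ⟨m + m', c * c', MvPowerSeries.monomial_mul_monomial _ _ _ _, fun k => ?_⟩
  rw [Pi.mul_apply, hY, hY', MvPowerSeries.monomial_mul_monomial, adamsMon_add, (adamsK k).map_mul]

theorem IsAdams.neg {x : Ser E L} {Y : ℕ+ → Ser E L} (h : IsAdams x Y) : IsAdams (-x) (-Y) := by
  obtain ⟨m, c, rfl, hY⟩ := h
  exact ⟨m, -c, (map_neg _ _).symm, fun k => by rw [Pi.neg_apply, hY, map_neg, map_neg]⟩

theorem isAdams_C (c : K) :
    IsAdams (MvPowerSeries.C c : Ser E L) fun k => MvPowerSeries.C (adamsK k c) :=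
  ⟨0, c, (MvPowerSeries.monomial_zero_eq_C_apply c).symm, fun k => by
    rw [adamsMon_zero, MvPowerSeries.monomial_zero_eq_C_apply]⟩

theorem isAdams_one : IsAdams (1 : Ser E L) 1 := by
  have h := isAdams_C (E := E) (L := L) 1
  simp only [map_one] at h
  exact h

theorem isAdams_X_inl (e : E) :
    IsAdams (MvPowerSeries.X (Sum.inl e) : Ser E L) fun k => MvPowerSeries.X (Sum.inl e) ^ (k : ℕ) :=
  ⟨Finsupp.single (Sum.inl e) 1, 1, rfl, fun k => by
    rw [adamsMon_single_inl, map_one, mul_one]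
    exact MvPowerSeries.X_pow_eq _ _⟩

theorem isAdams_X_inr (l : L) :
    IsAdams (MvPowerSeries.X (Sum.inr (l, 1)) : Ser E L) fun k => MvPowerSeries.X (Sum.inr (l, k)) :=
  ⟨Finsupp.single (Sum.inr (l, 1)) 1, 1, rfl, fun k => by
    rw [adamsMon_single_inr, mul_one, map_one]; rfl⟩

theorem IsAdams.prod {ι : Type*} (s : Finset ι) {x : ι → Ser E L} {Y : ι → ℕ+ → Ser E L}
    (h : ∀ i ∈ s, IsAdams (x i) (Y i)) : IsAdams (∏ i ∈ s, x i) (∏ i ∈ s, Y i) := by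
  classical
  induction s using Finset.induction_on with
  | empty => exact isAdams_one
  | insert a s ha ih =>
    rw [Finset.prod_insert ha, Finset.prod_insert ha]
    exact (h a (mem_insert_self _ _)).mul (ih fun i hi => h i (mem_insert_of_mem hi))

theorem IsAdams.Exp_eq [TopologicalSpace K] [DiscreteTopology K] {x : Ser E L}
    {Y : ℕ+ → Ser E L} (h : IsAdams x Y) (hY : Small serWeight Y) : Exp x = hSum Y := by
  obtain ⟨m, c, rfl, hx⟩ := h
  refine (hSum_eq_exp_subst hY fun m' => ?_).symm
  change (∑ᶠ k : ℕ+, _) = _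
  simp only [adams_monomial, hx]

/-- The signs `(-1)^{k+1}` in the definition of `Exp'` are those of the involution `om`, so it is
the same exponential at the transformed family. -/
theorem IsAdams.Exp'_eq [TopologicalSpace K] [DiscreteTopology K] {x : Ser E L}
    {Y : ℕ+ → Ser E L} (h : IsAdams x Y) (hY : Small serWeight Y) : Exp' x = hSum (om Y) := by
  obtain ⟨m, c, rfl, hx⟩ := h
  refine (hSum_eq_exp_subst (hY.mul_left fun k => (-1) ^ ((k : ℕ) + 1)) fun m' => ?_).symm
  change (∑ᶠ k : ℕ+, _) = _
  refine finsum_congr fun k => ?_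
  have h1 : ((-1 : Ser E L) ^ ((k : ℕ) + 1)) = MvPowerSeries.C ((-1) ^ ((k : ℕ) + 1)) := by simp
  rw [Pi.mul_apply, h1, ← MvPowerSeries.smul_eq_C_mul, MvPowerSeries.coeff_smul, adams_monomial, hx]
  ring

end Adams

end TopVertex
end

noncomputable section
namespace TopVertex
open Finset

/-! ### Symmetry of the pairing -/

section Symmetry

theorem hookEntry_comm (a : ℕ+ → K) (m n : ℕ) : hookEntry a m n = hookEntry a n m := by
  induction m generalizing n with
  | zero => rw [hookEntry_zero_left, hookEntry_zero_right]
  | succ m ih =>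
    rcases n with _ | n
    · rw [hookEntry_zero_left, hookEntry_zero_right]
    · rw [hookEntry_succ_succ, hookEntry_succ_succ, ih, mul_comm]

theorem vertexPairing_comm (a : ℕ+ → K) (μ ν : YoungDiagram) :
    vertexPairing a μ ν = vertexPairing a ν μ := by
  rw [vertexPairing_eq_det a (le_max_left (μ.colLen 0) (ν.colLen 0)) (le_max_right _ _),
    vertexPairing_eq_det a (le_max_right (μ.colLen 0) (ν.colLen 0)) (le_max_left _ _),
    ← Matrix.det_transpose]
  congr 1
  ext i j
  exact hookEntry_comm _ _ _

end Symmetry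

/-! ### Summation along a chain of vertices -/

section Chain

variable {σ : Type*} {w : σ → ℕ}

/-- A family of scalar power sums, seen as constant power series. -/
def constFam (a : ℕ+ → K) : ℕ+ → MvPowerSeries σ K := fun k => MvPowerSeries.C (a k)

/-- The family of all powers of a power series. -/
def powFam (t : MvPowerSeries σ K) : ℕ+ → MvPowerSeries σ K := fun k => t ^ (k : ℕ)

theorem powFam_mul (t t' : MvPowerSeries σ K) : powFam (t * t') = powFam t * powFam t' :=
  funext fun _ => mul_pow _ _ _

theorem powFam_one : powFam (1 : MvPowerSeries σ K) = 1 := funext fun _ => one_pow _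

theorem small_powFam {t : MvPowerSeries σ K} (ht : OrdGE w 1 t) : Small w (powFam t) := fun k => by
  have := ht.pow k
  rwa [one_mul] at this

/-- The product of the vertices and edges of a chain, the outer legs of which carry the partitions
`Λ 0` and `ν`. -/
def chainTerm (a : ℕ → ℕ+ → K) (t : ℕ → MvPowerSeries σ K) (n : ℕ)
    (Λ : Fin (n + 1) → YoungDiagram) (ν : YoungDiagram) : MvPowerSeries σ K :=
  (∏ e : Fin n, MvPowerSeries.C (vertexPairing (a e) (Λ e.castSucc) (Λ e.succ)) *
    t e ^ (Λ e.succ).card) * MvPowerSeries.C (vertexPairing (a n) (Λ (Fin.last n)) ν)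

theorem chainTerm_snoc (a : ℕ → ℕ+ → K) (t : ℕ → MvPowerSeries σ K) (n : ℕ)
    (Λ : Fin (n + 1) → YoungDiagram) (μ ν : YoungDiagram) :
    chainTerm a t (n + 1) (Fin.snoc (α := fun _ => YoungDiagram) Λ μ) ν =
      chainTerm a t n Λ μ * t n ^ μ.card * MvPowerSeries.C (vertexPairing (a (n + 1)) μ ν) := by
  rw [chainTerm, chainTerm, Fin.prod_univ_castSucc]
  simp only [Fin.succ_castSucc, Fin.snoc_castSucc, Fin.succ_last, Fin.snoc_last, Fin.val_castSucc,
    Fin.val_last, mul_assoc]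

/-- The sum of the parameters of the vertices, weighted by the edges behind them. -/
def rightSum (a : ℕ → ℕ+ → K) (t : ℕ → MvPowerSeries σ K) : ℕ → ℕ+ → MvPowerSeries σ K
  | 0 => constFam (a 0)
  | n + 1 => powFam (t n) * rightSum a t n + constFam (a (n + 1))

/-- The sum of the parameters of the vertices, weighted by the edges before them. -/
def leftSum (a : ℕ → ℕ+ → K) (t : ℕ → MvPowerSeries σ K) (n : ℕ) : ℕ+ → MvPowerSeries σ K :=
  ∑ v ∈ range (n + 1), powFam (∏ e ∈ range v, t e) * constFam (a v)

/-- The closed partition function of a chain. -/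
def chainNorm (a : ℕ → ℕ+ → K) (t : ℕ → MvPowerSeries σ K) : ℕ → MvPowerSeries σ K
  | 0 => 1
  | n + 1 => chainNorm a t n * hSum (constFam (a (n + 1)) * (powFam (t n) * rightSum a t n))

theorem rightSum_eq (a : ℕ → ℕ+ → K) (t : ℕ → MvPowerSeries σ K) (n : ℕ) :
    rightSum a t n = ∑ v ∈ range (n + 1), powFam (∏ e ∈ Ico v n, t e) * constFam (a v) := by
  induction n with
  | zero => simp [rightSum, powFam_one]
  | succ n ih =>
    rw [rightSum, ih, Finset.sum_range_succ _ (n + 1), Ico_self, prod_empty, powFam_one, one_mul,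
      Finset.mul_sum]
    congr 1
    refine Finset.sum_congr rfl fun v hv => ?_
    have := mem_range.1 hv
    rw [Finset.prod_Ico_succ_top (by omega), mul_comm _ (t n), powFam_mul, mul_assoc]

theorem ordGE_chainTerm {X : ℕ+ → MvPowerSeries σ K} (hX : Small w X) (a : ℕ → ℕ+ → K)
    {t : ℕ → MvPowerSeries σ K} (ht : ∀ e, OrdGE w 1 (t e)) {n : ℕ}
    (Λ : Fin (n + 1) → YoungDiagram) (ν : YoungDiagram) :
    OrdGE w (∑ i, (Λ i).card) (schurAt X (Λ 0) * chainTerm a t n Λ ν) := by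
  rw [Fin.sum_univ_succ]
  refine (hX.schurAt _).mul (OrdGE.mul_right (OrdGE.prod _ _ _ fun e _ => OrdGE.mul_left ?_ _) _)
  have := (ht e).pow (Λ e.succ).card
  rwa [one_mul] at this

theorem finite_sum_card_le {ι : Type*} [Fintype ι] (N : ℕ) :
    {Λ : ι → YoungDiagram | ∑ i, (Λ i).card ≤ N}.Finite := by
  refine (Set.Finite.pi' fun _ => finite_card_le N).subset fun Λ hΛ i => ?_
  exact (Finset.single_le_sum (f := fun i => (Λ i).card) (fun _ _ => Nat.zero_le _)
    (mem_univ i)).trans hΛ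

theorem Small.om {Y : ℕ+ → MvPowerSeries σ K} (hY : Small w Y) : Small w (om Y) :=
  hY.mul_left _

variable [TopologicalSpace K]
open scoped MvPowerSeries.WithPiTopology

theorem summable_chainTerm {X : ℕ+ → MvPowerSeries σ K} (hX : Small w X) (a : ℕ → ℕ+ → K)
    {t : ℕ → MvPowerSeries σ K} (ht : ∀ e, OrdGE w 1 (t e)) (n : ℕ) (ν : YoungDiagram) :
    Summable fun Λ : Fin (n + 1) → YoungDiagram => schurAt X (Λ 0) * chainTerm a t n Λ ν :=
  summable_of_ordGE _ finite_sum_card_le fun Λ => ordGE_chainTerm hX a ht Λ ν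

variable [DiscreteTopology K]

/-- The sum over all partitions on the inner edges and on the first leg of a chain. -/
theorem hasSum_chainTerm {X : ℕ+ → MvPowerSeries σ K} (hX : Small w X) (a : ℕ → ℕ+ → K)
    {t : ℕ → MvPowerSeries σ K} (ht : ∀ e, OrdGE w 1 (t e)) (n : ℕ) (ν : YoungDiagram) :
    HasSum (fun Λ : Fin (n + 1) → YoungDiagram => schurAt X (Λ 0) * chainTerm a t n Λ ν)
      (chainNorm a t n * hSum (leftSum a t n * X) *
        schurAt (rightSum a t n + powFam (∏ e ∈ range n, t e) * X) ν) := by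
  induction n generalizing ν with
  | zero =>
    have h := hasSum_schurAt_mul_vertexPairing hX (a 0) ν
    refine (Equiv.funUnique (Fin 1) YoungDiagram).symm.hasSum_iff.1 ?_
    simp only [chainNorm, leftSum, rightSum, zero_add, sum_range_one, range_zero, prod_empty,
      powFam_one, one_mul]
    rw [add_comm (constFam _)]
    convert! h using 1
    funext μ
    simp [chainTerm]
  | succ n ih =>
    have hs := (Equiv.summable_iff
      (Fin.snocEquiv fun _ : Fin (n + 2) => YoungDiagram)).2 (summable_chainTerm hX a ht (n + 1) ν)
    refine (Equiv.hasSum_iff (Fin.snocEquiv fun _ : Fin (n + 2) => YoungDiagram)).1 ?_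
    -- What reaches the new vertex. The constants in `rightSum` are not small by themselves; the
    -- edge parameter `t n` makes the family small, hence the sum over `μ` convergent.
    set Y := powFam (t n) * (rightSum a t n + powFam (∏ e ∈ range n, t e) * X) with hYdef
    have hY : Small w Y := (small_powFam (ht n)).mul_right _
    have hrow : ∀ μ : YoungDiagram, HasSum (fun Λ : Fin (n + 1) → YoungDiagram =>
        ((fun Λ : Fin (n + 2) → YoungDiagram => schurAt X (Λ 0) * chainTerm a t (n + 1) Λ ν) ∘
          Fin.snocEquiv fun _ : Fin (n + 2) => YoungDiagram) (μ, Λ))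
        (chainNorm a t n * hSum (leftSum a t n * X) *
          (schurAt Y μ * MvPowerSeries.C (vertexPairing (a (n + 1)) μ ν))) := by
      intro μ
      have h1 := (ih μ).mul_right (t n ^ μ.card *
        MvPowerSeries.C (vertexPairing (a (n + 1)) μ ν))
      have h2 : schurAt Y μ = t n ^ μ.card *
        schurAt (rightSum a t n + powFam (∏ e ∈ range n, t e) * X) μ := schurAt_mul_pow _ _ _
      rw [h2]
      convert! h1 using 1
      · funext Λ
        change schurAt X ((Fin.snoc (α := fun _ => YoungDiagram) Λ μ : Fin (n + 2) → _) 0) *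
          chainTerm a t (n + 1) (Fin.snoc (α := fun _ => YoungDiagram) Λ μ) ν = _
        rw [chainTerm_snoc, ← Fin.castSucc_zero, Fin.snoc_castSucc]
        ring
      · ring
    have h3 := hs.hasSum.prod_fiberwise hrow
    have h4 := (hasSum_schurAt_mul_vertexPairing hY (a (n + 1)) ν).mul_left
      (chainNorm a t n * hSum (leftSum a t n * X))
    -- The exponential produced by the new vertex splits: its pairing with earlier vertices goes to
    -- the closed part, its pairing with `X` to `leftSum`.
    have h5 : hSum ((fun k => MvPowerSeries.C (a (n + 1) k)) * Y) =
        hSum (constFam (a (n + 1)) * (powFam (t n) * rightSum a t n)) *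
          hSum (powFam (∏ e ∈ range (n + 1), t e) * constFam (a (n + 1)) * X) := by
      rw [← hSum_add (w := w)]
      · rw [prod_range_succ, powFam_mul, hYdef]
        change hSum (constFam (a (n + 1)) * _) = _
        congr 1
        ring
      · exact ((small_powFam (ht n)).mul_right _).mul_left _
      · exact hX.mul_left _
    have h6 : hSum (leftSum a t (n + 1) * X) = hSum (leftSum a t n * X) *
        hSum (powFam (∏ e ∈ range (n + 1), t e) * constFam (a (n + 1)) * X) := by
      rw [← hSum_add (hX.mul_left _) (hX.mul_left _), leftSum, sum_range_succ, add_mul, leftSum]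
    have h7 : rightSum a t (n + 1) + powFam (∏ e ∈ range (n + 1), t e) * X =
        Y + fun k => MvPowerSeries.C (a (n + 1) k) := by
      rw [rightSum, hYdef, prod_range_succ, powFam_mul]
      change _ = _ + constFam (a (n + 1))
      ring
    rw [h6, h7, chainNorm]
    have h8 := h3.unique h4
    have h9 := hs.hasSum
    rw [h8, h5] at h9
    convert! h9 using 1
    ring

/-- The sum over all partitions on the inner edges and on both legs of a chain. -/
theorem hasSum_chainTerm_mul {X Y : ℕ+ → MvPowerSeries σ K} (hX : Small w X) (hY : Small w Y)
    (a : ℕ → ℕ+ → K) {t : ℕ → MvPowerSeries σ K} (ht : ∀ e, OrdGE w 1 (t e)) (n : ℕ) :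
    HasSum (fun x : YoungDiagram × (Fin (n + 1) → YoungDiagram) =>
        schurAt X (x.2 0) * chainTerm a t n x.2 x.1.transpose * schurAt Y x.1)
      (chainNorm a t n * hSum (leftSum a t n * X) *
        hSum (om Y * (rightSum a t n + powFam (∏ e ∈ range n, t e) * X))) := by
  have hs : Summable fun x : YoungDiagram × (Fin (n + 1) → YoungDiagram) =>
      schurAt X (x.2 0) * chainTerm a t n x.2 x.1.transpose * schurAt Y x.1 := by
    refine summable_of_ordGE (w := w) (fun x => (∑ i, (x.2 i).card) + x.1.card) (fun N => ?_)
      fun x => (ordGE_chainTerm hX a ht _ _).mul (hY.schurAt _)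
    refine ((finite_card_le N).prod (finite_sum_card_le N)).subset fun x hx => ?_
    have : (∑ i, (x.2 i).card) + x.1.card ≤ N := hx
    exact ⟨show x.1.card ≤ N by omega, show ∑ i, (x.2 i).card ≤ N by omega⟩
  have h1 := hs.hasSum.prod_fiberwise fun μ =>
    (hasSum_chainTerm hX a ht n μ.transpose).mul_right (schurAt Y μ)
  -- The outer leg carries the transpose of the partition at the second brane, so the Cauchy
  -- identity is used with `om Y` and summed over transposes.
  have h2 := ((YoungDiagram.transposeOrderIso.toEquiv.hasSum_iff).2
    (hasSum_schurAt_mul_schurAt hY.om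
      (rightSum a t n + powFam (∏ e ∈ range n, t e) * X))).mul_left
        (chainNorm a t n * hSum (leftSum a t n * X))
  have h3 := hs.hasSum
  have h4 : (fun μ => chainNorm a t n * hSum (leftSum a t n * X) *
      schurAt (rightSum a t n + powFam (∏ e ∈ range n, t e) * X) μ.transpose * schurAt Y μ) =
      fun μ => chainNorm a t n * hSum (leftSum a t n * X) *
        ((fun μ => schurAt (om Y) μ * schurAt
          (rightSum a t n + powFam (∏ e ∈ range n, t e) * X) μ) ∘
            YoungDiagram.transposeOrderIso.toEquiv) μ := by
    funext μ
    have : YoungDiagram.transposeOrderIso.toEquiv μ = μ.transpose := rfl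
    rw [Function.comp_apply, this, schurAt_transpose (om Y), om_om]
    ring
  rw [h4] at h1
  rwa [h1.unique h2] at h3

end Chain

end TopVertex
end

noncomputable section
namespace TopVertex
open Finset

/-! ### Partition functions as convergent sums over labellings -/

section Labellings

theorem hasSum_of_eq_sum {ι M : Type*} [AddCommMonoid M] [TopologicalSpace M] {f : ι → M} {b : M}
    (s : Finset ι) (h : b = ∑ x ∈ s, f x) (hf : ∀ x ∉ s, f x = 0) : HasSum f b := by
  rw [h]
  exact hasSum_sum_of_ne_finset_zero hf

variable {E L : Type}

/-- The power sums of a brane. -/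
def braneFam (l : L) : ℕ+ → Ser E L := fun k => MvPowerSeries.X (Sum.inr (l, k))

theorem small_braneFam (l : L) : Small serWeight (braneFam l : ℕ+ → Ser E L) := by
  classical
  intro k m hm
  rw [braneFam, MvPowerSeries.coeff_X, if_neg]
  rintro rfl
  simp [Finsupp.weight_single, serWeight] at hm

theorem inr_injective (l : L) :
    Function.Injective fun k : ℕ+ => (Sum.inr (l, k) : E ⊕ L × ℕ+) :=
  fun _ _ h => (Prod.mk.inj (Sum.inr.inj h)).2

theorem legDegree_eq [DecidableEq L] (m : (E ⊕ L × ℕ+) →₀ ℕ) (l : L) :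
    FTCY.legDegree m l = wt (FTCY.legPart m l) := by
  classical
  induction m using Finsupp.induction_linear with
  | zero =>
    have : FTCY.legPart (0 : (E ⊕ L × ℕ+) →₀ ℕ) l = 0 := by ext; rfl
    rw [this]; simp [FTCY.legDegree, wt]
  | add f g hf hg =>
    have h1 : FTCY.legPart (f + g) l = FTCY.legPart f l + FTCY.legPart g l := by ext; rfl
    rw [h1, wt_add, ← hf, ← hg]
    refine Finsupp.sum_add_index' (fun x => ?_) fun x a b => ?_
    · rcases x with e | y <;> simp
    · rcases x with e | y
      · simp
      · simp only [Sum.elim_inr]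
        split_ifs <;> ring
  | single x a =>
    rw [FTCY.legDegree, Finsupp.sum_single_index]
    · rcases x with e | ⟨l', k⟩
      · have : FTCY.legPart (Finsupp.single (Sum.inl e : E ⊕ L × ℕ+) a) l = 0 := by
          ext k
          change Finsupp.single (Sum.inl e : E ⊕ L × ℕ+) a (Sum.inr (l, k)) = 0
          simp
        rw [this]; simp [wt]
      · simp only [Sum.elim_inr]
        split_ifs with h
        · subst h
          have : FTCY.legPart (Finsupp.single (Sum.inr (l', k) : E ⊕ L × ℕ+) a) l' =
              Finsupp.single k a := by
            ext k'
            change Finsupp.single (Sum.inr (l', k) : E ⊕ L × ℕ+) a (Sum.inr (l', k')) = _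
            rw [Finsupp.single_apply, Finsupp.single_apply]
            simp
          rw [this, wt_single, mul_comm]
        · have : FTCY.legPart (Finsupp.single (Sum.inr (l', k) : E ⊕ L × ℕ+) a) l = 0 := by
            ext k'
            change Finsupp.single (Sum.inr (l', k) : E ⊕ L × ℕ+) a (Sum.inr (l, k')) = 0
            rw [Finsupp.single_apply, if_neg]
            simp [h]
          rw [this]; simp [wt]
    · rcases x with e | y <;> simp

variable [Fintype E] [Fintype L]

/-- The exponent with given edge exponents and given parts at the branes. -/
def assemble (f : E → ℕ) (r : L → ℕ+ →₀ ℕ) : (E ⊕ L × ℕ+) →₀ ℕ :=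
  (∑ e, Finsupp.single (Sum.inl e) (f e)) +
    ∑ l, (r l).mapDomain fun k => (Sum.inr (l, k) : E ⊕ L × ℕ+)

theorem assemble_inl (f : E → ℕ) (r : L → ℕ+ →₀ ℕ) (e : E) :
    assemble f r (Sum.inl e) = f e := by
  classical
  rw [assemble, Finsupp.add_apply, Finsupp.finsetSum_apply, Finsupp.finsetSum_apply,
    Finset.sum_eq_zero (s := (univ : Finset L)), add_zero]
  · simp [Finsupp.single_apply]
  · intro l _
    refine Finsupp.mapDomain_of_notMem_range _ _ ?_
    rintro ⟨k, hk⟩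
    cases hk

theorem legPart_assemble (f : E → ℕ) (r : L → ℕ+ →₀ ℕ) (l : L) :
    FTCY.legPart (assemble f r) l = r l := by
  classical
  ext k
  change assemble f r (Sum.inr (l, k)) = r l k
  rw [assemble, Finsupp.add_apply, Finsupp.finsetSum_apply, Finsupp.finsetSum_apply,
    Finset.sum_eq_zero (s := (univ : Finset E)), zero_add, Finset.sum_eq_single l]
  · exact Finsupp.mapDomain_apply (inr_injective l) _ _
  · intro l' _ hl
    refine Finsupp.mapDomain_of_notMem_range _ _ ?_
    rintro ⟨k', hk⟩
    exact hl (Prod.mk.inj (Sum.inr.inj hk)).1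
  · simp
  · intro e _
    simp

theorem eq_assemble_iff (f : E → ℕ) (r : L → ℕ+ →₀ ℕ) (m : (E ⊕ L × ℕ+) →₀ ℕ) :
    m = assemble f r ↔ (∀ e, m (Sum.inl e) = f e) ∧ ∀ l, FTCY.legPart m l = r l := by
  constructor
  · rintro rfl
    exact ⟨assemble_inl f r, legPart_assemble f r⟩
  · rintro ⟨h1, h2⟩
    ext x
    rcases x with e | ⟨l, k⟩
    · rw [h1, assemble_inl]
    · have h3 := h2 l
      rw [← legPart_assemble f r l] at h3
      exact DFunLike.congr_fun h3 k

theorem monomial_assemble (f : E → ℕ) (r : L → ℕ+ →₀ ℕ) :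
    (MvPowerSeries.monomial (assemble f r) (1 : K) : Ser E L) =
      (∏ e, MvPowerSeries.X (Sum.inl e) ^ f e) * ∏ l, (r l).prod fun k c => braneFam l k ^ c := by
  classical
  have h1 : (∏ e, MvPowerSeries.X (Sum.inl e) ^ f e : Ser E L) =
      MvPowerSeries.monomial (∑ e, Finsupp.single (Sum.inl e) (f e)) 1 := by
    simp only [MvPowerSeries.X_pow_eq, MvPowerSeries.prod_monomial, prod_const_one]
  have h2 : ∀ l, ((r l).prod fun k c => braneFam l k ^ c : Ser E L) =
      MvPowerSeries.monomial ((r l).mapDomain fun k => Sum.inr (l, k)) 1 := by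
    intro l
    rw [MvPowerSeries.monomial_one_eq, Finsupp.prod_mapDomain_index_inj (inr_injective l)]
    rfl
  simp only [h1, h2, MvPowerSeries.prod_monomial, MvPowerSeries.monomial_mul_monomial,
    prod_const_one, mul_one, assemble]

/-- The coefficients of one term of a partition function. -/
theorem coeff_labelling (f : E → ℕ) (mu : L → YoungDiagram) (m : (E ⊕ L × ℕ+) →₀ ℕ) :
    MvPowerSeries.coeff m ((∏ e, MvPowerSeries.X (Sum.inl e) ^ f e) *
      ∏ l, schurAt (braneFam l) (mu l) : Ser E L) =
    if ∀ e, m (Sum.inl e) = f e then ∏ l, MvPolynomial.coeff (FTCY.legPart m l) (schur (mu l))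
      else 0 := by
  classical
  simp only [schurAt_eq_sum, Finset.prod_univ_sum, Finset.mul_sum, map_sum]
  have h1 : ∀ r : L → ℕ+ →₀ ℕ, MvPowerSeries.coeff m ((∏ e, MvPowerSeries.X (Sum.inl e) ^ f e) *
      ∏ l, MvPolynomial.coeff (r l) (schur (mu l)) •
        ((r l).prod fun k c => braneFam l k ^ c : Ser E L)) =
      if r = FTCY.legPart m then (if ∀ e, m (Sum.inl e) = f e then
        ∏ l, MvPolynomial.coeff (FTCY.legPart m l) (schur (mu l)) else 0) else 0 := by
    intro r
    rw [Finset.prod_smul, mul_smul_comm, ← monomial_assemble, MvPowerSeries.coeff_smul,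
      MvPowerSeries.coeff_monomial]
    have h2 := eq_assemble_iff f r m
    by_cases h : m = assemble f r
    · have h3 := h2.1 h
      have h4 : r = FTCY.legPart m := funext fun l => (h3.2 l).symm
      rw [if_pos h, if_pos h4, if_pos h3.1, mul_one, h4]
    · rw [if_neg h, mul_zero]
      by_cases h4 : r = FTCY.legPart m
      · rw [if_pos h4, if_neg]
        exact fun h5 => h (h2.2 ⟨h5, fun l => by rw [h4]⟩)
      · rw [if_neg h4]
  simp only [h1]
  rw [Finset.sum_ite_eq']
  split_ifs with h2 h3 h3
  · rfl
  · rfl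
  · obtain ⟨l, hl⟩ : ∃ l, wt (FTCY.legPart m l) ≠ (mu l).card := by
      by_contra! hc
      exact h2 (Fintype.mem_piFinset.2 fun l => mem_monomialsOf.2 (hc l))
    exact (Finset.prod_eq_zero (mem_univ l) (coeff_schur_of_ne hl)).symm
  · rfl

variable {V : Type} [Fintype V] [DecidableEq E] [TopologicalSpace K]
open scoped MvPowerSeries.WithPiTopology

theorem hasSum_partitionFunction [DecidableEq L] (X : FTCY V E L) :
    HasSum (fun x : (E → YoungDiagram) × (L → YoungDiagram) =>
      (MvPowerSeries.C (X.weight x.1 x.2) * ((∏ e, MvPowerSeries.X (Sum.inl e) ^ (x.1 e).card) *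
        ∏ l, schurAt (braneFam l) (x.2 l)) : Ser E L)) X.partitionFunction := by
  classical
  refine MvPowerSeries.WithPiTopology.hasSum_iff_hasSum_coeff.2 fun m => ?_
  have h1 : MvPowerSeries.coeff m X.partitionFunction = ∑ x ∈
      Fintype.piFinset (fun e => partitionsOf (m (Sum.inl e))) ×ˢ
        Fintype.piFinset (fun l => partitionsOf (FTCY.legDegree m l)),
      X.weight x.1 x.2 * ∏ l, MvPolynomial.coeff (FTCY.legPart m l) (schur (x.2 l)) := by
    rw [Finset.sum_product]
    rfl
  simp only [← MvPowerSeries.smul_eq_C_mul, MvPowerSeries.coeff_smul, coeff_labelling]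
  refine hasSum_of_eq_sum
    (Fintype.piFinset (fun e => partitionsOf (m (Sum.inl e))) ×ˢ
        Fintype.piFinset (fun l => partitionsOf (FTCY.legDegree m l))) (h1.trans ?_) ?_
  · refine Finset.sum_congr rfl fun x hx => ?_
    rw [if_pos]
    intro e
    exact (mem_partitionsOf.1 (Fintype.mem_piFinset.1 (mem_product.1 hx).1 e)).symm
  · intro x hx
    split_ifs with h
    -- The edge sizes match the exponents, so some brane partition has the wrong size, and its Schur
    -- function has no such coefficient by homogeneity.
    · obtain ⟨l, hl⟩ : ∃ l, wt (FTCY.legPart m l) ≠ (x.2 l).card := by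
        by_contra! hc
        refine hx (mem_product.2 ⟨Fintype.mem_piFinset.2 fun e => mem_partitionsOf.2 (h e).symm,
          Fintype.mem_piFinset.2 fun l => mem_partitionsOf.2 ?_⟩)
        rw [legDegree_eq, hc]
      rw [Finset.prod_eq_zero (mem_univ l) (coeff_schur_of_ne hl), mul_zero]
    · rw [mul_zero]

theorem hasSum_closedPartitionFunction (X : FTCY V E L) :
    HasSum (fun lam : E → YoungDiagram => (MvPowerSeries.C (X.weight lam fun _ => ⊥) *
      ∏ e, MvPowerSeries.X (Sum.inl e) ^ (lam e).card : Ser E L)) X.closedPartitionFunction := by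
  classical
  refine MvPowerSeries.WithPiTopology.hasSum_iff_hasSum_coeff.2 fun m => ?_
  have h1 : MvPowerSeries.coeff m X.closedPartitionFunction = ∑ lam ∈
      Fintype.piFinset (fun e => partitionsOf (m (Sum.inl e))),
      X.weight lam (fun _ => ⊥) * if ∀ l, FTCY.legPart m l = 0 then 1 else 0 := by
    change (if _ then _ else _) = _
    split_ifs <;> simp
  have h2 : ∀ lam : E → YoungDiagram, MvPowerSeries.coeff m
      (∏ e, MvPowerSeries.X (Sum.inl e) ^ (lam e).card : Ser E L) =
      if ∀ e, m (Sum.inl e) = (lam e).card then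
        (if ∀ l, FTCY.legPart m l = 0 then 1 else 0) else 0 := by
    intro lam
    have h := coeff_labelling (fun e => (lam e).card) (fun _ : L => ⊥) m
    simp only [schurAt_bot, prod_const_one, mul_one, schur_bot, MvPolynomial.coeff_one] at h
    rw [h]
    congr 1
    rw [Finset.prod_ite_zero]
    simp [eq_comm]
  simp only [← MvPowerSeries.smul_eq_C_mul, MvPowerSeries.coeff_smul, h2]
  refine hasSum_of_eq_sum (Fintype.piFinset (fun e => partitionsOf (m (Sum.inl e))))
    (h1.trans ?_) ?_
  · refine Finset.sum_congr rfl fun x hx => ?_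
    rw [if_pos (c := ∀ e, m (Sum.inl e) = (x e).card)]
    intro e
    exact (mem_partitionsOf.1 (Fintype.mem_piFinset.1 hx e)).symm
  · intro x hx
    rw [if_neg, mul_zero]
    exact fun h => hx (Fintype.mem_piFinset.2 fun e => mem_partitionsOf.2 (h e).symm)

end Labellings

end TopVertex
end

noncomputable section
namespace TopVertex
open Finset

/-! ### The strip as a chain -/

section StripWeight

variable {n : ℕ}

/-- The sign attached to the type of a vertex. -/
def VertexType.sgn : VertexType → ℤˣ
  | .A => 1
  | .B => -1

/-- The power sums attached to the type of a vertex. -/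
def VertexType.param : VertexType → ℕ+ → K
  | .A => aRho
  | .B => om aRho

/-- The partitions on the left half-edges, given those on the first halves of the edges. -/
def leftLabel (lam : Fin n → YoungDiagram) (μ : YoungDiagram) : Fin (n + 1) → YoungDiagram :=
  Fin.cons μ fun e => (lam e).transpose

/-- The partitions on the right half-edges. -/
def rightLabel (lam : Fin n → YoungDiagram) (μ : YoungDiagram) : Fin (n + 1) → YoungDiagram :=
  Fin.snoc lam μ

theorem label_left (ty : Fin (n + 1) → VertexType) (lam : Fin n → YoungDiagram)
    (mu : Fin 2 → YoungDiagram) (v : Fin (n + 1)) :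
    (strip ty).label lam mu (v, leftIdx (ty v)) = leftLabel lam (mu 0) v := by
  have h : (strip ty).slot (v, leftIdx (ty v)) =
      Fin.cases (motive := fun _ => Slot (Fin n) (Fin 2)) (.brane 0) (fun e => .target e) v :=
    if_pos rfl
  rw [FTCY.label, h]
  induction v using Fin.cases <;> rfl

theorem label_right (ty : Fin (n + 1) → VertexType) (lam : Fin n → YoungDiagram)
    (mu : Fin 2 → YoungDiagram) (v : Fin (n + 1)) :
    (strip ty).label lam mu (v, rightIdx (ty v)) = rightLabel lam (mu 1) v := by
  have h : (strip ty).slot (v, rightIdx (ty v)) = Fin.lastCases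
      (motive := fun _ => Slot (Fin n) (Fin 2)) (.brane 1) (fun e => .source e) v :=
    (if_neg (leftIdx_ne_rightIdx _).symm).trans (if_pos rfl)
  rw [FTCY.label, h]
  induction v using Fin.lastCases <;> simp [rightLabel]

theorem label_vertical (ty : Fin (n + 1) → VertexType) (lam : Fin n → YoungDiagram)
    (mu : Fin 2 → YoungDiagram) (v : Fin (n + 1)) :
    (strip ty).label lam mu (v, 2) = ⊥ := by
  have h : (strip ty).slot (v, 2) = .free := by
    change stripSlot ty (v, 2) = _
    unfold stripSlot leftIdx rightIdx
    cases ty v <;> rfl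
  rw [FTCY.label, h]

/-- A vertex of a strip. -/
theorem framedVertexC_strip (ty : Fin (n + 1) → VertexType) (lam : Fin n → YoungDiagram)
    (mu : Fin 2 → YoungDiagram) (v : Fin (n + 1)) :
    framedVertexC (fun i => (strip ty).framing (v, i)) (fun i => (strip ty).label lam mu (v, i)) =
      vertexPairing (ty v).param (leftLabel lam (mu 0) v) (rightLabel lam (mu 1) v).transpose := by
  have hf : (fun i => (strip ty).framing (v, i)) = ![-1, 0, 0] := by
    funext i
    fin_cases i <;> rfl
  have h1 := label_left ty lam mu v
  have h2 := label_right ty lam mu v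
  have h3 := label_vertical ty lam mu v
  rw [hf]
  cases h : ty v with
  | A =>
    rw [h] at h1 h2
    have hl : (fun i => (strip ty).label lam mu (v, i)) =
        ![rightLabel lam (mu 1) v, leftLabel lam (mu 0) v, ⊥] := by
      funext i
      fin_cases i
      · exact h2
      · exact h1
      · exact h3
    rw [hl, framedVertexC_eq]
    rfl
  | B =>
    rw [h] at h1 h2
    have hl : (fun i => (strip ty).label lam mu (v, i)) =
        ![leftLabel lam (mu 0) v, rightLabel lam (mu 1) v, ⊥] := by
      funext i
      fin_cases i
      · exact h1
      · exact h2
      · exact h3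
    -- At type `B` the left edge comes first in the cyclic order; symmetry restores left and right,
    -- and `ω` absorbs the transposes.
    rw [hl, framedVertexC_eq, vertexPairing_comm, VertexType.param, vertexPairing_om,
      YoungDiagram.transpose_transpose]

theorem edgeSign_strip (ty : Fin (n + 1) → VertexType) (e : Fin n) :
    (-1 : K) ^ ((strip ty).framing ((strip ty).src e) + (strip ty).framing ((strip ty).tgt e) + 1) =
      (((ty e.castSucc).sgn * (ty e.succ).sgn : ℤˣ) : ℤ) := by
  change (-1 : K) ^ ((if rightIdx (ty e.castSucc) = 0 then (-1 : ℤ) else 0) +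
    (if leftIdx (ty e.succ) = 0 then (-1 : ℤ) else 0) + 1) = _
  cases ty e.castSucc <;> cases ty e.succ <;> simp [leftIdx, rightIdx, VertexType.sgn]

/-- The parameters of the vertices of a strip. -/
def stripParam (ty : Fin (n + 1) → VertexType) (v : ℕ) : ℕ+ → K :=
  if h : v < n + 1 then (ty ⟨v, h⟩).param else 0

/-- The Kähler parameters of the edges of a strip, with the signs of the edges. -/
def stripEdge (ty : Fin (n + 1) → VertexType) (e : ℕ) : Ser (Fin n) (Fin 2) :=
  if h : e < n then
    ((((ty (Fin.castSucc ⟨e, h⟩)).sgn * (ty (Fin.succ ⟨e, h⟩)).sgn : ℤˣ) : ℤ) : Ser (Fin n) (Fin 2)) *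
      MvPowerSeries.X (Sum.inl ⟨e, h⟩)
  else 0

theorem stripParam_val (ty : Fin (n + 1) → VertexType) (v : Fin (n + 1)) :
    stripParam ty v = (ty v).param := dif_pos v.isLt

theorem stripEdge_val (ty : Fin (n + 1) → VertexType) (e : Fin n) :
    stripEdge ty e = ((((ty e.castSucc).sgn * (ty e.succ).sgn : ℤˣ) : ℤ) : Ser (Fin n) (Fin 2)) *
      MvPowerSeries.X (Sum.inl e) := dif_pos e.isLt

theorem ordGE_stripEdge (ty : Fin (n + 1) → VertexType) (e : ℕ) :
    OrdGE serWeight 1 (stripEdge ty e) := by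
  classical
  rw [stripEdge]
  split_ifs with h
  · refine OrdGE.mul_left (fun m hm => ?_) _
    rw [MvPowerSeries.coeff_X, if_neg]
    rintro rfl
    simp [Finsupp.weight_single, serWeight] at hm
  · exact fun m _ => rfl

/-- The pairing at `v_k` sees the transpose of the partition on the right, which is precisely the
label on the left of `v_{k+1}`; transposition does not change the size, so the exponent of the edge
parameter agrees. -/
theorem weight_strip (ty : Fin (n + 1) → VertexType) (lam : Fin n → YoungDiagram)
    (mu : Fin 2 → YoungDiagram) :
    (MvPowerSeries.C ((strip ty).weight lam mu) *
      ∏ e, MvPowerSeries.X (Sum.inl e) ^ (lam e).card : Ser (Fin n) (Fin 2)) =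
    chainTerm (stripParam ty) (stripEdge ty) n (leftLabel lam (mu 0)) (mu 1).transpose := by
  rw [FTCY.weight, chainTerm]
  simp only [framedVertexC_strip, edgeSign_strip]
  rw [Fin.prod_univ_castSucc]
  have h1 : ∀ e : Fin n, stripParam ty e = (ty e.castSucc).param :=
    fun e => stripParam_val ty e.castSucc
  have h2 : stripParam ty n = (ty (Fin.last n)).param := stripParam_val ty (Fin.last n)
  simp only [h1, h2, stripEdge_val, rightLabel, Fin.snoc_castSucc, Fin.snoc_last,
    map_mul, map_prod, map_pow, map_intCast, mul_pow, Finset.prod_mul_distrib, leftLabel,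
    Fin.cons_succ, card_transpose]
  ring

/-- The partitions on the left half-edges and at the second brane. -/
def labelEquiv : (Fin n → YoungDiagram) × (Fin 2 → YoungDiagram) ≃
    YoungDiagram × (Fin (n + 1) → YoungDiagram) where
  toFun x := (x.2 1, leftLabel x.1 (x.2 0))
  invFun y := (fun e => (y.2 e.succ).transpose, ![y.2 0, y.1])
  left_inv x := by
    ext1
    · funext e
      simp [leftLabel]
    · funext i
      fin_cases i <;> rfl
  right_inv y := by
    ext1
    · rfl
    · funext i
      induction i using Fin.cases <;> simp [leftLabel]

theorem schurAt_zero_of_ne_bot {R : Type*} [CommRing R] [Algebra K R] {μ : YoungDiagram}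
    (h : μ ≠ ⊥) : schurAt (0 : ℕ+ → R) μ = 0 := by
  have h1 := schurAt_mul_pow (0 : R) (0 : ℕ+ → R) μ
  rw [zero_pow (mt card_eq_zero_iff.1 h), zero_mul] at h1
  rw [← h1]
  congr 1
  funext k
  simp

variable [TopologicalSpace K] [DiscreteTopology K]
open scoped MvPowerSeries.WithPiTopology

/-- The brane alphabets are left general so that the power sums give the full partition function and
the zero alphabets the closed one. -/
theorem hasSum_strip (ty : Fin (n + 1) → VertexType) {X Y : ℕ+ → Ser (Fin n) (Fin 2)}
    (hX : Small serWeight X) (hY : Small serWeight Y) :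
    HasSum (fun x : (Fin n → YoungDiagram) × (Fin 2 → YoungDiagram) =>
      (MvPowerSeries.C ((strip ty).weight x.1 x.2) *
        ∏ e, MvPowerSeries.X (Sum.inl e) ^ (x.1 e).card : Ser (Fin n) (Fin 2)) *
          (schurAt X (x.2 0) * schurAt Y (x.2 1)))
      (chainNorm (stripParam ty) (stripEdge ty) n *
        hSum (leftSum (stripParam ty) (stripEdge ty) n * X) *
        hSum (om Y * (rightSum (stripParam ty) (stripEdge ty) n +
          powFam (∏ e ∈ range n, stripEdge ty e) * X))) := by
  have h := labelEquiv.hasSum_iff.2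
    (hasSum_chainTerm_mul hX hY (stripParam ty) (ordGE_stripEdge ty) n)
  convert! h using 1
  funext x
  rw [weight_strip]
  change _ = schurAt X (x.2 0) * chainTerm _ _ _ (leftLabel x.1 (x.2 0)) (x.2 1).transpose *
    schurAt Y (x.2 1)
  ring

theorem partitionFunction_strip (ty : Fin (n + 1) → VertexType) :
    (strip ty).partitionFunction = chainNorm (stripParam ty) (stripEdge ty) n *
        hSum (leftSum (stripParam ty) (stripEdge ty) n * braneFam 0) *
        hSum (om (braneFam 1) * (rightSum (stripParam ty) (stripEdge ty) n +
          powFam (∏ e ∈ range n, stripEdge ty e) * braneFam 0)) := by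
  refine (hasSum_partitionFunction (strip ty)).unique ?_
  convert! hasSum_strip ty (small_braneFam 0) (small_braneFam 1) using 1
  funext x
  rw [Fin.prod_univ_two, mul_assoc]

theorem closedPartitionFunction_strip (ty : Fin (n + 1) → VertexType) :
    (strip ty).closedPartitionFunction = chainNorm (stripParam ty) (stripEdge ty) n := by
  have h0 : Small serWeight (0 : ℕ+ → Ser (Fin n) (Fin 2)) := fun k m _ => rfl
  have h1 := hasSum_strip ty h0 h0
  have h2 : om (0 : ℕ+ → Ser (Fin n) (Fin 2)) = 0 := funext fun k => mul_zero _
  rw [h2, mul_zero, zero_mul, hSum_zero, mul_one, mul_one] at h1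
  have hinj : Function.Injective fun lam : Fin n → YoungDiagram =>
      ((lam, fun _ => ⊥) : (Fin n → YoungDiagram) × (Fin 2 → YoungDiagram)) :=
    fun _ _ h => (Prod.mk.inj h).1
  rw [← hinj.hasSum_iff] at h1
  · refine (hasSum_closedPartitionFunction (strip ty)).unique ?_
    convert! h1 using 1
    funext lam
    simp [schurAt_bot]
  -- At the zero alphabet `s_μ` vanishes unless `μ` is empty, so exactly the closed labellings
  -- contribute.
  · rintro ⟨lam, mu⟩ h
    by_cases hm : mu 0 = ⊥ ∧ mu 1 = ⊥
    · refine absurd ⟨lam, Prod.ext rfl (funext fun i => ?_)⟩ h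
      fin_cases i
      · exact hm.1.symm
      · exact hm.2.symm
    · rcases not_and_or.1 hm with h | h <;> simp [schurAt_zero_of_ne_bot h]

end StripWeight

end TopVertex
end

noncomputable section
namespace TopVertex
open Finset

/-! ### Identification of the disk and annulus factors -/

section Factors

theorem constantCoeff_hSum {σ : Type*} {w : σ → ℕ} {Y : ℕ+ → MvPowerSeries σ K}
    (hY : Small w Y) : MvPowerSeries.constantCoeff (hSum Y) = 1 := by
  rw [← MvPowerSeries.coeff_zero_eq_constantCoeff_apply]
  change ∑ᶠ d, MvPowerSeries.coeff 0 (hAt Y d) = 1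
  rw [finsum_eq_single _ 0]
  · simp [hAt_zero]
  · intro d hd
    exact hY.hAt d 0 (by simpa using Nat.pos_of_ne_zero hd)

theorem constantCoeff_chainNorm {σ : Type*} {w : σ → ℕ} (a : ℕ → ℕ+ → K)
    {t : ℕ → MvPowerSeries σ K} (ht : ∀ e, OrdGE w 1 (t e)) (n : ℕ) :
    MvPowerSeries.constantCoeff (chainNorm a t n) = 1 := by
  induction n with
  | zero => exact map_one _
  | succ n ih =>
    rw [chainNorm, map_mul, ih,
      constantCoeff_hSum (((small_powFam (ht n)).mul_right _).mul_left _), mul_one]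

variable {n : ℕ}

theorem QProd_self (i : Fin (n + 1)) : QProd i i = 1 := by
  refine Finset.prod_eq_one fun l _ => if_neg fun h => ?_
  exact absurd (h.1.trans_lt h.2) (lt_irrefl _)

theorem QProd_succ {i : Fin (n + 1)} (j : Fin n) (h : i ≤ j.castSucc) :
    QProd i j.succ = QProd i j.castSucc * MvPowerSeries.X (Sum.inl j) := by
  have h1 : ∀ l : Fin n, (if i ≤ l.castSucc ∧ l.castSucc < j.succ then
      MvPowerSeries.X (Sum.inl l) else 1 : Ser (Fin n) (Fin 2)) =
      (if i ≤ l.castSucc ∧ l.castSucc < j.castSucc then MvPowerSeries.X (Sum.inl l) else 1) *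
        if l = j then MvPowerSeries.X (Sum.inl l) else 1 := by
    intro l
    by_cases hl : l = j
    · subst hl
      simp [h]
    · have h2 : l.castSucc < j.succ ↔ l.castSucc < j.castSucc := by
        rw [Fin.lt_def, Fin.lt_def]
        have : (l : ℕ) ≠ j := fun h => hl (Fin.ext h)
        simp only [Fin.val_castSucc, Fin.val_succ]
        omega
      simp [hl, h2]
  simp only [QProd, h1, Finset.prod_mul_distrib, Finset.prod_ite_eq', mem_univ, if_true]

/-- The product of the signed Kähler parameters between two vertices. -/
theorem prod_stripEdge (ty : Fin (n + 1) → VertexType) (i j : Fin (n + 1)) (h : i ≤ j) :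
    ∏ e ∈ Ico (i : ℕ) j, stripEdge ty e =
      ((((ty i).sgn * (ty j).sgn : ℤˣ) : ℤ) : Ser (Fin n) (Fin 2)) * QProd i j := by
  induction j using Fin.induction with
  | zero =>
    have : i = 0 := Fin.le_zero_iff.1 h
    subst this
    simp [QProd_self]
  | succ j ih =>
    rcases h.eq_or_lt with rfl | h
    · simp [QProd_self]
    · have h1 : i ≤ j.castSucc := Fin.le_castSucc_iff.2 h
      have h2 : (i : ℕ) ≤ j := h1
      rw [Fin.val_succ, Finset.prod_Ico_succ_top h2, stripEdge_val, QProd_succ j h1]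
      rw [Fin.val_castSucc] at ih
      rw [ih h1]
      have h3 : ((((ty j.castSucc).sgn : ℤˣ) : ℤ) : Ser (Fin n) (Fin 2)) *
          (((ty j.castSucc).sgn : ℤˣ) : ℤ) = 1 := by
        rw [← Int.cast_mul, ← Units.val_mul, Int.units_mul_self]
        simp
      push_cast
      linear_combination (((ty i).sgn : ℤ) : Ser (Fin n) (Fin 2)) * ((ty j.succ).sgn : ℤ) *
        QProd i j.castSucc * MvPowerSeries.X (Sum.inl j) * h3

theorem isAdams_QProd (i j : Fin (n + 1)) : IsAdams (QProd i j) (powFam (QProd i j)) := by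
  have h : powFam (QProd i j) = ∏ l : Fin n, powFam
      (if i ≤ l.castSucc ∧ l.castSucc < j then MvPowerSeries.X (Sum.inl l) else 1) := by
    funext k
    rw [Finset.prod_apply]
    exact (Finset.prod_pow _ _ _).symm
  rw [h]
  refine IsAdams.prod _ fun l _ => ?_
  split_ifs
  · exact isAdams_X_inl l
  · rw [powFam_one]; exact isAdams_one

theorem isAdams_invQ1 : IsAdams (invQ1 : Ser (Fin n) (Fin 2)) (constFam aRho) := by
  have h := isAdams_C (E := Fin n) (L := Fin 2) (qInt 1)⁻¹
  simp only [adamsK_inv_qInt] at h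
  exact h

theorem isAdams_p1 (l : Fin 2) : IsAdams (p1 l : Ser (Fin n) (Fin 2)) (braneFam l) :=
  isAdams_X_inr l

variable [TopologicalSpace K] [DiscreteTopology K]

/-- The edge signs telescope to the sign of `v`, since the first vertex has sign `+1`. For type `B`
its `k`-th power `(-1)^k` meets the `(-1)^{k+1}` of `ω`, leaving `-1` for every `k`: this is the
Adams image of `-β_k`, because `ψ_k` does not act on the sign. -/
theorem diskL1_eq (ty : Fin (n + 1) → VertexType) (hty : ty 0 = .A) (v : Fin (n + 1)) :
    diskL1 ty v = hSum (powFam (∏ e ∈ range v, stripEdge ty e) * constFam (stripParam ty v) *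
      braneFam 0) := by
  have h1 := prod_stripEdge ty 0 v (Fin.zero_le v)
  rw [Fin.val_zero, ← Finset.range_eq_Ico, hty] at h1
  have h2 := ((isAdams_QProd 0 v).mul isAdams_invQ1).mul (isAdams_p1 0)
  have h3 := ((isAdams_QProd 0 v).neg.mul isAdams_invQ1).mul (isAdams_p1 0)
  rw [h1, stripParam_val, diskL1]
  cases h : ty v with
  | A =>
    simp only
    rw [h2.Exp_eq ((small_braneFam 0).mul_left _)]
    simp [VertexType.sgn, VertexType.param]
  | B =>
    simp only
    rw [h3.Exp_eq ((small_braneFam 0).mul_left _)]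
    congr 1
    funext k
    rcases Nat.even_or_odd (k : ℕ) with hk | hk <;>
      simp [VertexType.sgn, VertexType.param, powFam, constFam, om, pow_succ, neg_pow (QProd 0 v),
        hk.neg_one_pow]

/-- Three signs compete in degree `k`: `ω` on the brane, the `k`-th power of the product of the end
signs, and `ω` in the parameter of a type `B` vertex. The result alternates in `k` exactly when the
last vertex has type `A`, which decides between `Exp'` and `Exp`. -/
theorem diskL2_eq (ty : Fin (n + 1) → VertexType) (v : Fin (n + 1)) :
    diskL2 ty v = hSum (om (braneFam 1) *
      (powFam (∏ e ∈ Ico (v : ℕ) n, stripEdge ty e) * constFam (stripParam ty v))) := by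
  have h1 := prod_stripEdge ty v (Fin.last n) (Fin.le_last v)
  rw [Fin.val_last] at h1
  have h2 := ((isAdams_QProd v (Fin.last n)).mul isAdams_invQ1).mul (isAdams_p1 1)
  have h3 := ((isAdams_QProd v (Fin.last n)).neg.mul isAdams_invQ1).mul (isAdams_p1 1)
  rw [h1, stripParam_val, diskL2]
  cases h : ty v <;> cases h' : ty (Fin.last n) <;> simp only
  · rw [h2.Exp'_eq ((small_braneFam 1).mul_left _)]
    congr 1
    funext k
    simp [VertexType.sgn, VertexType.param, powFam, constFam, om]
    ring
  · rw [h3.Exp_eq ((small_braneFam 1).mul_left _)]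
    congr 1
    funext k
    rcases Nat.even_or_odd (k : ℕ) with hk | hk <;>
      simp [VertexType.sgn, VertexType.param, powFam, constFam, om, pow_succ,
        neg_pow (QProd v (Fin.last n)), hk.neg_one_pow] <;> ring
  · rw [h3.Exp'_eq ((small_braneFam 1).mul_left _)]
    congr 1
    funext k
    rcases Nat.even_or_odd (k : ℕ) with hk | hk <;>
      simp [VertexType.sgn, VertexType.param, powFam, constFam, om, pow_succ,
        neg_pow (QProd v (Fin.last n)), hk.neg_one_pow] <;> ring
  · rw [h2.Exp_eq ((small_braneFam 1).mul_left _)]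
    congr 1
    funext k
    rcases Nat.even_or_odd (k : ℕ) with hk | hk <;>
      simp [VertexType.sgn, VertexType.param, powFam, constFam, om, pow_succ,
        hk.neg_one_pow] <;> ring

theorem annulus_eq (ty : Fin (n + 1) → VertexType) (hty : ty 0 = .A) :
    annulus ty = hSum (om (braneFam 1) *
      (powFam (∏ e ∈ range n, stripEdge ty e) * braneFam 0)) := by
  have h1 := prod_stripEdge ty 0 (Fin.last n) (Fin.zero_le _)
  rw [Fin.val_zero, Fin.val_last, ← Finset.range_eq_Ico, hty] at h1
  have h2 := ((isAdams_QProd 0 (Fin.last n)).mul (isAdams_p1 0)).mul (isAdams_p1 1)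
  have h3 := ((isAdams_QProd 0 (Fin.last n)).neg.mul (isAdams_p1 0)).mul (isAdams_p1 1)
  rw [h1, annulus]
  cases h : ty (Fin.last n) <;> simp only
  · rw [h2.Exp'_eq ((small_braneFam 1).mul_left _)]
    congr 1
    funext k
    simp [VertexType.sgn, powFam, om]
    ring
  · rw [h3.Exp_eq ((small_braneFam 1).mul_left _)]
    congr 1
    funext k
    rcases Nat.even_or_odd (k : ℕ) with hk | hk <;>
      simp [VertexType.sgn, powFam, om, pow_succ, neg_pow (QProd 0 (Fin.last n)),
        hk.neg_one_pow] <;> ring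

theorem constantCoeff_closedPartitionFunction_strip (ty : Fin (n + 1) → VertexType) :
    MvPowerSeries.constantCoeff (strip ty).closedPartitionFunction = 1 := by
  rw [closedPartitionFunction_strip]
  exact constantCoeff_chainNorm _ (ordGE_stripEdge ty) n

theorem openPartitionFunction_strip (ty : Fin (n + 1) → VertexType) (hty : ty 0 = .A) :
    (strip ty).openPartitionFunction =
      annulus ty * (∏ k, diskL1 ty k) * ∏ k, diskL2 ty k := by
  have hx : Small serWeight (braneFam 0 : ℕ+ → Ser (Fin n) (Fin 2)) := small_braneFam 0
  have hy : Small serWeight (braneFam 1 : ℕ+ → Ser (Fin n) (Fin 2)) := small_braneFam 1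
  have h0 : MvPowerSeries.constantCoeff (strip ty).closedPartitionFunction ≠ 0 := by
    rw [constantCoeff_closedPartitionFunction_strip]
    exact one_ne_zero
  have hL : hSum (leftSum (stripParam ty) (stripEdge ty) n * braneFam 0) = ∏ k, diskL1 ty k := by
    rw [leftSum, Finset.sum_range, Finset.sum_mul, hSum_sum (w := serWeight)]
    · exact Finset.prod_congr rfl fun v _ => (diskL1_eq ty hty v).symm
    · exact fun v _ => hx.mul_left _
  have hR : hSum (om (braneFam 1) * rightSum (stripParam ty) (stripEdge ty) n) =
      ∏ k, diskL2 ty k := by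
    rw [rightSum_eq, Finset.sum_range, Finset.mul_sum, hSum_sum (w := serWeight)]
    · exact Finset.prod_congr rfl fun v _ => (diskL2_eq ty v).symm
    · exact fun v _ => hy.om.mul_right _
  -- The closed partition function is a literal factor of the full one; its constant coefficient is
  -- `1`, so it cancels against its inverse.
  rw [FTCY.openPartitionFunction, partitionFunction_strip, ← closedPartitionFunction_strip,
    mul_add, hSum_add (hy.om.mul_right _) (hy.om.mul_right _), hL, hR, ← annulus_eq ty hty]
  linear_combination (annulus ty * (∏ k, diskL1 ty k) * ∏ k, diskL2 ty k) *
    MvPowerSeries.mul_inv_cancel _ h0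

end Factors

end TopVertex

end

theorem theorem5p3 (n : ℕ) (ty : Fin (n + 1) → TopVertex.VertexType)
    (hty : ty 0 = TopVertex.VertexType.A) :
    (TopVertex.strip ty).openPartitionFunction =
      TopVertex.annulus ty * (∏ k : Fin (n + 1), TopVertex.diskL1 ty k) *
        ∏ k : Fin (n + 1), TopVertex.diskL2 ty k := by
  -- The discrete topology on the scalars is only a device for infinite sums; each coefficient
  -- involves finitely many nonzero terms.
  let _ : TopologicalSpace TopVertex.K := ⊥
  have _ : DiscreteTopology TopVertex.K := ⟨rfl⟩
  exact TopVertex.openPartitionFunction_strip ty hty
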